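/- For complex $q$ with $0<|q|<1$, complex $x$ and $k\in\mathbb Z$ let $(x;q)_\infty=\prod_{i\ge 0}(1-xq^i)$ and $(x;q)_k=(x;q)_\infty/(xq^k;q)_\infty$; that is, for $n\ge 0$, $(x;q)_n=\prod_{0\le i<n}(1-xq^i)$ and $(x;q)_{-n}=1/\prod_{i=1}^{n}(1-xq^{-i})$. Put $(x_1,\dots,x_r;q)_k=(x_1;q)_k\cdots(x_r;q)_k$ for $k\in\mathbb Z\cup\{\infty\}$, and $${}_r\psi_s\left[\begin{matrix}a_1,\dots,a_r\\ b_1,\dots,b_s\end{matrix};q,z\right]=\sum_{k=-\infty}^{\infty}\frac{(a_1,\dots,a_r;q)_k}{(b_1,\dots,b_s;q)_k}\left\{(-1)^kq^{\binom k2}\right\}^{s-r}z^k,$$ $${}_r\phi_{s-1}\left[\begin{matrix}a_1,\dots,a_r\\ b_2,\dots,b_s\end{matrix};q,z\right]=\sum_{k=0}^{\infty}\frac{(a_1,\dots,a_r;q)_k}{(q,b_2,\dots,b_s;q)_k}\left\{(-1)^kq^{\binom k2}\right\}^{s-r}z^k.$$ **Theorem 3.** Let $a,b,c,d,e,f,g$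 be nonzero complex numbers with $\max\{|a^3q^2/bcdefg|,\,|aq/fg|\}<1$, let $\mu=bcde/aq$, let $a^{1/2}$ and $\mu^{1/2}$ be any square roots of $a$ and $\mu$ (with $a^{-1/2}=1/a^{1/2}$), and suppose that no denominator in the formula below vanishes (neither in the infinite-product factors nor in any term of the three series; in particular, no upper parameter of a bilateral series is $q^n$ with $n\ge1$ and no lower parameter of a series is $q^{-n}$ with $n\ge 0$). Then the three series below converge absolutely, and $$\begin{aligned} &{}_8\psi_8\left[\begin{matrix}qa^{\frac12},-qa^{\frac12},b,c,d,e,f,g\\ a^{\frac12},-a^{\frac12},aq/b,aq/c,aq/d,aq/e,aq/f,aq/g\end{matrix};q,\frac{a^3q^2}{bcdefg}\right]\\ &=\frac{(aq,q/a,aq/cd,aq/ce,aq/de,aq/fg,b/a,\mu q/c,\mu q/d,\mu q/e,aq/\mu f,aq/\mu g;q)_\infty}{(q/f,q/g,aq/c,aq/d,aq/e,bc/a,bd/a,be/a,b/\mu,\mu q,q/\mu,a^2q/\mu fg;q)_\infty}\\ &\quad\times{}_8\psi_8\left[\begin{matrix}q\mu^{\frac12},-q\mu^{\frac12},b,c,d,e,\mu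 f/a,\mu g/a\\ \mu^{\frac12},-\mu^{\frac12},\mu q/b,\mu q/c,\mu q/d,\mu q/e,aq/f,aq/g\end{matrix};q,\frac{aq}{fg}\right]\\ &\quad+\frac{(q,aq,q/a,c,d,e,bq/c,bq/d,bq/e,bq/f,bq/g;q)_\infty}{(q/f,q/g,aq/b,aq/c,aq/d,aq/e,aq/f,aq/g,bc/a,bd/a,be/a;q)_\infty}\\ &\quad\times\frac{(aq/bf,aq/bg,bcde/a^2q,a^2q^2/bcde;q)_\infty}{(q/b,b^2q/a,cde/aq,aq^2/cde;q)_\infty}\\ &\quad\times{}_8\phi_7\left[\begin{matrix}b^2/a,qba^{-\frac12},-qba^{-\frac12},bc/a,bd/a,be/a,bf/a,bg/a\\ ba^{-\frac12},-ba^{-\frac12},bq/c,bq/d,bq/e,bq/f,bq/g\end{matrix};q,\frac{a^3q^2}{bcdefg}\right]. \end{aligned}$$ (Here a slash applies to everything after it, e.g. $bcde/aq=bcde/(aq)$ and $a^2q/\mu fg=a^2q/(\mu fg)$.) -/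

import Mathlib

/-- The infinite `q`-shifted factorial `(x; q)_∞ = ∏_{i ≥ 0} (1 - x q^i)`. -/
noncomputable def qPochInf (x q : ℂ) : ℂ := ∏' i : ℕ, (1 - x * q ^ i)

/-- `(x₁, …, x_r; q)_∞ = (x₁; q)_∞ ⋯ (x_r; q)_∞`. -/
noncomputable def qPochInfs (L : List ℂ) (q : ℂ) : ℂ := (L.map fun x => qPochInf x q).prod

/-- The `q`-shifted factorial `(x; q)_k` for an integer `k`:
`(x; q)_n = ∏_{i < n} (1 - x q^i)` and
`(x; q)_{-n} = 1 / ∏_{1 ≤ i ≤ n} (1 - x q^{-i})` for natural numbers `n`.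
It equals `(x; q)_∞ / (x q^k; q)_∞` whenever that quotient is defined, see
`qPoch_eq_div` below. -/
noncomputable def qPoch (x q : ℂ) : ℤ → ℂ
  | Int.ofNat n => ∏ i ∈ Finset.range n, (1 - x * q ^ i)
  | Int.negSucc n => (∏ i ∈ Finset.range (n + 1), (1 - x / q ^ (i + 1)))⁻¹

/-- `(x₁, …, x_r; q)_k = (x₁; q)_k ⋯ (x_r; q)_k`. -/
noncomputable def qPochs (L : List ℂ) (q : ℂ) (k : ℤ) : ℂ := (L.map fun x => qPoch x q k).prod

/-- The infinite product defining `(x; q)_∞` converges for `|q| < 1`. -/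
theorem qPochInf_multipliable (x q : ℂ) (hq : ‖q‖ < 1) :
    Multipliable fun i : ℕ => 1 - x * q ^ i := by
  have h : Summable fun i : ℕ => ‖-(x * q ^ i)‖ := by
    simp only [norm_neg, norm_mul, norm_pow]
    exact (summable_geometric_of_lt_one (norm_nonneg q) hq).mul_left _
  simpa [sub_eq_add_neg] using multipliable_one_add_of_summable h

/-- Splitting off the first `n` factors of `(x; q)_∞`. -/
theorem qPochInf_eq_mul (x q : ℂ) (hq : ‖q‖ < 1) (n : ℕ) :
    qPochInf x q = (∏ i ∈ Finset.range n, (1 - x * q ^ i)) * qPochInf (x * q ^ n) q := by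
  induction n with
  | zero => simp
  | succ n ih =>
    have h : qPochInf (x * q ^ n) q = (1 - x * q ^ n) * qPochInf (x * q ^ (n + 1)) q := by
      unfold qPochInf
      rw [tprod_eq_zero_mul' (f := fun i : ℕ => 1 - x * q ^ n * q ^ i)]
      · simp [pow_succ, mul_assoc, mul_comm, mul_left_comm]
      · refine (qPochInf_multipliable (x * q ^ (n + 1)) q hq).congr fun i => ?_
        ring
    rw [ih, h, Finset.prod_range_succ, mul_assoc]

/-- `(x; q)_k = (x; q)_∞ / (x q^k; q)_∞` when the denominator does not vanish. -/
theorem qPoch_eq_div (x q : ℂ) (hq0 : q ≠ 0) (hq : ‖q‖ < 1) (k : ℤ)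
    (h : qPochInf (x * q ^ k) q ≠ 0) :
    qPoch x q k = qPochInf x q / qPochInf (x * q ^ k) q := by
  rw [eq_div_iff h]
  cases k with
  | ofNat n =>
    have := qPochInf_eq_mul x q hq n
    simpa [qPoch] using this.symm
  | negSucc n =>
    have e := qPochInf_eq_mul (x * q ^ (Int.negSucc n)) q hq (n + 1)
    have e1 : x * q ^ (Int.negSucc n) * q ^ (n + 1) = x := by
      rw [zpow_negSucc, mul_assoc, inv_mul_cancel₀ (pow_ne_zero _ hq0), mul_one]
    have e2 : (∏ i ∈ Finset.range (n + 1), (1 - x * q ^ (Int.negSucc n) * q ^ i))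
        = ∏ i ∈ Finset.range (n + 1), (1 - x / q ^ (i + 1)) := by
      rw [← Finset.prod_range_reflect]
      refine Finset.prod_congr rfl fun i hi => ?_
      have hi' : i < n + 1 := Finset.mem_range.mp hi
      have : n + 1 = (n + 1 - 1 - i) + (i + 1) := by omega
      rw [zpow_negSucc, this, pow_add]
      simp only [Nat.add_sub_cancel]
      have ea : n - i + (i + 1) - 1 - i = n - i := by omega
      rw [ea]
      field_simp
    rw [e1, e2] at e
    have hp : (∏ i ∈ Finset.range (n + 1), (1 - x / q ^ (i + 1))) ≠ 0 := by
      intro h0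
      rw [h0, zero_mul] at e
      exact h e
    rw [e]
    simp only [qPoch]
    rw [inv_mul_cancel_left₀ hp]

/-- The `k`-th term of the bilateral series with upper parameters `A` (of length `r`) and lower
parameters `B` (of length `s`):
`(A; q)_k / (B; q)_k * ((-1)^k q^(k(k-1)/2))^(s-r) * z^k`. -/
noncomputable def psiTerm (A B : List ℂ) (q z : ℂ) (k : ℤ) : ℂ :=
  qPochs A q k / qPochs B q k *
    ((-1) ^ k * q ^ (k * (k - 1) / 2)) ^ ((B.length : ℤ) - (A.length : ℤ)) * z ^ k

/-- The bilateral basic hypergeometric series `_rψ_s[A; B; q, z]`. -/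
noncomputable def psiSeries (A B : List ℂ) (q z : ℂ) : ℂ := ∑' k : ℤ, psiTerm A B q z k

/-- The unilateral basic hypergeometric series `_rφ_{s-1}[A; B; q, z]`: its terms are those of the
bilateral series with the extra lower parameter `q`, and the sum is over `k ≥ 0`. -/
noncomputable def phiSeries (A B : List ℂ) (q z : ℂ) : ℂ :=
  ∑' k : ℕ, psiTerm A (q :: B) q z (k : ℤ)

/-- No term of the bilateral series with upper parameters `A` and lower parameters `B` has a
vanishing denominator: no upper parameter is `q^n` with `n ≥ 1` (else `(x; q)_{-n}` is undefined)
and no lower parameter is `q^{-n}` with `n ≥ 0` (else `(y; q)_{n+1} = 0`). -/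
def PsiDefined (A B : List ℂ) (q : ℂ) : Prop :=
  (∀ x ∈ A, ∀ n : ℕ, x ≠ q ^ (n + 1)) ∧ (∀ y ∈ B, ∀ n : ℕ, y * q ^ n ≠ 1)

/-- No term of the unilateral series with lower parameters `B` (besides `q`) has a vanishing
denominator: no lower parameter is `q^{-n}` with `n ≥ 0`. -/
def PhiDefined (B : List ℂ) (q : ℂ) : Prop := ∀ y ∈ B, ∀ n : ℕ, y * q ^ n ≠ 1

/-! Put `x = a^(1/2)` and `γ j = x / b j`, with `b j` running over `b, c, d, e, f, g`. Up to a
constant factor, the terms of the first `₈ψ₈` become those of `wpSeries q x γ`, in which every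
denominator has been absorbed into infinite products. The second `₈ψ₈` is the same function at `r *
x`, with parameters `r * g₁, …, r * g₄, g₅ / r, g₆ / r` and `r ^ 2 = μ / a`, that is, `r ^ 2 * q *
g₁ * g₂ * g₃ * g₄ = 1`. The `₈φ₇` is its value at `x = g₁⁻¹`, where all terms of negative index
vanish. The theorem is therefore a linear relation between three values of well-poised series.

The relation follows by counting zeros of theta functions. Under `x ↦ q * x` the series is
quasi-periodic, since the shift only moves the summation index. It is also antisymmetric, up to a
factor, under `x ↦ x⁻¹`. Hence it vanishes whenever `x ^ 2` is a power of `q`, and it equals `θ(x ^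
2) * G x` with `G` holomorphic on the punctured plane. After this division the difference of the two
sides is a function `f` with `f (q * x) = const * x ^ (-3) * f x`. Such a function is zero once it
has four zeros distinct modulo `q ^ ℤ` (`eq_zero_of_q_quasiperiodic`, which divides out theta
factors and then applies Liouville's theorem).

The four zeros are `g₁⁻¹, g₂, g₃, g₄`. At `g₁⁻¹` the second series drops out and the other two terms
cancel. At `g₂, g₃, g₄` the third term drops out; up to reflection both remaining series are
unilateral there, and the claim is Bailey's two-term transformation (`wpSeries_transformation`).
That transformation is proved first for terminating series, where Watson's formula sends both sides
to the same sum, and is then extended by the identity theorem in the last parameter. Watson's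
formula in turn rests on the terminating `₆φ₅` sum and the `q`-Saalschütz sum, both obtained by
telescoping.

The zero count needs parameters without coincidences modulo `q ^ ℤ`. Coincidences are removed at the
end: the parameters are deformed along a curve that is generic almost everywhere, superfluous
factors are cancelled there, and both sides are continuous in the limit (`wpSeries_phi_three_term`).
-/

/-! ### The theta function: functional equations and simple zeros. -/

section ThetaFunction

open Filter Topology

theorem summable_norm_qPochInf_factor (x : ℂ) {q : ℂ} (hq : ‖q‖ < 1) :
    Summable fun i : ℕ => ‖-(x * q ^ i)‖ := by
  simp only [norm_neg, norm_mul, norm_pow]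
  exact (summable_geometric_of_lt_one (norm_nonneg q) hq).mul_left _

theorem differentiable_qPochInf {q : ℂ} (hq : ‖q‖ < 1) :
    Differentiable ℂ fun x => qPochInf x q := by
  intro x₀
  have hU : IsOpen (Metric.ball (0 : ℂ) (‖x₀‖ + 1)) := Metric.isOpen_ball
  have hu : Summable fun i : ℕ => (‖x₀‖ + 1) * ‖q‖ ^ i :=
    (summable_geometric_of_lt_one (norm_nonneg q) hq).mul_left _
  have h := hu.hasProdLocallyUniformlyOn_nat_one_add (f := fun i x => -(x * q ^ i)) hU
    (Eventually.of_forall fun i x hx => by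
      rw [norm_neg, norm_mul, norm_pow]
      have : ‖x‖ ≤ ‖x₀‖ + 1 := by simpa using (Metric.mem_ball.mp hx).le
      gcongr)
    (fun i => by fun_prop)
  have h2 : DifferentiableOn ℂ (fun x => ∏' i, (1 + -(x * q ^ i)))
      (Metric.ball (0 : ℂ) (‖x₀‖ + 1)) :=
    h.differentiableOn (.of_forall fun _ => by
      simpa [Finset.prod_fn] using DifferentiableOn.finsetProd (fun _ _ => by fun_prop)) hU
  have h3 : DifferentiableAt ℂ (fun x => ∏' i, (1 + -(x * q ^ i))) x₀ :=
    h2.differentiableAt (hU.mem_nhds (by simp))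
  simpa only [qPochInf, sub_eq_add_neg] using h3

theorem DifferentiableAt.qPochInf {q : ℂ} (hq : ‖q‖ < 1) {f : ℂ → ℂ} {z : ℂ}
    (hf : DifferentiableAt ℂ f z) : DifferentiableAt ℂ (fun s => qPochInf (f s) q) z :=
  (differentiable_qPochInf hq (f z)).comp z hf

theorem ContinuousAt.qPochInf {X : Type*} [TopologicalSpace X] {q : ℂ} (hq : ‖q‖ < 1) {f : X → ℂ}
    {z : X} (hf : ContinuousAt f z) : ContinuousAt (fun s => qPochInf (f s) q) z :=
  ContinuousAt.comp (g := fun x => _root_.qPochInf x q) (differentiable_qPochInf hq (f z)).continuousAt hf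

theorem qPochInf_succ (x : ℂ) {q : ℂ} (hq : ‖q‖ < 1) :
    qPochInf x q = (1 - x) * qPochInf (x * q) q := by
  simpa using qPochInf_eq_mul x q hq 1

theorem qPochInf_ne_zero_iff {x q : ℂ} (hq : ‖q‖ < 1) :
    qPochInf x q ≠ 0 ↔ ∀ n : ℕ, x * q ^ n ≠ 1 := by
  constructor
  · intro h n hn
    apply h
    rw [qPochInf_eq_mul x q hq (n + 1), Finset.prod_range_succ, hn]
    simp
  · intro h
    have := tprod_one_add_ne_zero_of_summable (f := fun i : ℕ => -(x * q ^ i))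
      (fun i h0 => h i (by linear_combination -h0)) (summable_norm_qPochInf_factor x hq)
    simpa only [qPochInf, sub_eq_add_neg] using this

theorem qPochInf_eq_zero_iff {x q : ℂ} (hq : ‖q‖ < 1) :
    qPochInf x q = 0 ↔ ∃ n : ℕ, x * q ^ n = 1 := by
  simpa using (qPochInf_ne_zero_iff (x := x) hq).not

theorem qPochInf_self_ne_zero {q : ℂ} (hq : ‖q‖ < 1) : qPochInf q q ≠ 0 := by
  rw [qPochInf_ne_zero_iff hq]
  intro n h
  have : ‖q * q ^ n‖ = 1 := by rw [h]; simp
  rw [← pow_succ', norm_pow] at this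
  exact absurd this (pow_lt_one₀ (norm_nonneg q) hq (by omega)).ne

/-- The theta function `θ(x; q) = (x; q)_∞ (q / x; q)_∞`. -/
noncomputable def qTheta (x q : ℂ) : ℂ := qPochInf x q * qPochInf (q / x) q

/-- The two products exchange one factor: `1 - x` leaves the first and `1 - 1 / x` enters the
second, and their quotient is `-x`. -/
theorem qTheta_q_mul {x q : ℂ} (hq0 : q ≠ 0) (hq : ‖q‖ < 1) (hx : x ≠ 0) :
    x * qTheta (q * x) q = -qTheta x q := by
  unfold qTheta
  have e1 : q / (q * x) = 1 / x := by field_simp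
  have e2 : 1 / x * q = q / x := by field_simp
  rw [qPochInf_succ x hq, e1, qPochInf_succ (1 / x) hq, e2, mul_comm x q]
  field_simp
  ring

theorem qTheta_inv {x q : ℂ} (hq : ‖q‖ < 1) (hx : x ≠ 0) :
    x * qTheta x⁻¹ q = -qTheta x q := by
  unfold qTheta
  have e1 : q / x⁻¹ = x * q := by field_simp
  have e2 : x⁻¹ * q = q / x := by field_simp
  rw [qPochInf_succ x hq, e1, qPochInf_succ x⁻¹ hq, e2]
  field_simp
  ring

theorem qTheta_eq_zero_iff {x q : ℂ} (hq0 : q ≠ 0) (hq : ‖q‖ < 1) (hx : x ≠ 0) :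
    qTheta x q = 0 ↔ ∃ k : ℤ, x = q ^ k := by
  rw [qTheta, mul_eq_zero, qPochInf_eq_zero_iff hq, qPochInf_eq_zero_iff hq]
  constructor
  · rintro (⟨n, h⟩ | ⟨n, h⟩)
    · refine ⟨-n, ?_⟩
      rw [zpow_neg, zpow_natCast, eq_inv_of_mul_eq_one_left h]
    · refine ⟨n + 1, ?_⟩
      rw [zpow_add_one₀ hq0, zpow_natCast]
      field_simp at h
      rw [← h]; ring
  · rintro ⟨k, rfl⟩
    rcases le_or_gt k 0 with hk | hk
    · obtain ⟨n, hn⟩ := Int.eq_ofNat_of_zero_le (neg_nonneg.mpr hk)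
      left
      refine ⟨n, ?_⟩
      rw [← zpow_natCast, ← hn, ← zpow_add₀ hq0]
      simp
    · obtain ⟨n, hn⟩ := Int.eq_ofNat_of_zero_le (sub_nonneg.mpr (Int.add_one_le_iff.mpr hk))
      right
      refine ⟨n, ?_⟩
      have : k = n + 1 := by omega
      rw [this, zpow_add_one₀ hq0, zpow_natCast]
      field_simp

theorem DifferentiableAt.qTheta {q : ℂ} (hq : ‖q‖ < 1) {f : ℂ → ℂ} {z : ℂ}
    (hf : DifferentiableAt ℂ f z) (h0 : f z ≠ 0) : DifferentiableAt ℂ (fun s => qTheta (f s) q) z :=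
  (hf.qPochInf hq).mul (DifferentiableAt.qPochInf hq ((differentiableAt_const q).div hf h0))

theorem ContinuousAt.qTheta {X : Type*} [TopologicalSpace X] {q : ℂ} (hq : ‖q‖ < 1) {f : X → ℂ}
    {z : X} (hf : ContinuousAt f z) (h0 : f z ≠ 0) : ContinuousAt (fun s => qTheta (f s) q) z :=
  (hf.qPochInf hq).mul (ContinuousAt.qPochInf hq (continuousAt_const.div hf h0))

/-- The zeros `q ^ k` of the theta function are simple. -/
theorem deriv_qTheta_zpow_ne_zero {q : ℂ} (hq0 : q ≠ 0) (hq : ‖q‖ < 1) (k : ℤ) :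
    deriv (fun x => qTheta x q) (q ^ k) ≠ 0 := by
  have hd : ∀ x : ℂ, x ≠ 0 → DifferentiableAt ℂ (fun x => qTheta x q) x := fun x hx =>
    differentiableAt_id.qTheta hq hx
  have h0 : deriv (fun x => qTheta x q) 1 ≠ 0 := by
    have hg : DifferentiableAt ℂ (fun x => qPochInf (x * q) q * qPochInf (q / x) q) 1 :=
      ((differentiableAt_id.mul_const q).qPochInf hq).mul (DifferentiableAt.qPochInf hq
        ((differentiableAt_const q).div differentiableAt_id one_ne_zero))
    have e : (fun x => qTheta x q) =
        fun x => (1 - x) * (qPochInf (x * q) q * qPochInf (q / x) q) := by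
      funext x
      rw [qTheta, qPochInf_succ x hq, mul_assoc]
    have h1 : HasDerivAt (fun x : ℂ => 1 - x) (-1) 1 := (hasDerivAt_id (1 : ℂ)).const_sub 1
    rw [e, (h1.fun_mul hg.hasDerivAt).deriv]
    simp [qPochInf_self_ne_zero hq]
  -- Differentiating the functional equation at a zero relates the derivatives at `x` and `q * x`,
  -- so simplicity of the zero at `1` spreads to all of `q ^ ℤ` in both directions.
  have step : ∀ x : ℂ, x ≠ 0 → qTheta x q = 0 →
      x * (q * deriv (fun x => qTheta x q) (q * x)) = -deriv (fun x => qTheta x q) x := by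
    intro x hx hz
    have hz' : qTheta (q * x) q = 0 := by
      have := qTheta_q_mul hq0 hq hx
      rw [hz, neg_zero] at this
      exact (mul_eq_zero.mp this).resolve_left hx
    have h1 : HasDerivAt (fun y => y * qTheta (q * y) q)
        (1 * qTheta (q * x) q + x * (deriv (fun x => qTheta x q) (q * x) * (q * 1))) x :=
      (hasDerivAt_id x).fun_mul
        ((hd (q * x) (mul_ne_zero hq0 hx)).hasDerivAt.comp x ((hasDerivAt_id x).const_mul q))
    have h2 : HasDerivAt (fun y => y * qTheta (q * y) q) (-deriv (fun x => qTheta x q) x) x := by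
      refine ((hd x hx).hasDerivAt.fun_neg).congr_of_eventuallyEq ?_
      filter_upwards [isOpen_ne.mem_nhds hx] with y hy
      exact qTheta_q_mul hq0 hq hy
    have := h1.unique h2
    rw [hz'] at this
    linear_combination this
  have hz : ∀ k : ℤ, qTheta (q ^ k) q = 0 := fun k =>
    (qTheta_eq_zero_iff hq0 hq (zpow_ne_zero k hq0)).mpr ⟨k, rfl⟩
  induction k using Int.induction_on with
  | zero => simpa using h0
  | succ k ih =>
    intro h
    have := step _ (zpow_ne_zero _ hq0) (hz k)
    rw [← zpow_one_add₀ hq0, add_comm, h] at this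
    apply ih
    linear_combination this
  | pred k ih =>
    intro h
    have := step _ (zpow_ne_zero _ hq0) (hz (-k - 1))
    rw [← zpow_one_add₀ hq0, h, neg_zero] at this
    have e : (1 + (-(k : ℤ) - 1)) = -k := by ring
    rw [e] at this
    exact ih ((mul_eq_zero.mp ((mul_eq_zero.mp this).resolve_left
      (zpow_ne_zero _ hq0))).resolve_left hq0)

end ThetaFunction

/-! ### Counting zeros of quasi-periodic functions on the punctured plane. -/

section QuasiPeriodic

open Filter Topology

/-- Division of holomorphic functions on the punctured plane by one with simple zeros. -/
theorem exists_eq_mul_of_simple_zeros {f h : ℂ → ℂ} (hf : ∀ x ≠ 0, DifferentiableAt ℂ f x)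
    (hh : ∀ x ≠ 0, DifferentiableAt ℂ h x) (hz : ∀ x ≠ 0, h x = 0 → f x = 0)
    (hs : ∀ x ≠ 0, h x = 0 → deriv h x ≠ 0) :
    ∃ g : ℂ → ℂ, (∀ x ≠ 0, DifferentiableAt ℂ g x) ∧ ∀ x ≠ 0, f x = h x * g x := by
  classical
  -- The quotient is extended over the zeros of `h` by its limit `f' / h'`; near such a zero it is a
  -- quotient of divided slopes, which are holomorphic.
  refine ⟨fun x => if h x = 0 then deriv f x / deriv h x else f x / h x, fun x hx => ?_,
    fun x hx => ?_⟩
  · by_cases h0 : h x = 0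
    · have hne : {x : ℂ | x ≠ 0} ∈ 𝓝 x := isOpen_ne.mem_nhds hx
      have df : DifferentiableAt ℂ (dslope f x) x :=
        ((Complex.differentiableOn_dslope hne).mpr
          fun y hy => (hf y hy).differentiableWithinAt).differentiableAt hne
      have dh : DifferentiableAt ℂ (dslope h x) x :=
        ((Complex.differentiableOn_dslope hne).mpr
          fun y hy => (hh y hy).differentiableWithinAt).differentiableAt hne
      have hd : dslope h x x ≠ 0 := by rw [dslope_same]; exact hs x hx h0
      refine (df.div dh hd).congr_of_eventuallyEq ?_
      filter_upwards [dh.continuousAt.eventually_ne hd] with y hy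
      rcases eq_or_ne y x with rfl | hyx
      · simp [h0]
      · have e1 : h y = (y - x) * dslope h x y := by
          rw [← smul_eq_mul, sub_smul_dslope, h0, sub_zero]
        have e2 : f y = (y - x) * dslope f x y := by
          rw [← smul_eq_mul, sub_smul_dslope, hz x hx h0, sub_zero]
        have hyx' := sub_ne_zero.mpr hyx
        have : h y ≠ 0 := by rw [e1]; exact mul_ne_zero hyx' hy
        simp only [this, if_false, Pi.div_apply]
        rw [e1, e2, mul_div_mul_left _ _ hyx']
    · refine ((hf x hx).div (hh x hx) h0).congr_of_eventuallyEq ?_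
      filter_upwards [(hh x hx).continuousAt.eventually_ne h0] with y hy
      simp [hy]
  · by_cases h0 : h x = 0
    · simp [h0, hz x hx h0]
    · simp only [h0, if_false]
      field_simp

/-- Cancellation of a factor with simple zeros. -/
theorem eq_of_mul_eventuallyEq {h g₁ g₂ : ℂ → ℂ} {x : ℂ} (hh : DifferentiableAt ℂ h x)
    (h₁ : DifferentiableAt ℂ g₁ x) (h₂ : DifferentiableAt ℂ g₂ x)
    (hs : h x = 0 → deriv h x ≠ 0) (e : ∀ᶠ y in 𝓝 x, h y * g₁ y = h y * g₂ y) :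
    g₁ x = g₂ x := by
  by_cases h0 : h x = 0
  · have e1 := hh.hasDerivAt.fun_mul h₁.hasDerivAt
    have e2 := (hh.hasDerivAt.fun_mul h₂.hasDerivAt).congr_of_eventuallyEq e
    have := e1.unique e2
    simp only [h0, zero_mul, add_zero] at this
    exact mul_left_cancel₀ (hs h0) this
  · exact mul_left_cancel₀ h0 e.self_of_nhds

/-- For `m > 0` the multiplier `C * x ^ m` is at most `1` in size near `0` and at least `1` near
infinity. Moving any point along its `q`-orbit to a fixed annulus therefore does not decrease `‖f‖`.
So `f` is bounded, hence constant by Liouville's theorem, and only the constant `0` fits a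
nonconstant multiplier. -/
theorem eq_zero_of_q_quasiperiodic_pos {q C : ℂ} (hq0 : q ≠ 0) (hq : ‖q‖ < 1) {f : ℂ → ℂ}
    (hf : ∀ x ≠ 0, DifferentiableAt ℂ f x) {m : ℤ} (hm : 0 < m)
    (h : ∀ x ≠ 0, f (q * x) = C * x ^ m * f x) : ∀ x ≠ 0, f x = 0 := by
  lift m to ℕ using hm.le
  have hm' : 1 ≤ m := by omega
  simp only [zpow_natCast] at h
  rcases eq_or_ne C 0 with rfl | hC
  · intro x hx
    have := h (x / q) (div_ne_zero hx hq0)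
    rwa [mul_div_cancel₀ x hq0, zero_mul, zero_mul] at this
  have hCn : 0 < ‖C‖ := norm_pos_iff.mpr hC
  have hqn : 0 < ‖q‖ := norm_pos_iff.mpr hq0
  -- Since `m ≥ 1`, `‖C‖ * ‖x‖ ^ m` is at most `1` for `‖x‖ ≤ r₀` and at least `1` for `‖x‖ ≥ r₁`.
  set r₀ : ℝ := min 1 ‖C‖⁻¹ with hr₀
  set r₁ : ℝ := max 1 ‖C‖⁻¹ with hr₁
  have r₀pos : 0 < r₀ := lt_min one_pos (inv_pos.mpr hCn)
  have r₁pos : 0 < r₁ := lt_max_of_lt_left one_pos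
  have small : ∀ x ≠ 0, ‖x‖ ≤ r₀ → ‖f (q * x)‖ ≤ ‖f x‖ := by
    intro x hx hxr
    rw [h x hx, norm_mul, norm_mul, norm_pow]
    refine mul_le_of_le_one_left (norm_nonneg _) ?_
    calc ‖C‖ * ‖x‖ ^ m ≤ ‖C‖ * ‖x‖ := by
          gcongr
          exact pow_le_of_le_one (norm_nonneg _) (hxr.trans (min_le_left _ _)) (by omega)
      _ ≤ ‖C‖ * ‖C‖⁻¹ := by gcongr; exact hxr.trans (min_le_right _ _)
      _ = 1 := mul_inv_cancel₀ hCn.ne'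
  have large : ∀ x ≠ 0, r₁ ≤ ‖x‖ → ‖f x‖ ≤ ‖f (q * x)‖ := by
    intro x hx hxr
    rw [h x hx, norm_mul, norm_mul, norm_pow]
    refine le_mul_of_one_le_left (norm_nonneg _) ?_
    calc 1 = ‖C‖ * ‖C‖⁻¹ := (mul_inv_cancel₀ hCn.ne').symm
      _ ≤ ‖C‖ * ‖x‖ := by gcongr; exact (le_max_right _ _).trans hxr
      _ ≤ ‖C‖ * ‖x‖ ^ m := by
          gcongr
          exact le_self_pow₀ ((le_max_left _ _).trans hxr) (by omega)
  -- The inner radius is `‖q‖ * r₀`, so that no orbit can jump over the annulus.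
  have hK : IsCompact (Metric.closedBall (0 : ℂ) r₁ \ Metric.ball (0 : ℂ) (‖q‖ * r₀)) :=
    (isCompact_closedBall _ _).diff Metric.isOpen_ball
  have hKc : ContinuousOn f (Metric.closedBall (0 : ℂ) r₁ \ Metric.ball (0 : ℂ) (‖q‖ * r₀)) := by
    intro x hx
    refine (hf x ?_).continuousAt.continuousWithinAt
    rintro rfl
    exact hx.2 (Metric.mem_ball_self (by positivity))
  obtain ⟨M, hM⟩ := hK.exists_bound_of_continuousOn hKc
  have hM' : ∀ x : ℂ, ‖q‖ * r₀ ≤ ‖x‖ → ‖x‖ ≤ r₁ → ‖f x‖ ≤ M := fun x h1 h2 =>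
    hM x ⟨by simpa using h2, by simpa using h1⟩
  have r₀₁ : r₀ ≤ r₁ := (min_le_left _ _).trans (le_max_left _ _)
  have bound : ∀ x ≠ 0, ‖f x‖ ≤ M := by
    intro x hx
    have hxn : 0 < ‖x‖ := norm_pos_iff.mpr hx
    rcases le_total ‖x‖ r₀ with hx0 | hx0
    · obtain ⟨n, hn1, hn2⟩ := exists_nat_pow_near_of_lt_one (x := ‖x‖ / r₀) (by positivity)
        ((div_le_one r₀pos).mpr hx0) hqn hq
      have key : ∀ (n : ℕ) (y : ℂ), y ≠ 0 → ‖y‖ ≤ r₀ → ‖f (q ^ n * y)‖ ≤ ‖f y‖ := by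
        intro n
        induction n with
        | zero => intro y _ _; simp
        | succ n ih =>
          intro y hy hyr
          rw [pow_succ', mul_assoc]
          refine (small _ (mul_ne_zero (pow_ne_zero _ hq0) hy) ?_).trans (ih y hy hyr)
          rw [norm_mul, norm_pow]
          exact (mul_le_of_le_one_left (norm_nonneg _)
            (pow_le_one₀ (norm_nonneg _) hq.le)).trans hyr
      have hy : ‖x / q ^ n‖ = ‖x‖ / ‖q‖ ^ n := by rw [norm_div, norm_pow]
      have hqp : 0 < ‖q‖ ^ n := by positivity
      have hy1 : ‖x / q ^ n‖ ≤ r₀ := by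
        rw [hy, div_le_iff₀ hqp, mul_comm]
        exact (div_le_iff₀ r₀pos).mp hn2
      have hy2 : ‖q‖ * r₀ ≤ ‖x / q ^ n‖ := by
        rw [hy, le_div_iff₀ hqp]
        have := ((lt_div_iff₀ r₀pos).mp hn1).le
        rw [pow_succ] at this
        linarith
      have := key n (x / q ^ n) (div_ne_zero hx (pow_ne_zero _ hq0)) hy1
      rw [mul_div_cancel₀ x (pow_ne_zero _ hq0)] at this
      exact this.trans (hM' _ hy2 (hy1.trans r₀₁))
    · rcases le_total ‖x‖ r₁ with hx1 | hx1
      · exact hM' x ((mul_le_of_le_one_left r₀pos.le hq.le).trans hx0) hx1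
      · obtain ⟨n, hn1, hn2⟩ := exists_nat_pow_near_of_lt_one (x := r₁ / ‖x‖) (by positivity)
          ((div_le_one hxn).mpr hx1) hqn hq
        have key : ∀ n : ℕ, r₁ ≤ ‖q ^ n * x‖ → ‖f x‖ ≤ ‖f (q ^ (n + 1) * x)‖ := by
          intro n
          induction n with
          | zero => intro h; simpa using large x hx (by simpa using h)
          | succ n ih =>
            intro hn
            have hn' : r₁ ≤ ‖q ^ n * x‖ := by
              refine hn.trans ?_
              rw [pow_succ', mul_assoc, norm_mul]
              exact mul_le_of_le_one_left (norm_nonneg _) hq.le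
            refine (ih hn').trans ?_
            rw [pow_succ' q (n + 1), mul_assoc]
            exact large _ (mul_ne_zero (pow_ne_zero _ hq0) hx) hn
        have h1 : r₁ ≤ ‖q ^ n * x‖ := by
          rw [norm_mul, norm_pow]
          exact (div_le_iff₀ hxn).mp hn2
        refine (key n h1).trans (hM' _ ?_ ?_)
        · rw [pow_succ', mul_assoc, norm_mul]
          gcongr
          exact r₀₁.trans h1
        · rw [norm_mul, norm_pow]
          exact ((lt_div_iff₀ hxn).mp hn1).le
  -- Composing with `exp` gives a bounded entire function and removes the puncture at `0`.
  have hent : Differentiable ℂ (fun z => f (Complex.exp z)) := fun z =>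
    (hf _ (Complex.exp_ne_zero z)).comp z Complex.differentiable_exp.differentiableAt
  have hb : Bornology.IsBounded (Set.range fun z => f (Complex.exp z)) := by
    refine isBounded_iff_forall_norm_le.mpr ⟨M, ?_⟩
    rintro _ ⟨z, rfl⟩
    exact bound _ (Complex.exp_ne_zero z)
  have const : ∀ x y : ℂ, x ≠ 0 → y ≠ 0 → f x = f y := by
    intro x y hx hy
    have := hent.apply_eq_apply_of_bounded hb (Complex.log x) (Complex.log y)
    simpa only [Complex.exp_log hx, Complex.exp_log hy] using this
  intro x hx
  -- For constant `f`, the points `1` and `2` give `f = C * f` and `f = C * 2 ^ m * f`, whence `(2 ^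
  -- m - 1) * f = 0`.
  have h1 := h 1 one_ne_zero
  have h2 := h 2 two_ne_zero
  rw [mul_one, const q x hq0 hx, const 1 x one_ne_zero hx] at h1
  rw [const (q * 2) x (mul_ne_zero hq0 two_ne_zero) hx, const 2 x two_ne_zero hx] at h2
  have h3 : ((2 : ℂ) ^ m - 1) * f x = 0 := by
    rw [one_pow, mul_one] at h1
    linear_combination -h2 + (2 : ℂ) ^ m * h1
  refine (mul_eq_zero.mp h3).resolve_left fun h4 => ?_
  have h5 : (2 : ℕ) ^ m = 1 := by exact_mod_cast sub_eq_zero.mp h4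
  exact absurd h5 (Nat.one_lt_two_pow (by omega)).ne'

theorem deriv_qTheta_div_ne_zero {q p x : ℂ} (hq0 : q ≠ 0) (hq : ‖q‖ < 1) (hp : p ≠ 0)
    (hx : x ≠ 0) (h : qTheta (x / p) q = 0) : deriv (fun x => qTheta (x / p) q) x ≠ 0 := by
  obtain ⟨k, hk⟩ := (qTheta_eq_zero_iff hq0 hq (div_ne_zero hx hp)).mp h
  have hd : DifferentiableAt ℂ (fun x => qTheta x q) (x / p) :=
    differentiableAt_id.qTheta hq (div_ne_zero hx hp)
  have := (hd.hasDerivAt.comp x ((hasDerivAt_id x).div_const p)).deriv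
  simp only [Function.comp_def, id] at this
  rw [this, hk]
  exact mul_ne_zero (deriv_qTheta_zpow_ne_zero hq0 hq k) (one_div_ne_zero hp)

/-- A holomorphic function on the punctured plane that is quasi-periodic of degree `-m` under
`x ↦ q x` and has more than `-m` zeros modulo `q ^ ℤ` vanishes identically. -/
theorem eq_zero_of_q_quasiperiodic {q : ℂ} (hq0 : q ≠ 0) (hq : ‖q‖ < 1) (n : ℕ) :
    ∀ {C : ℂ} {f : ℂ → ℂ} {m : ℤ} (p : Fin n → ℂ), (∀ x ≠ 0, DifferentiableAt ℂ f x) →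
      (∀ x ≠ 0, f (q * x) = C * x ^ m * f x) → 0 < m + n → (∀ i, p i ≠ 0) →
      (∀ i j, i ≠ j → ∀ k : ℤ, p i ≠ q ^ k * p j) → (∀ i, f (p i) = 0) →
      ∀ x ≠ 0, f x = 0 := by
  induction n with
  | zero =>
    intro C f m p hf h hm _ _ _
    exact eq_zero_of_q_quasiperiodic_pos hq0 hq hf (by simpa using hm) h
  | succ n ih =>
    intro C f m p hf h hm hp hpp hfp
    have hθd : ∀ x ≠ 0, DifferentiableAt ℂ (fun x => qTheta (x / p 0) q) x := fun x hx =>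
      (differentiableAt_id.div_const (p 0)).qTheta hq (div_ne_zero hx (hp 0))
    -- The zero `p 0` spreads over its whole orbit. Going backwards divides by the multiplier, so `C
    -- = 0` is treated apart.
    have hfq : ∀ k : ℤ, f (q ^ k * p 0) = 0 := by
      have up : ∀ x ≠ 0, f x = 0 → f (q * x) = 0 := fun x hx h0 => by rw [h x hx, h0, mul_zero]
      rcases eq_or_ne C 0 with rfl | hC
      · intro k
        have := h (q ^ k * p 0 / q) (div_ne_zero (mul_ne_zero (zpow_ne_zero k hq0) (hp 0)) hq0)
        rwa [mul_div_cancel₀ _ hq0, zero_mul, zero_mul] at this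
      intro k
      induction k using Int.induction_on with
      | zero => simpa using hfp 0
      | succ k ih2 =>
        have := up _ (mul_ne_zero (zpow_ne_zero _ hq0) (hp 0)) ih2
        rwa [← mul_assoc, ← zpow_one_add₀ hq0, add_comm] at this
      | pred k ih2 =>
        have hx := mul_ne_zero (zpow_ne_zero (-(k : ℤ) - 1) hq0) (hp 0)
        have := h _ hx
        rw [← mul_assoc, ← zpow_one_add₀ hq0, add_sub_cancel, ih2] at this
        exact (mul_eq_zero.mp this.symm).resolve_left (mul_ne_zero hC (zpow_ne_zero _ hx))
    have hzero : ∀ x ≠ 0, qTheta (x / p 0) q = 0 → f x = 0 := by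
      intro x hx h0
      obtain ⟨k, hk⟩ := (qTheta_eq_zero_iff hq0 hq (div_ne_zero hx (hp 0))).mp h0
      rw [(div_eq_iff (hp 0)).mp hk]
      exact hfq k
    obtain ⟨g, hg, hfg⟩ := exists_eq_mul_of_simple_zeros hf hθd hzero
      fun x hx => deriv_qTheta_div_ne_zero hq0 hq (hp 0) hx
    -- Dividing by `θ(x / p 0)` raises the exponent of the multiplier by one and uses up one zero.
    have hgq : ∀ x ≠ 0, g (q * x) = -(C / p 0) * x ^ (m + 1) * g x := by
      intro x hx
      refine eq_of_mul_eventuallyEq (h := fun x => qTheta (x / p 0) q) (g₁ := fun x => g (q * x))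
        (g₂ := fun x => -(C / p 0) * x ^ (m + 1) * g x) (hθd x hx)
        ((hg _ (mul_ne_zero hq0 hx)).comp x (differentiableAt_id.const_mul q))
        (((differentiableAt_zpow.mpr (Or.inl hx)).const_mul _).mul (hg x hx))
        (deriv_qTheta_div_ne_zero hq0 hq (hp 0) hx) ?_
      filter_upwards [isOpen_ne.mem_nhds hx] with y hy
      have e1 := h y hy
      rw [hfg y hy, hfg _ (mul_ne_zero hq0 hy)] at e1
      have e2 := qTheta_q_mul hq0 hq (div_ne_zero hy (hp 0))
      rw [← mul_div_assoc] at e2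
      have hp0 := hp 0
      rw [div_mul_eq_mul_div, div_eq_iff hp0] at e2
      have hC : C = C / p 0 * p 0 := (div_mul_cancel₀ C hp0).symm
      refine mul_left_cancel₀ hp0 ?_
      rw [zpow_add_one₀ hy]
      linear_combination -y * e1 + g (q * y) * e2 - y * y ^ m * qTheta (y / p 0) q * g y * hC
    intro x hx
    rw [hfg x hx, ih (fun i => p i.succ) hg hgq (by push_cast at hm; omega) (fun i => hp _)
      (fun i j hij k => hpp _ _ (by simpa using hij) k) (fun i => ?_) x hx, mul_zero]
    have h0 := hfp i.succ
    rw [hfg _ (hp _)] at h0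
    -- The other prescribed zeros are not on the orbit of `p 0`, so they pass to the quotient.
    refine (mul_eq_zero.mp h0).resolve_left fun h1 => ?_
    obtain ⟨k, hk⟩ := (qTheta_eq_zero_iff hq0 hq (div_ne_zero (hp _) (hp 0))).mp h1
    exact hpp i.succ 0 (Fin.succ_ne_zero i) k ((div_eq_iff (hp 0)).mp hk)

end QuasiPeriodic

/-! ### The normalized bilateral well-poised series: convergence and symmetries. -/

section WellPoisedSeries

open Filter Topology

/-- A locally uniform ratio test: if `t (k + 1) = R (s, q ^ k) * t k` with `R` continuous at
`(s₀, 0)` and `‖R (s₀, 0)‖ < 1`, then `∑ t k` is locally uniformly dominated near `s₀`. -/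
theorem exists_summable_bound_of_ratio {X : Type*} [TopologicalSpace X] {s₀ : X} {q : ℂ}
    (hq : ‖q‖ < 1) {t : ℕ → X → ℂ} {R : X × ℂ → ℂ} (ht : ∀ k, ContinuousAt (t k) s₀)
    (hR : ContinuousAt R (s₀, 0)) (hlt : ‖R (s₀, 0)‖ < 1)
    (h : ∀ᶠ p in 𝓝 (s₀, (0 : ℂ)), ∀ k : ℕ, p.2 = q ^ k → t (k + 1) p.1 = R p * t k p.1) :
    ∃ u : ℕ → ℝ, Summable u ∧ ∀ᶠ s in 𝓝 s₀, ∀ k, ‖t k s‖ ≤ u k := by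
  obtain ⟨ρ, hρ0, hρ1⟩ := exists_between hlt
  have hρ : 0 ≤ ρ := (norm_nonneg _).trans hρ0.le
  have h1 : ∀ᶠ p in 𝓝 (s₀, (0 : ℂ)), ‖R p‖ < ρ := hR.norm.eventually_lt continuousAt_const hρ0
  -- Since `q ^ k → 0`, from some index `K` on the ratio is below `ρ` uniformly for `s` in `U`; the
  -- finitely many terms up to `K` are bounded by continuity.
  obtain ⟨U, hU, V, hV, hUV⟩ := mem_nhds_prod_iff.mp (h.and h1)
  obtain ⟨K, hK⟩ := eventually_atTop.mp
    ((tendsto_pow_atTop_nhds_zero_of_norm_lt_one hq).eventually hV)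
  have h2 : ∀ᶠ s in 𝓝 s₀, ∀ k ∈ Finset.range (K + 1), ‖t k s‖ < ‖t k s₀‖ + 1 := by
    rw [Filter.eventually_all_finset]
    exact fun k _ => (ht k).norm.eventually_lt continuousAt_const (lt_add_one _)
  refine ⟨fun k => if k < K then ‖t k s₀‖ + 1 else (‖t K s₀‖ + 1) * ρ ^ (k - K), ?_, ?_⟩
  · rw [← summable_nat_add_iff K]
    simpa using (summable_geometric_of_lt_one hρ hρ1).mul_left (‖t K s₀‖ + 1)
  · filter_upwards [hU, h2] with s hs h2s k
    by_cases hk : k < K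
    · simp only [hk, if_true]
      exact (h2s k (Finset.mem_range.mpr (by omega))).le
    · simp only [hk, if_false]
      obtain ⟨i, rfl⟩ := Nat.exists_eq_add_of_le (not_lt.mp hk)
      clear hk
      rw [Nat.add_sub_cancel_left]
      induction i with
      | zero => simpa using (h2s K (Finset.mem_range.mpr (by omega))).le
      | succ i ih =>
        have hm := hUV (Set.mk_mem_prod hs (hK (K + i) (by omega)))
        rw [← add_assoc, hm.1 (K + i) rfl, norm_mul, pow_succ']
        calc _ ≤ ρ * ((‖t K s₀‖ + 1) * ρ ^ i) :=
              mul_le_mul hm.2.le ih (norm_nonneg _) hρ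
          _ = _ := by ring

/-- The terms of the very-well-poised bilateral series, normalized so that they are entire in the
parameters `γ j` (the reciprocals of the numerator parameters, up to a factor `x`). -/
noncomputable def wpTerm (q x : ℂ) (γ : Fin 6 → ℂ) (k : ℤ) : ℂ :=
  (1 - (x * q ^ k) ^ 2) * (x ^ (6 * k) * q ^ (3 * k ^ 2 - k)) *
    ∏ j, (qPochInf (q * γ j * (x * q ^ k)) q * qPochInf (q * γ j / (x * q ^ k)) q)

/-- The normalized very-well-poised bilateral series. -/
noncomputable def wpSeries (q x : ℂ) (γ : Fin 6 → ℂ) : ℂ := ∑' k : ℤ, wpTerm q x γ k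

/-- The product over `j` is symmetric in `x * q ^ k` and its inverse, so only the elementary
prefactor changes. -/
theorem wpTerm_neg {q x : ℂ} (hq0 : q ≠ 0) (hx : x ≠ 0) (γ : Fin 6 → ℂ) (k : ℤ) :
    wpTerm q x γ (-k) = -x ^ 2 * wpTerm q x⁻¹ γ k := by
  unfold wpTerm
  have e1 : ∀ j, q * γ j * (x * q ^ (-k)) = q * γ j / (x⁻¹ * q ^ k) := by
    intro j; rw [zpow_neg, div_eq_mul_inv, mul_inv, inv_inv]
  have e2 : ∀ j, q * γ j / (x * q ^ (-k)) = q * γ j * (x⁻¹ * q ^ k) := by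
    intro j; rw [zpow_neg, div_eq_mul_inv, mul_inv, inv_inv]
  have e3 : ∏ j, (qPochInf (q * γ j * (x * q ^ (-k))) q * qPochInf (q * γ j / (x * q ^ (-k))) q) =
      ∏ j, (qPochInf (q * γ j * (x⁻¹ * q ^ k)) q * qPochInf (q * γ j / (x⁻¹ * q ^ k)) q) := by
    refine Finset.prod_congr rfl fun j _ => ?_
    rw [e1, e2, mul_comm]
  rw [e3, ← mul_assoc (-x ^ 2)]
  congr 1
  have e4 : x⁻¹ ^ (6 * k) = x ^ (6 * -k) := by rw [inv_zpow', mul_neg]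
  have e5 : q ^ (3 * (-k) ^ 2 - -k) = q ^ (3 * k ^ 2 - k) * q ^ k * q ^ k := by
    rw [← zpow_add₀ hq0, ← zpow_add₀ hq0]; congr 1; ring
  have hqk := zpow_ne_zero k hq0
  rw [e4, e5, zpow_neg]
  field_simp
  ring

/-- The term depends on `x` and `k` through `x * q ^ k`, apart from the Gaussian factor; completing
the square there produces the multiplier of degree `-6 * n`. -/
theorem wpTerm_zpow_mul {q x : ℂ} (hq0 : q ≠ 0) (hx : x ≠ 0) (γ : Fin 6 → ℂ) (n k : ℤ) :
    wpTerm q (q ^ n * x) γ k = x ^ (-6 * n) * q ^ (n - 3 * n ^ 2) * wpTerm q x γ (k + n) := by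
  unfold wpTerm
  have e : q ^ n * x * q ^ k = x * q ^ (k + n) := by rw [zpow_add₀ hq0]; ring
  have e1 : (q ^ n * x) ^ (6 * k) * q ^ (3 * k ^ 2 - k) = x ^ (-6 * n) * q ^ (n - 3 * n ^ 2) *
      (x ^ (6 * (k + n)) * q ^ (3 * (k + n) ^ 2 - (k + n))) := by
    rw [mul_zpow, ← zpow_mul, show 6 * (k + n) = -(-6 * n) + 6 * k by ring, zpow_add₀ hx,
      zpow_neg x (-6 * n)]
    have h1 : n * (6 * k) + (3 * k ^ 2 - k) =
        (n - 3 * n ^ 2) + (3 * (k + n) ^ 2 - (k + n)) := by ring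
    have h2 : q ^ (n * (6 * k)) * q ^ (3 * k ^ 2 - k) =
        q ^ (n - 3 * n ^ 2) * q ^ (3 * (k + n) ^ 2 - (k + n)) := by
      rw [← zpow_add₀ hq0, ← zpow_add₀ hq0, h1]
    have h3 := zpow_ne_zero (-6 * n) hx
    field_simp
    linear_combination h2
  rw [e, e1]
  ring

/-- The term ratio, cleared of denominators. Written in `y = x * q ^ k`, both coefficients are
polynomials, so the ratio extends continuously to `y = 0`. -/
theorem wpTerm_succ {q x : ℂ} (hq0 : q ≠ 0) (hq : ‖q‖ < 1) (hx : x ≠ 0) (γ : Fin 6 → ℂ) (k : ℤ) :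
    wpTerm q x γ (k + 1) * ((1 - (x * q ^ k) ^ 2) * ∏ j, (1 - q * γ j * (x * q ^ k))) =
      q ^ 2 * (1 - (q * (x * q ^ k)) ^ 2) * (∏ j, (x * q ^ k - γ j)) * wpTerm q x γ k := by
  unfold wpTerm
  have hy : x * q ^ k ≠ 0 := mul_ne_zero hx (zpow_ne_zero k hq0)
  have e : x * q ^ (k + 1) = q * (x * q ^ k) := by rw [zpow_add_one₀ hq0]; ring
  have e1 : x ^ (6 * (k + 1)) * q ^ (3 * (k + 1) ^ 2 - (k + 1)) =
      (x * q ^ k) ^ 6 * q ^ 2 * (x ^ (6 * k) * q ^ (3 * k ^ 2 - k)) := by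
    have h1 : (q ^ k) ^ 6 = q ^ (k * 6) := by rw [zpow_mul]; rfl
    have h2 : q ^ (3 * (k + 1) ^ 2 - (k + 1)) = q ^ (k * 6) * q ^ 2 * q ^ (3 * k ^ 2 - k) := by
      rw [← zpow_natCast q 2, ← zpow_add₀ hq0, ← zpow_add₀ hq0]; congr 1; push_cast; ring
    have h3 : x ^ (6 * (k + 1)) = x ^ 6 * x ^ (6 * k) := by
      rw [← zpow_natCast x 6, ← zpow_add₀ hx]; congr 1; push_cast; ring
    rw [mul_pow, h1, h2, h3]; ring
  have e2 : ∀ j, qPochInf (q * γ j * (x * q ^ k)) q * qPochInf (q * γ j / (q * (x * q ^ k))) q *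
      (x * q ^ k) = (x * q ^ k - γ j) * (qPochInf (q * γ j * (x * q ^ k)) q *
        qPochInf (q * γ j / (x * q ^ k)) q) := by
    intro j
    have h1 : q * γ j / (q * (x * q ^ k)) = γ j / (x * q ^ k) := mul_div_mul_left _ _ hq0
    have h2 : γ j / (x * q ^ k) * q = q * γ j / (x * q ^ k) := by ring
    rw [h1, qPochInf_succ (γ j / (x * q ^ k)) hq, h2]
    field_simp
  have e3 : ∀ j, (1 - q * γ j * (x * q ^ k)) * qPochInf (q * γ j * (q * (x * q ^ k))) q =
      qPochInf (q * γ j * (x * q ^ k)) q := by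
    intro j
    rw [qPochInf_succ (q * γ j * (x * q ^ k)) hq]
    congr 2
    ring
  rw [e, e1]
  have e4 : (∏ j, (qPochInf (q * γ j * (q * (x * q ^ k))) q *
      qPochInf (q * γ j / (q * (x * q ^ k))) q)) * (∏ j, (1 - q * γ j * (x * q ^ k))) *
        (x * q ^ k) ^ 6 = (∏ j, (x * q ^ k - γ j)) *
        ∏ j, (qPochInf (q * γ j * (x * q ^ k)) q * qPochInf (q * γ j / (x * q ^ k)) q) := by
    have : (x * q ^ k) ^ 6 = ∏ _j : Fin 6, (x * q ^ k) := by simp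
    rw [this, ← Finset.prod_mul_distrib, ← Finset.prod_mul_distrib, ← Finset.prod_mul_distrib]
    refine Finset.prod_congr rfl fun j _ => ?_
    rw [← e2, ← e3]
    ring
  linear_combination (q ^ 2 * (1 - (q * (x * q ^ k)) ^ 2) * (1 - (x * q ^ k) ^ 2) *
    (x ^ (6 * k) * q ^ (3 * k ^ 2 - k))) * e4

theorem continuousAt_wpTerm {q : ℂ} (hq0 : q ≠ 0) (hq : ‖q‖ < 1) {p : ℂ × (Fin 6 → ℂ)}
    (hx : p.1 ≠ 0) (k : ℤ) : ContinuousAt (fun p => wpTerm q p.1 p.2 k) p := by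
  unfold wpTerm
  have hy : p.1 * q ^ k ≠ 0 := mul_ne_zero hx (zpow_ne_zero k hq0)
  refine ContinuousAt.mul (ContinuousAt.mul (by fun_prop)
    (ContinuousAt.mul (continuousAt_fst.zpow₀ _ (Or.inl hx)) continuousAt_const))
    (tendsto_finsetProd _ fun j _ => ContinuousAt.mul (ContinuousAt.qPochInf hq (by fun_prop))
      (ContinuousAt.qPochInf hq ?_))
  exact ContinuousAt.div (by fun_prop) (by fun_prop) hy

/-- As `q ^ k → 0` the ratio `N / D` tends to `q ^ 2 * ∏ j, γ j`; the six signs from `x * q ^ k - γ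
j` cancel. -/
theorem exists_summable_bound_wpTerm_nat {q : ℂ} (hq0 : q ≠ 0) (hq : ‖q‖ < 1)
    {p₀ : ℂ × (Fin 6 → ℂ)} (hx : p₀.1 ≠ 0) (hγ : ‖q ^ 2 * ∏ j, p₀.2 j‖ < 1) :
    ∃ u : ℕ → ℝ, Summable u ∧ ∀ᶠ p in 𝓝 p₀, ∀ k : ℕ, ‖wpTerm q p.1 p.2 k‖ ≤ u k := by
  set N : (ℂ × (Fin 6 → ℂ)) × ℂ → ℂ := fun s =>
    q ^ 2 * (1 - (q * (s.1.1 * s.2)) ^ 2) * ∏ j, (s.1.1 * s.2 - s.1.2 j) with hN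
  set D : (ℂ × (Fin 6 → ℂ)) × ℂ → ℂ := fun s =>
    (1 - (s.1.1 * s.2) ^ 2) * ∏ j, (1 - q * s.1.2 j * (s.1.1 * s.2)) with hD
  have hNc : ContinuousAt N (p₀, 0) := by
    have : Continuous N := by fun_prop
    exact this.continuousAt
  have hDc : ContinuousAt D (p₀, 0) := by
    have : Continuous D := by fun_prop
    exact this.continuousAt
  have hD0 : D (p₀, 0) ≠ 0 := by simp [hD]
  refine exists_summable_bound_of_ratio hq (R := fun s => N s / D s)
    (fun k => continuousAt_wpTerm hq0 hq hx k) (hNc.div hDc hD0) ?_ ?_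
  · have : N (p₀, 0) / D (p₀, 0) = q ^ 2 * ∏ j, p₀.2 j := by
      simp only [hN, hD, mul_zero, zero_pow two_ne_zero, sub_zero, mul_one, zero_sub,
        Finset.prod_const_one, div_one, Finset.prod_neg]
      rw [Finset.card_fin, Even.neg_one_pow (by decide), one_mul]
    rw [this]
    exact hγ
  · have hxc : ContinuousAt (fun s : (ℂ × (Fin 6 → ℂ)) × ℂ => s.1.1) (p₀, 0) := by fun_prop
    filter_upwards [hDc.eventually_ne hD0, hxc.eventually_ne hx] with s hs hxs k hk
    have := wpTerm_succ hq0 hq hxs s.1.2 k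
    rw [zpow_natCast, ← hk] at this
    rw [div_mul_eq_mul_div, eq_div_iff hs]
    exact_mod_cast this

/-- The reflection `wpTerm_neg` turns the negative half into the positive half at `x⁻¹`, with the
same limiting ratio. One condition thus controls both directions. -/
theorem exists_summable_bound_wpTerm {q : ℂ} (hq0 : q ≠ 0) (hq : ‖q‖ < 1)
    {p₀ : ℂ × (Fin 6 → ℂ)} (hx : p₀.1 ≠ 0) (hγ : ‖q ^ 2 * ∏ j, p₀.2 j‖ < 1) :
    ∃ u : ℤ → ℝ, Summable u ∧ ∀ᶠ p in 𝓝 p₀, ∀ k : ℤ, ‖wpTerm q p.1 p.2 k‖ ≤ u k := by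
  obtain ⟨u₁, hu₁, h₁⟩ := exists_summable_bound_wpTerm_nat hq0 hq hx hγ
  obtain ⟨u₂, hu₂, h₂⟩ := exists_summable_bound_wpTerm_nat hq0 hq (p₀ := (p₀.1⁻¹, p₀.2))
    (inv_ne_zero hx) hγ
  have hc : ContinuousAt (fun p : ℂ × (Fin 6 → ℂ) => (p.1⁻¹, p.2)) p₀ :=
    (continuousAt_fst.inv₀ hx).prodMk continuousAt_snd
  have hc2 : ContinuousAt (fun p : ℂ × (Fin 6 → ℂ) => ‖-p.1 ^ 2‖) p₀ := by fun_prop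
  refine ⟨fun k => |u₁ k.natAbs| + (‖-p₀.1 ^ 2‖ + 1) * |u₂ k.natAbs|, ?_, ?_⟩
  · have hs : Summable fun n : ℕ => |u₁ n| + (‖-p₀.1 ^ 2‖ + 1) * |u₂ n| :=
      hu₁.abs.add (hu₂.abs.mul_left _)
    exact Summable.of_nat_of_neg (by simpa only [Int.natAbs_natCast] using hs)
      (by simpa only [Int.natAbs_neg, Int.natAbs_natCast] using hs)
  · filter_upwards [h₁, hc.eventually h₂, hc2.eventually_lt continuousAt_const (lt_add_one _),
      continuousAt_fst.eventually_ne hx] with p hp1 hp2 hp3 hp4 k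
    rcases Int.natAbs_eq k with hk | hk
    · have := (hp1 k.natAbs).trans (le_abs_self _)
      rw [← hk] at this
      refine this.trans (le_add_of_nonneg_right (by positivity))
    · have := (hp2 k.natAbs).trans (le_abs_self _)
      rw [hk, wpTerm_neg hq0 hp4, norm_mul, Int.natAbs_neg, Int.natAbs_natCast]
      exact (mul_le_mul hp3.le this (norm_nonneg _) (by positivity)).trans
        (le_add_of_nonneg_left (abs_nonneg _))

theorem summable_norm_wpTerm {q x : ℂ} (hq0 : q ≠ 0) (hq : ‖q‖ < 1) {γ : Fin 6 → ℂ} (hx : x ≠ 0)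
    (hγ : ‖q ^ 2 * ∏ j, γ j‖ < 1) : Summable fun k => ‖wpTerm q x γ k‖ := by
  obtain ⟨u, hu, h⟩ := exists_summable_bound_wpTerm hq0 hq (p₀ := (x, γ)) hx hγ
  exact hu.of_nonneg_of_le (fun _ => norm_nonneg _) h.self_of_nhds

theorem summable_wpTerm {q x : ℂ} (hq0 : q ≠ 0) (hq : ‖q‖ < 1) {γ : Fin 6 → ℂ} (hx : x ≠ 0)
    (hγ : ‖q ^ 2 * ∏ j, γ j‖ < 1) : Summable fun k => wpTerm q x γ k :=
  (summable_norm_wpTerm hq0 hq hx hγ).of_norm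

theorem DifferentiableAt.wpTerm {q : ℂ} (hq0 : q ≠ 0) (hq : ‖q‖ < 1) {X : ℂ → ℂ}
    {Γ : ℂ → Fin 6 → ℂ} {s : ℂ} (hX : DifferentiableAt ℂ X s)
    (hΓ : ∀ j, DifferentiableAt ℂ (fun s => Γ s j) s) (hx : X s ≠ 0) (k : ℤ) :
    DifferentiableAt ℂ (fun s => wpTerm q (X s) (Γ s) k) s := by
  unfold _root_.wpTerm
  have hy : X s * q ^ k ≠ 0 := mul_ne_zero hx (zpow_ne_zero k hq0)
  refine DifferentiableAt.fun_mul (DifferentiableAt.fun_mul (by fun_prop)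
    ((hX.zpow (Or.inl hx)).mul_const _))
    (DifferentiableAt.fun_finsetProd fun j _ => DifferentiableAt.fun_mul
      (DifferentiableAt.qPochInf hq ?_) (DifferentiableAt.qPochInf hq ?_))
  · exact ((hΓ j).const_mul q).fun_mul (hX.mul_const _)
  · exact ((hΓ j).const_mul q).fun_div (hX.mul_const _) hy

theorem DifferentiableAt.wpSeries {q : ℂ} (hq0 : q ≠ 0) (hq : ‖q‖ < 1) {X : ℂ → ℂ}
    {Γ : ℂ → Fin 6 → ℂ} {s : ℂ} (hX : ∀ᶠ z in 𝓝 s, DifferentiableAt ℂ X z)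
    (hΓ : ∀ᶠ z in 𝓝 s, ∀ j, DifferentiableAt ℂ (fun s => Γ s j) z) (hx : X s ≠ 0)
    (hγ : ‖q ^ 2 * ∏ j, Γ s j‖ < 1) : DifferentiableAt ℂ (fun s => wpSeries q (X s) (Γ s)) s := by
  obtain ⟨u, hu, h⟩ := exists_summable_bound_wpTerm hq0 hq (p₀ := (X s, Γ s)) hx hγ
  have hXc := hX.self_of_nhds.continuousAt
  have hc : ContinuousAt (fun s => (X s, Γ s)) s :=
    hXc.prodMk (continuousAt_pi.mpr fun j => (hΓ.self_of_nhds j).continuousAt)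
  have hev := (hX.and hΓ).and ((hc.eventually h).and (hXc.eventually_ne hx))
  obtain ⟨U, hU, hUo, hsU⟩ := mem_nhds_iff.mp hev
  have := Complex.differentiableOn_tsum_of_summable_norm (F := fun k z => _root_.wpTerm q (X z) (Γ z) k) hu
    (fun k z hz => (DifferentiableAt.wpTerm hq0 hq (hU hz).1.1 (hU hz).1.2 (hU hz).2.2
      k).differentiableWithinAt) hUo (fun k z hz => (hU hz).2.1 k)
  exact this.differentiableAt (hUo.mem_nhds hsU)

theorem wpSeries_inv {q x : ℂ} (hq0 : q ≠ 0) (hx : x ≠ 0) (γ : Fin 6 → ℂ) :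
    wpSeries q x γ = -x ^ 2 * wpSeries q x⁻¹ γ := by
  unfold wpSeries
  rw [← (Equiv.neg ℤ).tsum_eq, ← tsum_mul_left]
  exact tsum_congr fun k => wpTerm_neg hq0 hx γ k

theorem wpSeries_zpow_mul {q x : ℂ} (hq0 : q ≠ 0) (hx : x ≠ 0) (γ : Fin 6 → ℂ) (n : ℤ) :
    wpSeries q (q ^ n * x) γ = x ^ (-6 * n) * q ^ (n - 3 * n ^ 2) * wpSeries q x γ := by
  unfold wpSeries
  rw [← (Equiv.addRight n).tsum_eq (fun k => wpTerm q x γ k), ← tsum_mul_left]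
  exact tsum_congr fun k => wpTerm_zpow_mul hq0 hx γ n k

/-- When `x ^ 2 = q ^ k`, the inverse of `x` is `q ^ (-k) * x`. Reflection and shift then both
relate the series to itself, with opposite signs. -/
theorem wpSeries_eq_zero {q x : ℂ} (hq0 : q ≠ 0) (hx : x ≠ 0) (γ : Fin 6 → ℂ) {k : ℤ}
    (h : x ^ 2 = q ^ k) : wpSeries q x γ = 0 := by
  have e1 := wpSeries_inv hq0 hx γ
  have e2 := wpSeries_zpow_mul hq0 hx γ (-k)
  have e3 : q ^ (-k) * x = x⁻¹ := by
    rw [zpow_neg, ← h]; field_simp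
  have e4 : x ^ (-6 * -k) = q ^ (3 * k ^ 2) := by
    have : -6 * -k = 2 * (3 * k) := by ring
    rw [this, zpow_mul]
    have h' : x ^ (2 : ℤ) = q ^ k := by exact_mod_cast h
    rw [h', ← zpow_mul]; congr 1; ring
  have e5 : q ^ (3 * k ^ 2) * q ^ (-k - 3 * (-k) ^ 2) * q ^ k = 1 := by
    rw [← zpow_add₀ hq0, ← zpow_add₀ hq0, ← zpow_zero q]; congr 1; ring
  rw [e3, e4] at e2
  rw [e2, h] at e1
  have : 2 * wpSeries q x γ = 0 := by linear_combination e1 - wpSeries q x γ * e5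
  exact (mul_eq_zero.mp this).resolve_left two_ne_zero

end WellPoisedSeries

/-! ### Terminating summations: very-well-poised `₆φ₅` and `q`-Saalschütz. -/

section TerminatingSums

open Finset

/-- The finite `q`-shifted factorial `(x; q)_n = ∏_{i < n} (1 - x q^i)`. -/
noncomputable def qPochFin (x q : ℂ) (n : ℕ) : ℂ := ∏ i ∈ range n, (1 - x * q ^ i)

@[simp] theorem qPochFin_zero (x q : ℂ) : qPochFin x q 0 = 1 := by simp [qPochFin]

theorem qPochFin_succ (x q : ℂ) (n : ℕ) :
    qPochFin x q (n + 1) = qPochFin x q n * (1 - x * q ^ n) := prod_range_succ _ _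

theorem qPochFin_succ' (x q : ℂ) (n : ℕ) :
    qPochFin x q (n + 1) = (1 - x) * qPochFin (x * q) q n := by
  rw [qPochFin, prod_range_succ', mul_comm, qPochFin]
  simp [pow_succ', mul_assoc]

theorem qPochFin_add (x q : ℂ) (m n : ℕ) :
    qPochFin x q (m + n) = qPochFin x q m * qPochFin (x * q ^ m) q n := by
  simp [qPochFin, prod_range_add, pow_add, mul_assoc]

theorem qPochFin_ne_zero {x q : ℂ} (h : ∀ n : ℕ, x * q ^ n ≠ 1) (n : ℕ) : qPochFin x q n ≠ 0 :=
  prod_ne_zero_iff.mpr fun i _ => sub_ne_zero.mpr (h i).symm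

theorem qPochFin_eq_zero {x q : ℂ} {i n : ℕ} (hi : i < n) (h : x * q ^ i = 1) :
    qPochFin x q n = 0 :=
  prod_eq_zero (mem_range.mpr hi) (by rw [h, sub_self])

theorem qPochFin_inv_pow_self_succ {q : ℂ} (hq0 : q ≠ 0) (n : ℕ) :
    qPochFin (q ^ n)⁻¹ q (n + 1) = 0 :=
  qPochFin_eq_zero (Nat.lt_succ_self n) (inv_mul_cancel₀ (pow_ne_zero n hq0))

/-- Reversal of the order of factors: each `1 - y` is rewritten as `-y * (1 - 1 / y)`. -/
theorem qPochFin_mul_inv_pow {q x : ℂ} (hq0 : q ≠ 0) (hx : x ≠ 0) (k : ℕ) :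
    qPochFin (x * (q ^ k)⁻¹) q k =
      (-(x / q)) ^ k * (∏ i ∈ range k, (q ^ i)⁻¹) * qPochFin (q / x) q k := by
  induction k with
  | zero => simp
  | succ k ih =>
    have e : x * (q ^ (k + 1))⁻¹ * q = x * (q ^ k)⁻¹ := by
      rw [pow_succ]; field_simp
    rw [qPochFin_succ', e, ih, prod_range_succ, qPochFin_succ, pow_succ (-(x / q))]
    have : 1 - x * (q ^ (k + 1))⁻¹ = -(x / q) * (q ^ k)⁻¹ * (1 - q / x * q ^ k) := by
      have := pow_ne_zero k hq0
      rw [pow_succ]; field_simp; ring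
    rw [this]
    ring

theorem qPochFin_inv_pow_add {q : ℂ} (hq0 : q ≠ 0) (j i : ℕ) :
    qPochFin (q ^ (j + i))⁻¹ q j * qPochFin q q i =
      qPochFin q q (j + i) * ((-1) ^ j * (∏ l ∈ range j, (q ^ l)⁻¹) * (q ^ j)⁻¹ *
        ((q ^ j)⁻¹) ^ i) := by
  induction j with
  | zero => simp
  | succ j ih =>
    have e : (q ^ (j + 1 + i))⁻¹ * q = (q ^ (j + i))⁻¹ := by
      rw [show j + 1 + i = j + i + 1 by ring, pow_succ]; field_simp
    have e2 : j + 1 + i = (j + i) + 1 := by ring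
    rw [qPochFin_succ', e, mul_assoc, ih, e2, qPochFin_succ, prod_range_succ]
    have h1 : 1 - (q ^ (j + i + 1))⁻¹ = -(q ^ (j + i + 1))⁻¹ * (1 - q * q ^ (j + i)) := by
      field_simp; ring
    rw [h1]
    have h2 : ((q ^ (j + 1))⁻¹) ^ i = ((q ^ j)⁻¹) ^ i * (q ^ i)⁻¹ := by
      rw [pow_succ, mul_inv, mul_pow, inv_pow q]
    rw [h2]
    field_simp
    ring

theorem pow_succ_ne_one_of_norm_lt_one {q : ℂ} (hq : ‖q‖ < 1) (n : ℕ) : q * q ^ n ≠ 1 := by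
  intro h
  have : ‖q ^ (n + 1)‖ = 1 := by rw [pow_succ', h, norm_one]
  rw [norm_pow] at this
  exact absurd this (pow_lt_one₀ (norm_nonneg q) hq (by omega)).ne

/-- The terms of the terminating very-well-poised `₆φ₅` series. -/
noncomputable def sixPhiTerm (q a d e : ℂ) (m i : ℕ) : ℂ :=
  (1 - a * q ^ (2 * i)) * (qPochFin a q i * qPochFin d q i * qPochFin e q i *
    qPochFin (q ^ m)⁻¹ q i) / (qPochFin q q i * qPochFin (a * q / d) q i *
    qPochFin (a * q / e) q i * qPochFin (a * q ^ (m + 1)) q i) * (a * q ^ (m + 1) / (d * e)) ^ i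

/-- A telescoping certificate for the recurrence in `m`: the combination of partial sums has a
closed form, checked by induction on `n`. Its factor `(q ^ (-m); q)_n` vanishes at `n = m + 1`,
which leaves a two-term recurrence for the complete sums. -/
theorem sixPhiTerm_telescope {q a d e : ℂ} (hq0 : q ≠ 0) (hq : ‖q‖ < 1) (hd : d ≠ 0) (he : e ≠ 0)
    (ha : ∀ n : ℕ, a * q ^ n ≠ 1) (had : ∀ n : ℕ, a * q / d * q ^ n ≠ 1)
    (hae : ∀ n : ℕ, a * q / e * q ^ n ≠ 1) (m n : ℕ) :
    (1 - a * q ^ (m + 1) / d) * (1 - a * q ^ (m + 1) / e) *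
        (∑ i ∈ range (n + 1), sixPhiTerm q a d e (m + 1) i) -
      (1 - a * q ^ (m + 1)) * (1 - a * q ^ (m + 1) / (d * e)) *
        (∑ i ∈ range (n + 1), sixPhiTerm q a d e m i) =
    (1 - a * q ^ (m + 1)) * (qPochFin a q (n + 1) * qPochFin d q (n + 1) * qPochFin e q (n + 1) *
      qPochFin (q ^ m)⁻¹ q n) / (qPochFin q q n * qPochFin (a * q / d) q n *
      qPochFin (a * q / e) q n * qPochFin (a * q ^ (m + 1)) q (n + 1)) *
      (a * q ^ (m + 1) / (d * e)) ^ (n + 1) := by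
  have hM := pow_ne_zero m hq0
  have ham : ∀ n : ℕ, a * q ^ (m + 1) * q ^ n ≠ 1 := fun n => by
    rw [mul_assoc, ← pow_add]; exact ha _
  have h1 : 1 - a * q ^ (m + 1) ≠ 0 := sub_ne_zero.mpr (ha _).symm
  induction n with
  | zero =>
    simp only [zero_add, range_one, sum_singleton, sixPhiTerm, qPochFin_succ, qPochFin_zero,
      mul_zero, pow_zero, mul_one, pow_one, one_mul, div_one]
    field_simp
    ring
  | succ n ih =>
    rw [sum_range_succ _ (n + 1), sum_range_succ _ (n + 1), mul_add, mul_add, add_sub_add_comm, ih]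
    have e1 : qPochFin (q ^ (m + 1))⁻¹ q (n + 1) =
        (1 - (q ^ (m + 1))⁻¹) * qPochFin (q ^ m)⁻¹ q n := by
      rw [qPochFin_succ']
      congr 2
      rw [pow_succ]; field_simp
    have e2 : qPochFin (a * q ^ (m + 1 + 1)) q (n + 1) =
        qPochFin (a * q ^ (m + 1)) q (n + 1) * (1 - a * q ^ (m + 1) * q ^ (n + 1)) /
          (1 - a * q ^ (m + 1)) := by
      rw [eq_div_iff h1, ← qPochFin_succ, qPochFin_succ' _ _ (n + 1), mul_comm, pow_succ q (m + 1),
        mul_assoc a]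
    have e3 : (a * q ^ (m + 1 + 1) / (d * e)) ^ (n + 1) =
        (a * q ^ (m + 1) / (d * e)) ^ (n + 1) * q ^ (n + 1) := by
      rw [← mul_pow]; congr 1; rw [pow_succ q (m + 1)]; ring
    have e4 : a * q ^ (2 * (n + 1)) = a * q ^ 2 * (q ^ n) ^ 2 := by ring
    simp only [sixPhiTerm]
    rw [e1, e2, e3, e4, qPochFin_succ q q n, qPochFin_succ (a * q / d) q n,
      qPochFin_succ (a * q / e) q n, qPochFin_succ (a * q ^ (m + 1)) q (n + 1),
      qPochFin_succ a q (n + 1), qPochFin_succ d q (n + 1), qPochFin_succ e q (n + 1),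
      qPochFin_succ (q ^ m)⁻¹ q n, pow_succ (a * q ^ (m + 1) / (d * e)) (n + 1)]
    have n1 : 1 - q * q ^ n ≠ 0 := sub_ne_zero.mpr (pow_succ_ne_one_of_norm_lt_one hq n).symm
    have n2 : 1 - a * q / d * q ^ n ≠ 0 := sub_ne_zero.mpr (had n).symm
    have n3 : 1 - a * q / e * q ^ n ≠ 0 := sub_ne_zero.mpr (hae n).symm
    have n4 : 1 - a * q ^ (m + 1) * q ^ (n + 1) ≠ 0 := sub_ne_zero.mpr (ham _).symm
    have p1 := qPochFin_ne_zero (pow_succ_ne_one_of_norm_lt_one hq) n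
    have p2 := qPochFin_ne_zero had n
    have p3 := qPochFin_ne_zero hae n
    have p4 := qPochFin_ne_zero ham (n + 1)
    generalize qPochFin q q n = P1 at *
    generalize qPochFin (a * q / d) q n = P2 at *
    generalize qPochFin (a * q / e) q n = P3 at *
    generalize qPochFin (a * q ^ (m + 1)) q (n + 1) = P4 at *
    generalize qPochFin a q (n + 1) = A at *
    generalize qPochFin d q (n + 1) = B at *
    generalize qPochFin e q (n + 1) = C at *
    generalize qPochFin (q ^ m)⁻¹ q n = U at *
    generalize (a * q ^ (m + 1) / (d * e)) ^ (n + 1) = Z at *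
    rw [pow_succ q n, pow_succ q m] at *
    generalize q ^ m = M at *
    generalize q ^ n = X at *
    have n2' : d - a * q * X ≠ 0 := by
      intro h; apply n2; field_simp; linear_combination h
    have n3' : e - a * q * X ≠ 0 := by
      intro h; apply n3; field_simp; linear_combination h
    have r2 : 1 - a * q / d * X = (d - a * q * X) / d := by field_simp
    have r3 : 1 - a * q / e * X = (e - a * q * X) / e := by field_simp
    rw [r2, r3]
    clear ih e1 e2 e3 e4 ham ha had hae r2 r3 n2 n3
    -- The rational identity left after the common shifted factorials are removed, with `M = q ^ m`
    -- and `X = q ^ n`.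
    have key : (1 - a * (M * q) / d) * (1 - a * (M * q) / e) *
        ((1 - a * q ^ 2 * X ^ 2) * (1 - (M * q)⁻¹) * (X * q)) * (1 - a * (M * q)) -
        (1 - a * (M * q)) * (1 - a * (M * q) / (d * e)) * ((1 - a * q ^ 2 * X ^ 2) *
          (1 - M⁻¹ * X)) * (1 - a * (M * q) * (X * q)) =
        (1 - a * (M * q)) * ((1 - a * (X * q)) * (1 - d * (X * q)) * (1 - e * (X * q)) *
          (1 - M⁻¹ * X)) * (a * (M * q) / (d * e)) -
        (1 - a * (M * q)) * (1 - q * X) * ((d - a * q * X) / d) * ((e - a * q * X) / e) *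
          (1 - a * (M * q) * (X * q)) := by
      field_simp
      ring
    have n4' : 1 - a * M * q ^ 2 * X ≠ 0 := by
      intro h; apply n4; linear_combination h
    have h1' : 1 - a * M * q ≠ 0 := by
      intro h; apply h1; linear_combination h
    field_simp at key ⊢
    linear_combination A * B * C * U * Z * key

/-- The terminating very-well-poised `₆φ₅` summation. -/
theorem sum_sixPhiTerm {q a d e : ℂ} (hq0 : q ≠ 0) (hq : ‖q‖ < 1) (hd : d ≠ 0) (he : e ≠ 0)
    (ha : ∀ n : ℕ, a * q ^ n ≠ 1) (had : ∀ n : ℕ, a * q / d * q ^ n ≠ 1)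
    (hae : ∀ n : ℕ, a * q / e * q ^ n ≠ 1) (m : ℕ) :
    qPochFin (a * q / d) q m * qPochFin (a * q / e) q m *
      (∑ i ∈ range (m + 1), sixPhiTerm q a d e m i) =
    (1 - a) * qPochFin (a * q) q m * qPochFin (a * q / (d * e)) q m := by
  induction m with
  | zero => simp [sixPhiTerm]
  | succ m ih =>
    have h := sixPhiTerm_telescope hq0 hq hd he ha had hae m (m + 1)
    -- The sum for `m` stops one index before that for `m + 1`, so both may be taken over the longer
    -- range.
    have h0 : sixPhiTerm q a d e m (m + 1) = 0 := by
      rw [sixPhiTerm, qPochFin_inv_pow_self_succ hq0]; simp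
    rw [qPochFin_inv_pow_self_succ hq0, sum_range_succ (sixPhiTerm q a d e m), h0] at h
    simp only [mul_zero, zero_div, zero_mul, add_zero] at h
    have e1 : ∀ x, a * q / x * q ^ m = a * q ^ (m + 1) / x := fun x => by rw [pow_succ]; ring
    rw [qPochFin_succ, qPochFin_succ, qPochFin_succ, qPochFin_succ, e1, e1, e1,
      show a * q * q ^ m = a * q ^ (m + 1) by ring]
    linear_combination qPochFin (a * q / d) q m * qPochFin (a * q / e) q m * h +
      (1 - a * q ^ (m + 1)) * (1 - a * q ^ (m + 1) / (d * e)) * ih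

/-- The terms of the terminating balanced `₃φ₂` series. -/
noncomputable def threePhiTerm (q A B C D : ℂ) (k j : ℕ) : ℂ :=
  (qPochFin (q ^ k)⁻¹ q j * qPochFin A q j * qPochFin B q j) /
    (qPochFin q q j * qPochFin C q j * qPochFin (D * (q ^ k)⁻¹) q j) * q ^ j

/-- The analogous certificate in `k`. The balancing condition `C * D = A * B * q` is what makes the
difference telescope. -/
theorem threePhiTerm_telescope {q A B C D : ℂ} (hq0 : q ≠ 0) (hq : ‖q‖ < 1) (hC0 : C ≠ 0)
    (hCD : C * D = A * B * q) (hC : ∀ n : ℕ, C * q ^ n ≠ 1) (k n : ℕ)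
    (hD : ∀ n : ℕ, D * q ^ n ≠ q ^ (k + 1)) :
    (1 - C * q ^ k) * (1 - D * (q ^ (k + 1))⁻¹) *
        (∑ j ∈ range (n + 1), threePhiTerm q A B C D (k + 1) j) +
      (C * q ^ k - A) * (C * q ^ k - B) / (C * q ^ k) *
        (∑ j ∈ range (n + 1), threePhiTerm q A B C D k j) =
    qPochFin A q (n + 1) * qPochFin B q (n + 1) * qPochFin (q ^ k)⁻¹ q n /
      (qPochFin q q n * qPochFin C q n * qPochFin (D * (q ^ k)⁻¹) q n) := by
  have hK := pow_ne_zero k hq0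
  have hD1 : ∀ n : ℕ, D * (q ^ (k + 1))⁻¹ * q ^ n ≠ 1 := fun n h => hD n (by
    have := pow_ne_zero (k + 1) hq0
    field_simp at h; exact h)
  have hD2 : ∀ n : ℕ, D * (q ^ k)⁻¹ * q ^ n ≠ 1 := fun n h => hD1 (n + 1) (by
    rw [← h, pow_succ, pow_succ]; field_simp)
  have h1 : 1 - D * (q ^ (k + 1))⁻¹ ≠ 0 := sub_ne_zero.mpr (by simpa using (hD1 0).symm)
  induction n with
  | zero =>
    simp only [zero_add, range_one, sum_singleton, threePhiTerm, qPochFin_succ, qPochFin_zero,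
      pow_zero, mul_one, one_mul, div_one]
    rw [pow_succ]
    field_simp
    linear_combination (C * q ^ k - 1) * hCD
  | succ n ih =>
    rw [sum_range_succ _ (n + 1), sum_range_succ _ (n + 1), mul_add, mul_add, add_add_add_comm, ih]
    have e0 : (q ^ (k + 1))⁻¹ * q = (q ^ k)⁻¹ := by rw [pow_succ]; field_simp
    have e1 : qPochFin (q ^ (k + 1))⁻¹ q (n + 1) =
        (1 - (q ^ (k + 1))⁻¹) * qPochFin (q ^ k)⁻¹ q n := by
      rw [qPochFin_succ', e0]
    have e2 : qPochFin (D * (q ^ (k + 1))⁻¹) q (n + 1) =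
        (1 - D * (q ^ (k + 1))⁻¹) * qPochFin (D * (q ^ k)⁻¹) q n := by
      rw [qPochFin_succ', mul_assoc, e0]
    simp only [threePhiTerm]
    rw [e1, e2, qPochFin_succ q q n, qPochFin_succ C q n, qPochFin_succ (D * (q ^ k)⁻¹) q n,
      qPochFin_succ A q (n + 1), qPochFin_succ B q (n + 1), qPochFin_succ (q ^ k)⁻¹ q n]
    have n1 : 1 - q * q ^ n ≠ 0 := sub_ne_zero.mpr (pow_succ_ne_one_of_norm_lt_one hq n).symm
    have n2 : 1 - C * q ^ n ≠ 0 := sub_ne_zero.mpr (hC n).symm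
    have n3 : 1 - D * (q ^ k)⁻¹ * q ^ n ≠ 0 := sub_ne_zero.mpr (hD2 n).symm
    have p1 := qPochFin_ne_zero (pow_succ_ne_one_of_norm_lt_one hq) n
    have p2 := qPochFin_ne_zero hC n
    have p3 := qPochFin_ne_zero hD2 n
    clear ih e0 e1 e2 hC hD hD1 hD2
    generalize qPochFin q q n = P1 at *
    generalize qPochFin C q n = P2 at *
    generalize qPochFin (D * (q ^ k)⁻¹) q n = P3 at *
    generalize qPochFin A q (n + 1) = A1 at *
    generalize qPochFin B q (n + 1) = B1 at *
    generalize qPochFin (q ^ k)⁻¹ q n = U at *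
    rw [pow_succ q n, pow_succ q k] at *
    generalize q ^ k = K at *
    generalize q ^ n = X at *
    have n3' : K - D * X ≠ 0 := by
      intro h; apply n3; field_simp; linear_combination h
    have r3 : 1 - D * K⁻¹ * X = (K - D * X) / K := by field_simp
    have h1' : K * q - D ≠ 0 := by
      intro h; apply h1; field_simp; linear_combination h
    have r1 : 1 - D * (K * q)⁻¹ = (K * q - D) / (K * q) := by field_simp
    rw [r1, r3]
    clear r1 r3 h1 n3
    field_simp
    linear_combination -(A1 * B1 * U * X *
      (K * (1 - q * X) * (1 - C * X) + X * (1 - C * K) * (K * q - 1))) * hCD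

/-- The `q`-Saalschütz summation. -/
theorem sum_threePhiTerm {q A B C D : ℂ} (hq0 : q ≠ 0) (hq : ‖q‖ < 1) (hA : A ≠ 0) (hB : B ≠ 0)
    (hC0 : C ≠ 0) (hCD : C * D = A * B * q) (hC : ∀ n : ℕ, C * q ^ n ≠ 1) (k : ℕ)
    (hD : ∀ n : ℕ, D * q ^ n ≠ q ^ k) :
    qPochFin C q k * qPochFin (q / D) q k * (∑ j ∈ range (k + 1), threePhiTerm q A B C D k j) =
      qPochFin (C / A) q k * qPochFin (C / B) q k := by
  have hD0 : D ≠ 0 := by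
    rintro rfl
    rw [mul_zero] at hCD
    exact mul_ne_zero (mul_ne_zero hA hB) hq0 hCD.symm
  induction k with
  | zero => simp [threePhiTerm]
  | succ k ih =>
    have ih := ih fun n h => hD (n + 1) (by rw [pow_succ, ← mul_assoc, h, pow_succ])
    have h := threePhiTerm_telescope hq0 hq hC0 hCD hC k (k + 1) hD
    have h0 : threePhiTerm q A B C D k (k + 1) = 0 := by
      rw [threePhiTerm, qPochFin_inv_pow_self_succ hq0]; simp
    rw [qPochFin_inv_pow_self_succ hq0, sum_range_succ (threePhiTerm q A B C D k), h0] at h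
    simp only [mul_zero, zero_div, add_zero] at h
    rw [qPochFin_succ, qPochFin_succ, qPochFin_succ, qPochFin_succ]
    have hK := pow_ne_zero k hq0
    have r1 : (1 - D * (q ^ (k + 1))⁻¹) = -(D / (q * q ^ k)) * (1 - q / D * q ^ k) := by
      rw [pow_succ]; field_simp; ring
    have r2 : (C * q ^ k - A) * (C * q ^ k - B) / (C * q ^ k) =
        D / (q * q ^ k) * ((1 - C / A * q ^ k) * (1 - C / B * q ^ k)) := by
      have hD' : D = A * B * q / C := by rw [eq_div_iff hC0]; linear_combination hCD
      rw [hD']; field_simp; ring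
    rw [r1, r2] at h
    have h' : (1 - C * q ^ k) * (1 - q / D * q ^ k) *
        (∑ j ∈ range (k + 1 + 1), threePhiTerm q A B C D (k + 1) j) =
        (1 - C / A * q ^ k) * (1 - C / B * q ^ k) *
          ∑ j ∈ range (k + 1), threePhiTerm q A B C D k j := by
      have : D / (q * q ^ k) ≠ 0 := by positivity
      refine mul_left_cancel₀ this ?_
      linear_combination -h
    linear_combination qPochFin C q k * qPochFin (q / D) q k * h' +
      (1 - C / A * q ^ k) * (1 - C / B * q ^ k) * ih

end TerminatingSums

/-! ### Watson's transformation. -/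

section Watson

open Finset

/-- The `q`-Saalschütz sum read backwards: it expands the part of the `₈φ₇` summand containing `b`
and `c`, so that what remains after exchanging sums is a `₆φ₅`. -/
theorem wellPoised_pair_eq_sum {q a b c : ℂ} (hq0 : q ≠ 0) (hq : ‖q‖ < 1) (ha0 : a ≠ 0)
    (hb : b ≠ 0) (hc : c ≠ 0) (hab : ∀ n : ℕ, a * q / b * q ^ n ≠ 1)
    (hac : ∀ n : ℕ, a * q / c * q ^ n ≠ 1) (k : ℕ) :
    qPochFin b q k * qPochFin c q k / (qPochFin (a * q / b) q k * qPochFin (a * q / c) q k) *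
        (a * q / (b * c)) ^ k =
      ∑ j ∈ range (k + 1), qPochFin (q ^ k)⁻¹ q j * qPochFin (a * q ^ k) q j *
        qPochFin (a * q / (b * c)) q j / (qPochFin q q j * qPochFin (a * q / b) q j *
          qPochFin (a * q / c) q j) * q ^ j := by
  have hk := pow_ne_zero k hq0
  -- `D` carries the power `q ^ (k + 1)` so that the lower parameter `D * q ^ (-k)` is `a * q / c`,
  -- independent of `k`.
  have h := sum_threePhiTerm (A := a * q ^ k) (B := a * q / (b * c)) (C := a * q / b)
    (D := a * q ^ (k + 1) / c) hq0 hq (mul_ne_zero ha0 hk)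
    (div_ne_zero (mul_ne_zero ha0 hq0) (mul_ne_zero hb hc)) (div_ne_zero (mul_ne_zero ha0 hq0) hb)
    (by rw [pow_succ]; field_simp) hab k (fun n h => hac n (by
      refine mul_left_cancel₀ hk ?_
      rw [mul_one]; refine Eq.trans ?_ h; rw [pow_succ]; ring))
  have e1 : a * q / b / (a * q ^ k) = q / b * (q ^ k)⁻¹ := by field_simp
  have e2 : a * q / b / (a * q / (b * c)) = c := by field_simp
  have e3 : q / (a * q ^ (k + 1) / c) = c / a * (q ^ k)⁻¹ := by rw [pow_succ]; field_simp
  have e4 : a * q ^ (k + 1) / c * (q ^ k)⁻¹ = a * q / c := by rw [pow_succ]; field_simp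
  have e5 : q / (c / a) = a * q / c := by field_simp
  have e6 : q / (q / b) = b := by field_simp
  have e7 : -(q / b / q) = -(c / a / q) * (a * q / (b * c)) := by field_simp
  rw [e1, e2, e3, qPochFin_mul_inv_pow hq0 (div_ne_zero hq0 hb),
    qPochFin_mul_inv_pow hq0 (div_ne_zero hc ha0), e5, e6, e7, mul_pow] at h
  simp only [threePhiTerm, e4] at h
  have n1 : (-(c / a / q)) ^ k ≠ 0 := pow_ne_zero _ (neg_ne_zero.mpr
    (div_ne_zero (div_ne_zero hc ha0) hq0))
  have n2 : ∏ i ∈ range k, (q ^ i)⁻¹ ≠ 0 :=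
    prod_ne_zero_iff.mpr fun i _ => inv_ne_zero (pow_ne_zero i hq0)
  have n3 := qPochFin_ne_zero hab k
  have n4 := qPochFin_ne_zero hac k
  rw [div_mul_eq_mul_div, div_eq_iff (mul_ne_zero n3 n4)]
  refine mul_left_cancel₀ (mul_ne_zero n1 n2) ?_
  linear_combination -h

/-- The terms of the terminating very-well-poised `₈φ₇` series with last numerator parameter
`q ^ (-N)`. -/
noncomputable def eightPhiTerm (q a b c d e : ℂ) (N k : ℕ) : ℂ :=
  (1 - a * q ^ (2 * k)) * (qPochFin a q k * qPochFin b q k * qPochFin c q k * qPochFin d q k *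
    qPochFin e q k * qPochFin (q ^ N)⁻¹ q k) / (qPochFin q q k * qPochFin (a * q / b) q k *
    qPochFin (a * q / c) q k * qPochFin (a * q / d) q k * qPochFin (a * q / e) q k *
    qPochFin (a * q ^ (N + 1)) q k) * (a ^ 2 * q ^ (N + 2) / (b * c * d * e)) ^ k

/-- With `k = j + i`, the dependence on `i` is again a `₆φ₅` summand, with `a, d, e` replaced by `a
* q ^ (2 * j), d * q ^ j, e * q ^ j`. The regrouping rests on `(a)_{j+i} (a q^{j+i})_j = (a)_{2j} (a
q^{2j})_i`. -/
theorem eightPhi_summand_shift {q a d e : ℂ} (hq0 : q ≠ 0) (hq : ‖q‖ < 1) (hd : d ≠ 0)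
    (he : e ≠ 0) (ha : ∀ n : ℕ, a * q ^ n ≠ 1) (had : ∀ n : ℕ, a * q / d * q ^ n ≠ 1)
    (hae : ∀ n : ℕ, a * q / e * q ^ n ≠ 1) (m j i : ℕ) :
    sixPhiTerm q a d e (j + m) (j + i) * (qPochFin (q ^ (j + i))⁻¹ q j *
      qPochFin (a * q ^ (j + i)) q j * q ^ j) =
    qPochFin a q (2 * j) * (qPochFin d q j * qPochFin e q j * qPochFin (q ^ (j + m))⁻¹ q j) /
      (qPochFin (a * q / d) q j * qPochFin (a * q / e) q j *
        qPochFin (a * q ^ (j + m + 1)) q j) * ((-(a * q ^ (j + m + 1) / (d * e))) ^ j *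
      ∏ l ∈ range j, (q ^ l)⁻¹) *
      sixPhiTerm q (a * q ^ (2 * j)) (d * q ^ j) (e * q ^ j) m i := by
  have hj := pow_ne_zero j hq0
  have ham : ∀ n : ℕ, a * q ^ (j + m + 1) * q ^ n ≠ 1 := fun n => by
    rw [mul_assoc, ← pow_add]; exact ha _
  have c1 : qPochFin a q (j + i) * qPochFin (a * q ^ (j + i)) q j =
      qPochFin a q (2 * j) * qPochFin (a * q ^ (2 * j)) q i := by
    rw [← qPochFin_add, ← qPochFin_add]; congr 1; ring
  have c2 := qPochFin_inv_pow_add hq0 j i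
  have c3 : (q ^ (j + m))⁻¹ * q ^ j = (q ^ m)⁻¹ := by rw [pow_add]; field_simp
  have c4 : a * q / d * q ^ j = a * q ^ (2 * j) * q / (d * q ^ j) := by
    rw [two_mul, pow_add]; field_simp
  have c5 : a * q / e * q ^ j = a * q ^ (2 * j) * q / (e * q ^ j) := by
    rw [two_mul, pow_add]; field_simp
  have c6 : a * q ^ (j + m + 1) * q ^ j = a * q ^ (2 * j) * q ^ (m + 1) := by ring
  have c7 : a * q ^ (2 * j) * q ^ (m + 1) / (d * q ^ j * (e * q ^ j)) =
      a * q ^ (j + m + 1) / (d * e) * (q ^ j)⁻¹ := by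
    rw [add_assoc, pow_add q j (m + 1), two_mul, pow_add]; field_simp
  have c8 : a * q ^ (2 * j) * q ^ (2 * i) = a * q ^ (2 * (j + i)) := by ring
  have n1 := qPochFin_ne_zero (pow_succ_ne_one_of_norm_lt_one hq) (j + i)
  have n2 := qPochFin_ne_zero (pow_succ_ne_one_of_norm_lt_one hq) i
  have n3 := qPochFin_ne_zero had (j + i)
  have n4 := qPochFin_ne_zero hae (j + i)
  have n5 := qPochFin_ne_zero ham (j + i)
  unfold sixPhiTerm
  rw [qPochFin_add _ _ j i] at n3 n4 n5
  rw [c7, c8, qPochFin_add d q j i, qPochFin_add e q j i, qPochFin_add (q ^ (j + m))⁻¹ q j i,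
    qPochFin_add (a * q / d) q j i, qPochFin_add (a * q / e) q j i,
    qPochFin_add (a * q ^ (j + m + 1)) q j i, c3, ← c4, ← c5, ← c6, pow_add _ j i, mul_pow,
    neg_pow (a * q ^ (j + m + 1) / (d * e)) j]
  have n3' := left_ne_zero_of_mul n3
  have n3'' := right_ne_zero_of_mul n3
  have n4' := left_ne_zero_of_mul n4
  have n4'' := right_ne_zero_of_mul n4
  have n5' := left_ne_zero_of_mul n5
  have n5'' := right_ne_zero_of_mul n5
  have c2' : qPochFin (q ^ (j + i))⁻¹ q j = qPochFin q q (j + i) * ((-1) ^ j *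
      (∏ l ∈ range j, (q ^ l)⁻¹) * (q ^ j)⁻¹ * ((q ^ j)⁻¹) ^ i) / qPochFin q q i := by
    rw [eq_div_iff n2, c2]
  rw [c2']
  generalize a * q ^ (j + m + 1) / (d * e) = z
  generalize (q ^ j)⁻¹ ^ i = y
  generalize ∏ l ∈ range j, (q ^ l)⁻¹ = w
  clear c2 c2' c3 c4 c5 c6 c7 c8 ham had hae ha n3 n4 n5
  generalize qPochFin a q (j + i) = A₁ at *
  generalize qPochFin (a * q ^ (j + i)) q j = A₂ at *
  generalize qPochFin a q (2 * j) = A₃ at *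
  generalize qPochFin (a * q ^ (2 * j)) q i = A₄ at *
  generalize qPochFin q q (j + i) = Q₁ at *
  generalize qPochFin q q i = Q₂ at *
  generalize qPochFin (a * q / d) q j = D₁ at *
  generalize qPochFin (a * q / d * q ^ j) q i = D₂ at *
  generalize qPochFin (a * q / e) q j = E₁ at *
  generalize qPochFin (a * q / e * q ^ j) q i = E₂ at *
  generalize qPochFin (a * q ^ (j + m + 1)) q j = F₁ at *
  generalize qPochFin (a * q ^ (j + m + 1) * q ^ j) q i = F₂ at *
  generalize qPochFin d q j = D₃
  generalize qPochFin (d * q ^ j) q i = D₄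
  generalize qPochFin e q j = E₃
  generalize qPochFin (e * q ^ j) q i = E₄
  generalize qPochFin (q ^ (j + m))⁻¹ q j = U₁
  generalize qPochFin (q ^ m)⁻¹ q i = U₂
  generalize a * q ^ (2 * (j + i)) = v
  generalize z ^ j = z₁
  generalize z ^ i = z₂
  generalize q ^ j = p at *
  generalize (-1 : ℂ) ^ j = ε
  rw [show (1 - v) * (A₁ * (D₃ * D₄) * (E₃ * E₄) * (U₁ * U₂)) / (Q₁ * (D₁ * D₂) * (E₁ * E₂) *
    (F₁ * F₂)) * (z₁ * z₂) * (Q₁ * (ε * w * p⁻¹ * y) / Q₂ * A₂ * p) =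
    (A₁ * A₂) * ((1 - v) * ((D₃ * D₄) * (E₃ * E₄) * (U₁ * U₂)) / (Q₁ * (D₁ * D₂) * (E₁ * E₂) *
    (F₁ * F₂)) * (z₁ * z₂) * (Q₁ * (ε * w * p⁻¹ * y) / Q₂ * p)) by ring, c1]
  have hp := mul_inv_cancel₀ hj
  have hQ := mul_inv_cancel₀ n1
  simp only [div_eq_mul_inv, mul_inv]
  linear_combination (A₃ * A₄ * ((1 - v) * (D₃ * D₄ * (E₃ * E₄) * (U₁ * U₂)) *
    (D₁⁻¹ * D₂⁻¹ * (E₁⁻¹ * E₂⁻¹) * (F₁⁻¹ * F₂⁻¹)) * (z₁ * z₂) * (ε * w * y * Q₂⁻¹))) *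
      (hp + p * p⁻¹ * hQ)

/-- Watson's transformation of a terminating very-well-poised `₈φ₇` series. -/
theorem sum_eightPhiTerm {q a b c d e : ℂ} (hq0 : q ≠ 0) (hq : ‖q‖ < 1) (ha0 : a ≠ 0)
    (hb : b ≠ 0) (hc : c ≠ 0) (hd : d ≠ 0) (he : e ≠ 0) (ha : ∀ n : ℕ, a * q ^ n ≠ 1)
    (hab : ∀ n : ℕ, a * q / b * q ^ n ≠ 1) (hac : ∀ n : ℕ, a * q / c * q ^ n ≠ 1)
    (had : ∀ n : ℕ, a * q / d * q ^ n ≠ 1) (hae : ∀ n : ℕ, a * q / e * q ^ n ≠ 1) (N : ℕ) :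
    qPochFin (a * q / d) q N * qPochFin (a * q / e) q N *
      (∑ k ∈ range (N + 1), eightPhiTerm q a b c d e N k) =
    (1 - a) * qPochFin (a * q) q N * ∑ j ∈ range (N + 1),
      qPochFin d q j * qPochFin e q j * qPochFin (q ^ N)⁻¹ q j * qPochFin (a * q / (b * c)) q j /
        (qPochFin q q j * qPochFin (a * q / b) q j * qPochFin (a * q / c) q j) *
        qPochFin (a * q / (d * e)) q (N - j) * ((-(a * q ^ (N + 1) / (d * e))) ^ j *
          ∏ l ∈ range j, (q ^ l)⁻¹) := by
  have split : ∀ k, eightPhiTerm q a b c d e N k = ∑ j ∈ range (k + 1),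
      sixPhiTerm q a d e N k * (qPochFin (q ^ k)⁻¹ q j * qPochFin (a * q ^ k) q j * q ^ j) *
        (qPochFin (a * q / (b * c)) q j / (qPochFin q q j * qPochFin (a * q / b) q j *
          qPochFin (a * q / c) q j)) := by
    intro k
    have h := wellPoised_pair_eq_sum hq0 hq ha0 hb hc hab hac k
    have e1 : a ^ 2 * q ^ (N + 2) / (b * c * d * e) =
        a * q ^ (N + 1) / (d * e) * (a * q / (b * c)) := by
      field_simp; ring
    rw [eightPhiTerm, e1, mul_pow]
    have e2 : ∀ x y : ℂ, x = sixPhiTerm q a d e N k * (qPochFin b q k * qPochFin c q k /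
        (qPochFin (a * q / b) q k * qPochFin (a * q / c) q k) * (a * q / (b * c)) ^ k) →
        y = sixPhiTerm q a d e N k * (∑ j ∈ range (k + 1), qPochFin (q ^ k)⁻¹ q j *
          qPochFin (a * q ^ k) q j * qPochFin (a * q / (b * c)) q j / (qPochFin q q j *
          qPochFin (a * q / b) q j * qPochFin (a * q / c) q j) * q ^ j) → x = y := by
      rintro x y rfl rfl
      rw [h]
    refine e2 _ _ ?_ ?_
    · rw [sixPhiTerm]
      simp only [div_eq_mul_inv, mul_inv]
      ring
    · rw [mul_sum]
      exact sum_congr rfl fun j _ => by ring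
  rw [sum_congr rfl fun k _ => split k]
  -- The double sum over `j ≤ k ≤ N` is reindexed by `k = j + i`, so that the sum over `i` becomes
  -- the inner one.
  have flip := sum_range_diag_flip (N + 1) (fun j i =>
    sixPhiTerm q a d e N (j + i) * (qPochFin (q ^ (j + i))⁻¹ q j *
      qPochFin (a * q ^ (j + i)) q j * q ^ j) *
        (qPochFin (a * q / (b * c)) q j / (qPochFin q q j * qPochFin (a * q / b) q j *
          qPochFin (a * q / c) q j)))
  have e1 : ∀ k, ∑ j ∈ range (k + 1), sixPhiTerm q a d e N k * (qPochFin (q ^ k)⁻¹ q j *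
      qPochFin (a * q ^ k) q j * q ^ j) * (qPochFin (a * q / (b * c)) q j / (qPochFin q q j *
        qPochFin (a * q / b) q j * qPochFin (a * q / c) q j)) =
      ∑ j ∈ range (k + 1), sixPhiTerm q a d e N (j + (k - j)) *
        (qPochFin (q ^ (j + (k - j)))⁻¹ q j * qPochFin (a * q ^ (j + (k - j))) q j * q ^ j) *
        (qPochFin (a * q / (b * c)) q j / (qPochFin q q j *
        qPochFin (a * q / b) q j * qPochFin (a * q / c) q j)) := fun k =>
    sum_congr rfl fun j hj => by
      rw [Nat.add_sub_cancel' (Nat.lt_succ_iff.mp (mem_range.mp hj))]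
  rw [sum_congr rfl fun k _ => e1 k, flip, mul_sum, mul_sum]
  refine sum_congr rfl fun j hj => ?_
  obtain ⟨m, rfl⟩ := Nat.exists_eq_add_of_le (Nat.lt_succ_iff.mp (mem_range.mp hj))
  have e2 : j + m + 1 - j = m + 1 := by omega
  rw [e2, Nat.add_sub_cancel_left, ← sum_mul,
    sum_congr rfl fun i _ => eightPhi_summand_shift hq0 hq hd he ha had hae m j i, ← mul_sum]
  have hj := pow_ne_zero j hq0
  have c4 : a * q ^ (2 * j) * q / (d * q ^ j) = a * q / d * q ^ j := by
    rw [two_mul, pow_add]; field_simp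
  have c5 : a * q ^ (2 * j) * q / (e * q ^ j) = a * q / e * q ^ j := by
    rw [two_mul, pow_add]; field_simp
  have c6 : a * q ^ (2 * j) * q / (d * q ^ j * (e * q ^ j)) = a * q / (d * e) := by
    rw [two_mul, pow_add]; field_simp
  have h := sum_sixPhiTerm (a := a * q ^ (2 * j)) (d := d * q ^ j) (e := e * q ^ j) hq0 hq
    (mul_ne_zero hd hj) (mul_ne_zero he hj)
    (fun n => by rw [mul_assoc, ← pow_add]; exact ha _)
    (fun n => by rw [c4, mul_assoc, ← pow_add]; exact had _)
    (fun n => by rw [c5, mul_assoc, ← pow_add]; exact hae _) m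
  rw [c4, c5, c6] at h
  have ham : ∀ n : ℕ, a * q ^ (j + m + 1) * q ^ n ≠ 1 := fun n => by
    rw [mul_assoc, ← pow_add]; exact ha _
  have n1 := qPochFin_ne_zero had j
  have n2 := qPochFin_ne_zero hae j
  have n3 := qPochFin_ne_zero ham j
  have c7 : qPochFin a q (2 * j) * ((1 - a * q ^ (2 * j)) * qPochFin (a * q ^ (2 * j) * q) q m) =
      (1 - a) * qPochFin (a * q) q (j + m) * qPochFin (a * q ^ (j + m + 1)) q j := by
    rw [← qPochFin_succ', ← qPochFin_add, ← qPochFin_succ', ← qPochFin_add]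
    congr 1; ring
  rw [qPochFin_add (a * q / d), qPochFin_add (a * q / e)]
  generalize ∑ i ∈ range (m + 1), sixPhiTerm q (a * q ^ (2 * j)) (d * q ^ j) (e * q ^ j) m i = S
    at *
  generalize (-(a * q ^ (j + m + 1) / (d * e))) ^ j = Z
  generalize ∏ l ∈ range j, (q ^ l)⁻¹ = W
  generalize qPochFin (a * q / d * q ^ j) q m = D at *
  generalize qPochFin (a * q / e * q ^ j) q m = E at *
  generalize hTdef : qPochFin (a * q / (b * c)) q j / (qPochFin q q j * qPochFin (a * q / b) q j *
          qPochFin (a * q / c) q j) = T at *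
  generalize qPochFin (a * q / d) q j = D₁ at *
  generalize qPochFin (a * q / e) q j = E₁ at *
  generalize qPochFin (a * q ^ (j + m + 1)) q j = F₁ at *
  have hT : qPochFin d q j * qPochFin e q j * qPochFin (q ^ (j + m))⁻¹ q j *
      qPochFin (a * q / (b * c)) q j / (qPochFin q q j * qPochFin (a * q / b) q j *
        qPochFin (a * q / c) q j) = qPochFin d q j * qPochFin e q j *
      qPochFin (q ^ (j + m))⁻¹ q j * T := by rw [← hTdef]; ring
  rw [hT]
  clear hTdef hT c4 c5 c6 ham split flip e1
  generalize qPochFin d q j * qPochFin e q j * qPochFin (q ^ (j + m))⁻¹ q j = V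
  generalize qPochFin (a * q / (d * e)) q m = R at *
  have hD := mul_inv_cancel₀ n1
  have hE := mul_inv_cancel₀ n2
  have hF := mul_inv_cancel₀ n3
  simp only [div_eq_mul_inv, mul_inv]
  linear_combination (D₁ * E₁ * D₁⁻¹ * E₁⁻¹ * F₁⁻¹ * qPochFin a q (2 * j) * V * (Z * W) * T) * h +
    (D₁ * E₁ * D₁⁻¹ * E₁⁻¹ * F₁⁻¹ * V * (Z * W) * T * R) * c7 +
    (1 - a) * qPochFin (a * q) q (j + m) * V * (Z * W) * T * R *
      (E₁ * E₁⁻¹ * F₁ * F₁⁻¹ * hD + F₁ * F₁⁻¹ * hE + hF)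

end Watson

/-! ### Bailey's terminating transformation and terminating values of `wpSeries`. -/

section BaileyTransformation

open Filter Topology

/-- Bailey's transformation of a terminating very-well-poised `₈φ₇` series. -/
theorem sum_eightPhiTerm_transformation {q a b c d e l : ℂ} (hq0 : q ≠ 0) (hq : ‖q‖ < 1)
    (ha0 : a ≠ 0) (hb : b ≠ 0) (hc : c ≠ 0) (hd : d ≠ 0) (he : e ≠ 0)
    (hl : l * (b * c * d) = a ^ 2 * q) (ha : ∀ n : ℕ, a * q ^ n ≠ 1)
    (hln : ∀ n : ℕ, l * q ^ n ≠ 1) (hab : ∀ n : ℕ, a * q / b * q ^ n ≠ 1)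
    (hac : ∀ n : ℕ, a * q / c * q ^ n ≠ 1) (had : ∀ n : ℕ, a * q / d * q ^ n ≠ 1)
    (hae : ∀ n : ℕ, a * q / e * q ^ n ≠ 1) (hle : ∀ n : ℕ, l * q / e * q ^ n ≠ 1) (N : ℕ) :
    qPochFin (a * q / e) q N * ((1 - l) * qPochFin (l * q) q N) *
        (∑ k ∈ Finset.range (N + 1), eightPhiTerm q a b c d e N k) =
      (1 - a) * qPochFin (a * q) q N * qPochFin (l * q / e) q N *
        ∑ k ∈ Finset.range (N + 1),
          eightPhiTerm q l (l * b / a) (l * c / a) (l * d / a) e N k := by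
  have hl0 : l ≠ 0 := by
    rintro rfl
    rw [zero_mul] at hl
    exact mul_ne_zero (pow_ne_zero 2 ha0) hq0 hl.symm
  have hl' : l = a ^ 2 * q / (b * c * d) := by
    rw [eq_div_iff (mul_ne_zero (mul_ne_zero hb hc) hd), hl]
  have e1 : ∀ x, x ≠ 0 → l * q / (l * x / a) = a * q / x := fun x hx => by field_simp
  -- Passing to base `l` interchanges `d` and `a * q / (b * c)` and preserves the remaining data in
  -- Watson's formula. Both series therefore have the same right-hand sum, up to the prefactor.
  have e2 : l * q / (l * b / a * (l * c / a)) = d := by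
    rw [hl']; field_simp
  have e3 : l * d / a = a * q / (b * c) := by rw [hl']; field_simp
  have e4 : l * q / (l * d / a * e) = a * q / (d * e) := by field_simp
  have h1 := sum_eightPhiTerm hq0 hq ha0 hb hc hd he ha hab hac had hae N
  have h2 := sum_eightPhiTerm hq0 hq hl0 (div_ne_zero (mul_ne_zero hl0 hb) ha0)
    (div_ne_zero (mul_ne_zero hl0 hc) ha0) (div_ne_zero (mul_ne_zero hl0 hd) ha0) he hln
    (by rwa [e1 b hb]) (by rwa [e1 c hc]) (by rwa [e1 d hd]) hle N
  have e5 : l * q ^ (N + 1) / (l * d / a * e) = a * q ^ (N + 1) / (d * e) := by field_simp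
  rw [e1 b hb, e1 c hc, e1 d hd, e2, e4, e5] at h2
  have hs : ∀ j, qPochFin (l * d / a) q j * qPochFin e q j * qPochFin (q ^ N)⁻¹ q j *
      qPochFin d q j = qPochFin d q j * qPochFin e q j * qPochFin (q ^ N)⁻¹ q j *
      qPochFin (a * q / (b * c)) q j := fun j => by rw [e3]; ring
  simp only [hs] at h2
  refine mul_left_cancel₀ (qPochFin_ne_zero had N) ?_
  linear_combination ((1 - l) * qPochFin (l * q) q N) * h1 -
    ((1 - a) * qPochFin (a * q) q N) * h2

/-- The value of `wpTerm` in terms of finite shifted factorials. -/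
theorem wpTerm_natCast {q x : ℂ} (hq0 : q ≠ 0) (hq : ‖q‖ < 1) (hx : x ≠ 0) {γ : Fin 6 → ℂ}
    (hγ : ∀ j, γ j ≠ 0) (k : ℕ) :
    wpTerm q x γ k * ∏ j, qPochFin (q * γ j * x) q k =
      (1 - x ^ 2 * q ^ (2 * k)) * (∏ j, qPochFin (x / γ j) q k) * (q ^ 2 * ∏ j, γ j) ^ k *
        ∏ j, (qPochInf (q * γ j * x) q * qPochInf (q * γ j / x) q) := by
  have hk := pow_ne_zero k hq0
  have h1 : ∀ j, qPochInf (q * γ j * (x * q ^ (k : ℤ))) q *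
      qPochInf (q * γ j / (x * q ^ (k : ℤ))) q * qPochFin (q * γ j * x) q k =
      (qPochInf (q * γ j * x) q * qPochInf (q * γ j / x) q) * (γ j) ^ k * (-1 / x) ^ k *
        (∏ i ∈ Finset.range k, (q ^ i)⁻¹) * qPochFin (x / γ j) q k := by
    intro j
    rw [zpow_natCast]
    have e1 := qPochInf_eq_mul (q * γ j * x) q hq k
    have e2 := qPochInf_eq_mul (q * γ j / x * (q ^ k)⁻¹) q hq k
    rw [inv_mul_cancel_right₀ hk] at e2
    have e3 := qPochFin_mul_inv_pow hq0 (div_ne_zero (mul_ne_zero hq0 (hγ j)) hx) k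
    have e4 : q * γ j / (x * q ^ k) = q * γ j / x * (q ^ k)⁻¹ := by field_simp
    have e5 : q / (q * γ j / x) = x / γ j := by have := hγ j; field_simp
    have e6 : -(q * γ j / x / q) = γ j * (-1 / x) := by field_simp
    rw [e5, e6, mul_pow] at e3
    rw [e4, e2, show ∏ i ∈ Finset.range k, (1 - q * γ j / x * (q ^ k)⁻¹ * q ^ i) =
      qPochFin (q * γ j / x * (q ^ k)⁻¹) q k from rfl, e3, e1,
      show ∏ i ∈ Finset.range k, (1 - q * γ j * x * q ^ i) = qPochFin (q * γ j * x) q k from rfl,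
      ← mul_assoc (q * γ j) x]
    ring
  -- The Gaussian factor of `wpTerm` cancels the six Gaussian factors from reversing the products,
  -- leaving only `(q ^ 2) ^ k`.
  have h2 : (∏ i ∈ Finset.range k, (q ^ i)⁻¹) ^ 6 * q ^ (3 * (k : ℤ) ^ 2 - k) = (q ^ 2) ^ k := by
    clear h1 hk
    induction k with
    | zero => simp
    | succ k ih =>
      rw [Finset.prod_range_succ, mul_pow, pow_succ (q ^ 2), ← ih]
      have : (3 * ((k + 1 : ℕ) : ℤ) ^ 2 - ((k + 1 : ℕ) : ℤ)) =
          (3 * (k : ℤ) ^ 2 - k) + (k : ℤ) * 6 + 2 := by push_cast; ring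
      rw [this, zpow_add₀ hq0, zpow_add₀ hq0, zpow_mul, zpow_natCast]
      have hk := pow_ne_zero k hq0
      have h6 : (q ^ k) ^ (6 : ℤ) = (q ^ k) ^ 6 := rfl
      have h2 : q ^ (2 : ℤ) = q ^ 2 := rfl
      rw [h6, h2]
      field_simp
  have h3 : x ^ (6 * (k : ℤ)) * ((-1 / x) ^ k) ^ 6 = 1 := by
    have : x ^ (6 * (k : ℤ)) = (x ^ k) ^ 6 := by
      rw [mul_comm, zpow_mul, zpow_natCast]; rfl
    rw [this, ← mul_pow, ← mul_pow, mul_div_cancel₀ _ hx, ← pow_mul, mul_comm k, pow_mul]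
    norm_num
  unfold wpTerm
  rw [mul_assoc, ← Finset.prod_mul_distrib, Finset.prod_congr rfl fun j _ => h1 j]
  simp only [Finset.prod_mul_distrib, Finset.prod_const, Finset.card_fin, Finset.prod_pow]
  rw [mul_pow (q ^ 2), ← h2, zpow_natCast]
  have h4 : (x * q ^ k) ^ 2 = x ^ 2 * q ^ (2 * k) := by ring
  rw [h4]
  linear_combination ((1 - x ^ 2 * q ^ (2 * k)) * q ^ (3 * (k : ℤ) ^ 2 - (k : ℤ)) *
    ((∏ j, qPochInf (q * γ j * x) q) * (∏ j, qPochInf (q * γ j / x) q) * (∏ j, γ j) ^ k *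
      (∏ i ∈ Finset.range k, (q ^ i)⁻¹) ^ 6 * ∏ j, qPochFin (x / γ j) q k)) * h3

theorem qPochInf_zpow_eq_zero {q : ℂ} (hq0 : q ≠ 0) (hq : ‖q‖ < 1) {k : ℤ} (hk : k ≤ 0) :
    qPochInf (q ^ k) q = 0 := by
  rw [qPochInf_eq_zero_iff hq]
  obtain ⟨n, hn⟩ := Int.eq_ofNat_of_zero_le (neg_nonneg.mpr hk)
  refine ⟨n, ?_⟩
  rw [← zpow_natCast, ← hn, ← zpow_add₀ hq0]
  simp

/-- At `x = (γ i)⁻¹` the `i`-th product contains `(q ^ (k + 1); q)_∞`, which is zero for every `k <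
0`. -/
theorem wpSeries_eq_tsum_nat {q : ℂ} (hq0 : q ≠ 0) (hq : ‖q‖ < 1) {γ : Fin 6 → ℂ} {i : Fin 6}
    (hi : γ i ≠ 0) : wpSeries q (γ i)⁻¹ γ = ∑' k : ℕ, wpTerm q (γ i)⁻¹ γ k := by
  refine (Function.Injective.tsum_eq (g := fun k : ℕ => (k : ℤ)) Nat.cast_injective ?_).symm
  intro k hk
  rcases le_or_gt 0 k with h | h
  · exact ⟨k.toNat, Int.toNat_of_nonneg h⟩
  · exfalso
    apply hk
    have : qPochInf (q * γ i * ((γ i)⁻¹ * q ^ k)) q = 0 := by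
      have e : q * γ i * ((γ i)⁻¹ * q ^ k) = q ^ (k + 1) := by
        rw [zpow_add_one₀ hq0]; field_simp
      rw [e]
      exact qPochInf_zpow_eq_zero hq0 hq (by omega)
    unfold wpTerm
    rw [Finset.prod_eq_zero (Finset.mem_univ i) (by rw [this, zero_mul]), mul_zero]

theorem wpSeries_comp_perm (q x : ℂ) (γ : Fin 6 → ℂ) (σ : Equiv.Perm (Fin 6)) :
    wpSeries q x (γ ∘ σ) = wpSeries q x γ := by
  unfold wpSeries wpTerm
  refine tsum_congr fun k => ?_
  congr 1
  exact Equiv.prod_comp σ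
    (fun j => qPochInf (q * γ j * (x * q ^ k)) q * qPochInf (q * γ j / (x * q ^ k)) q)

/-- The first parameter cuts off the negative indices, and the last one, `q ^ N / g₁`, contributes
`(q ^ (N + 1 - k); q)_∞`, which cuts off `k > N`. -/
theorem wpSeries_terminating {q g₁ g₂ g₃ g₄ g₅ : ℂ} (hq0 : q ≠ 0) (hq : ‖q‖ < 1) (h₁ : g₁ ≠ 0)
    (h₂ : g₂ ≠ 0) (h₃ : g₃ ≠ 0) (h₄ : g₄ ≠ 0) (h₅ : g₅ ≠ 0)
    (ha : ∀ n : ℕ, 1 / g₁ ^ 2 * q ^ n ≠ 1) (hb : ∀ n : ℕ, q * g₂ / g₁ * q ^ n ≠ 1)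
    (hc : ∀ n : ℕ, q * g₃ / g₁ * q ^ n ≠ 1) (hd : ∀ n : ℕ, q * g₄ / g₁ * q ^ n ≠ 1)
    (he : ∀ n : ℕ, q * g₅ / g₁ * q ^ n ≠ 1) (N : ℕ) :
    wpSeries q g₁⁻¹ ![g₁, g₂, g₃, g₄, g₅, q ^ N / g₁] =
      (∏ j, (qPochInf (q * ![g₁, g₂, g₃, g₄, g₅, q ^ N / g₁] j * g₁⁻¹) q *
        qPochInf (q * ![g₁, g₂, g₃, g₄, g₅, q ^ N / g₁] j / g₁⁻¹) q)) *
      ∑ k ∈ Finset.range (N + 1), eightPhiTerm q (1 / g₁ ^ 2) (1 / (g₁ * g₂)) (1 / (g₁ * g₃))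
        (1 / (g₁ * g₄)) (1 / (g₁ * g₅)) N k := by
  have hN := pow_ne_zero N hq0
  have h := wpSeries_eq_tsum_nat hq0 hq (γ := ![g₁, g₂, g₃, g₄, g₅, q ^ N / g₁]) (i := 0) h₁
  simp only [Matrix.cons_val_zero] at h
  rw [h, tsum_eq_sum (s := Finset.range (N + 1)), Finset.mul_sum]
  · refine Finset.sum_congr rfl fun k _ => ?_
    have hγ : ∀ j, ![g₁, g₂, g₃, g₄, g₅, q ^ N / g₁] j ≠ 0 := by
      intro j; fin_cases j <;> simp [h₁, h₂, h₃, h₄, h₅, hq0]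
    have := wpTerm_natCast hq0 hq (inv_ne_zero h₁) hγ k
    have haN : ∀ n : ℕ, 1 / g₁ ^ 2 * q ^ (N + 1) * q ^ n ≠ 1 := fun n => by
      rw [mul_assoc, ← pow_add]; exact ha _
    have e1 : q * g₁ * g₁⁻¹ = q := by field_simp
    have e2 : ∀ g, q * g * g₁⁻¹ = q * g / g₁ := fun g => by field_simp
    have e3 : q * (q ^ N / g₁) * g₁⁻¹ = 1 / g₁ ^ 2 * q ^ (N + 1) := by field_simp; ring
    have e4 : ∀ g, g ≠ 0 → 1 / g₁ ^ 2 * q / (1 / (g₁ * g)) = q * g / g₁ := fun g hg => by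
      field_simp
    have e5 : g₁⁻¹ / g₁ = 1 / g₁ ^ 2 := by field_simp
    have e6 : ∀ g, g₁⁻¹ / g = 1 / (g₁ * g) := fun g => by field_simp
    have e7 : g₁⁻¹ / (q ^ N / g₁) = (q ^ N)⁻¹ := by field_simp
    have e8 : q ^ 2 * (g₁ * g₂ * g₃ * g₄ * g₅ * (q ^ N / g₁)) = (1 / g₁ ^ 2) ^ 2 * q ^ (N + 2) /
        (1 / (g₁ * g₂) * (1 / (g₁ * g₃)) * (1 / (g₁ * g₄)) * (1 / (g₁ * g₅))) := by
      field_simp; ring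
    have p0 := qPochFin_ne_zero (pow_succ_ne_one_of_norm_lt_one hq) k
    have p1 := qPochFin_ne_zero hb k
    have p2 := qPochFin_ne_zero hc k
    have p3 := qPochFin_ne_zero hd k
    have p4 := qPochFin_ne_zero he k
    have p5 := qPochFin_ne_zero haN k
    set Pr := ∏ j, (qPochInf (q * ![g₁, g₂, g₃, g₄, g₅, q ^ N / g₁] j * g₁⁻¹) q *
        qPochInf (q * ![g₁, g₂, g₃, g₄, g₅, q ^ N / g₁] j / g₁⁻¹) q) with hPr
    set w := wpTerm q g₁⁻¹ ![g₁, g₂, g₃, g₄, g₅, q ^ N / g₁] k with hw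
    simp only [Fin.prod_univ_six, Matrix.cons_val] at this
    rw [e1, e2 g₂, e2 g₃, e2 g₄, e2 g₅, e3, e5, e6, e6, e6, e6, e7, e8] at this
    rw [eightPhiTerm, e4 _ h₂, e4 _ h₃, e4 _ h₄, e4 _ h₅]
    rw [← eq_div_iff (mul_ne_zero (mul_ne_zero (mul_ne_zero (mul_ne_zero (mul_ne_zero p0 p1) p2)
      p3) p4) p5)] at this
    rw [this, show g₁⁻¹ ^ 2 = 1 / g₁ ^ 2 by rw [inv_pow, one_div]]
    ring
  · intro k hk
    have hk : N < k := by simpa using hk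
    unfold wpTerm
    rw [Finset.prod_eq_zero (Finset.mem_univ 5), mul_zero]
    have e : q * ![g₁, g₂, g₃, g₄, g₅, q ^ N / g₁] 5 / (g₁⁻¹ * q ^ (k : ℤ)) =
        q ^ ((N : ℤ) + 1 - k) := by
      rw [zpow_sub₀ hq0, zpow_add_one₀ hq0]
      simp only [Matrix.cons_val, zpow_natCast]
      field_simp
    rw [e, qPochInf_zpow_eq_zero hq0 hq (by omega), mul_zero]

end BaileyTransformation

/-! ### Bailey's nonterminating two-term transformation. -/

section NonterminatingBailey

open Filter Topology

/-- The finite transformation with base `1 / g₁ ^ 2` and `l = 1 / (r * g₁) ^ 2`. The finite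
factorials are completed to infinite products in which `N` occurs only through `q ^ N / g₁`, so that
this quantity can become a free variable. -/
theorem wpSeries_terminating_transformation {q r g₁ g₂ g₃ g₄ g₅ : ℂ} (hq0 : q ≠ 0) (hq : ‖q‖ < 1)
    (hr : r ^ 2 * (q * (g₁ * g₂ * g₃ * g₄)) = 1) (h₅ : g₅ ≠ 0)
    (ha : ∀ k : ℤ, g₁ ^ 2 ≠ q ^ k) (hb : ∀ k : ℤ, g₂ ≠ q ^ k * g₁) (hc : ∀ k : ℤ, g₃ ≠ q ^ k * g₁)
    (hd : ∀ k : ℤ, g₄ ≠ q ^ k * g₁) (he : ∀ k : ℤ, g₅ ≠ q ^ k * g₁)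
    (hl : ∀ k : ℤ, g₂ * g₃ * g₄ ≠ q ^ k * g₁) (hle : ∀ k : ℤ, g₂ * g₃ * g₄ * g₅ ≠ q ^ k) (N : ℕ) :
    wpSeries q g₁⁻¹ ![g₁, g₂, g₃, g₄, g₅, q ^ N / g₁] *
      (qPochInf (q * g₅ * (q ^ N / g₁) / r ^ 2) q * qTheta (q * (g₂ * g₃ * g₄) / g₁) q *
        (qPochInf (1 / (g₂ * g₃)) q * qPochInf (1 / (g₂ * g₄)) q * qPochInf (1 / (g₃ * g₄)) q)) =
    wpSeries q (r * g₁)⁻¹ ![r * g₁, r * g₂, r * g₃, r * g₄, g₅ / r, q ^ N / g₁ / r] *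
      (qPochInf (q * g₅ * (q ^ N / g₁)) q * qTheta (1 / g₁ ^ 2) q *
        (qPochInf (q * g₁ * g₂) q * qPochInf (q * g₁ * g₃) q * qPochInf (q * g₁ * g₄) q)) := by
  have h0 : r ^ 2 * (q * (g₁ * g₂ * g₃ * g₄)) ≠ 0 := by rw [hr]; exact one_ne_zero
  have hr0 : r ≠ 0 := by rintro rfl; simp at h0
  have h₁ : g₁ ≠ 0 := by rintro rfl; simp at h0
  have h₂ : g₂ ≠ 0 := by rintro rfl; simp at h0
  have h₃ : g₃ ≠ 0 := by rintro rfl; simp at h0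
  have h₄ : g₄ ≠ 0 := by rintro rfl; simp at h0
  have hr2 : r ^ 2 = 1 / (q * (g₁ * g₂ * g₃ * g₄)) := eq_one_div_of_mul_eq_one_left hr
  have hN := pow_ne_zero N hq0
  have natz : ∀ (n : ℕ) {x y : ℂ} (_ : x ≠ 0), y / x * q ^ n = 1 → x = q ^ (n : ℤ) * y := by
    intro n x y hx h
    rw [div_mul_eq_mul_div, div_eq_one_iff_eq hx] at h
    rw [zpow_natCast, ← h, mul_comm]
  have natz' : ∀ (n : ℕ) {x y : ℂ} (_ : y ≠ 0), q * x / y * q ^ n = 1 →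
      x = q ^ (-(n : ℤ) - 1) * y := by
    intro n x y hy h
    have hn := pow_ne_zero n hq0
    rw [zpow_sub_one₀ hq0, zpow_neg, zpow_natCast]
    field_simp at h ⊢
    linear_combination h
  have A : ∀ n : ℕ, 1 / g₁ ^ 2 * q ^ n ≠ 1 := fun n h =>
    ha n (by simpa using natz n (pow_ne_zero 2 h₁) h)
  have B : ∀ n : ℕ, q * g₂ / g₁ * q ^ n ≠ 1 := fun n h => hb _ (natz' n h₁ h)
  have C : ∀ n : ℕ, q * g₃ / g₁ * q ^ n ≠ 1 := fun n h => hc _ (natz' n h₁ h)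
  have D : ∀ n : ℕ, q * g₄ / g₁ * q ^ n ≠ 1 := fun n h => hd _ (natz' n h₁ h)
  have E : ∀ n : ℕ, q * g₅ / g₁ * q ^ n ≠ 1 := fun n h => he _ (natz' n h₁ h)
  have lam : 1 / (r * g₁) ^ 2 = q * (g₂ * g₃ * g₄) / g₁ := by
    rw [mul_pow, hr2]; field_simp
  have L : ∀ n : ℕ, 1 / (r * g₁) ^ 2 * q ^ n ≠ 1 := fun n h => by
    rw [lam] at h
    exact hl _ (natz' n h₁ h)
  have LE' : q * (g₅ / r) / (r * g₁) = q * (q * (g₂ * g₃ * g₄ * g₅)) := by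
    have : q * (g₅ / r) / (r * g₁) = q * g₅ / (r ^ 2 * g₁) := by field_simp
    rw [this, hr2]; field_simp
  have LE : ∀ n : ℕ, q * (g₅ / r) / (r * g₁) * q ^ n ≠ 1 := fun n h => by
    rw [LE'] at h
    have hn := pow_ne_zero n hq0
    refine hle (-(n : ℤ) - 1 - 1) ?_
    rw [zpow_sub_one₀ hq0, zpow_sub_one₀ hq0, zpow_neg, zpow_natCast]
    field_simp
    linear_combination h
  have e1 : ∀ g, q * (r * g) / (r * g₁) = q * g / g₁ := fun g => by field_simp
  have e2 : q ^ N / g₁ / r = q ^ N / (r * g₁) := by field_simp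
  have hrg := mul_ne_zero hr0 h₁
  rw [wpSeries_terminating hq0 hq h₁ h₂ h₃ h₄ h₅ A B C D E N, e2,
    wpSeries_terminating hq0 hq hrg (mul_ne_zero hr0 h₂) (mul_ne_zero hr0 h₃) (mul_ne_zero hr0 h₄)
      (div_ne_zero h₅ hr0) L (by rwa [e1]) (by rwa [e1]) (by rwa [e1]) LE N]
  have f1 : ∀ g, g ≠ 0 → 1 / g₁ ^ 2 * q / (1 / (g₁ * g)) = q * g / g₁ := fun g hg => by
    field_simp
  have f2 : ∀ g, g ≠ 0 → 1 / (r * g₁ * (r * g)) =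
      1 / (r * g₁) ^ 2 * (1 / (g₁ * g)) / (1 / g₁ ^ 2) := fun g hg => by field_simp
  have f3 : 1 / (r * g₁ * (g₅ / r)) = 1 / (g₁ * g₅) := by field_simp
  have f4 : 1 / (r * g₁) ^ 2 * q / (1 / (g₁ * g₅)) = q * (g₅ / r) / (r * g₁) := by field_simp
  have key := sum_eightPhiTerm_transformation (q := q) (a := 1 / g₁ ^ 2) (b := 1 / (g₁ * g₂))
    (c := 1 / (g₁ * g₃)) (d := 1 / (g₁ * g₄)) (e := 1 / (g₁ * g₅)) (l := 1 / (r * g₁) ^ 2) hq0 hq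
    (one_div_ne_zero (pow_ne_zero 2 h₁)) (one_div_ne_zero (mul_ne_zero h₁ h₂))
    (one_div_ne_zero (mul_ne_zero h₁ h₃)) (one_div_ne_zero (mul_ne_zero h₁ h₄))
    (one_div_ne_zero (mul_ne_zero h₁ h₅))
    (by rw [lam]; field_simp) A L
    (by rwa [f1 _ h₂]) (by rwa [f1 _ h₃]) (by rwa [f1 _ h₄]) (by rwa [f1 _ h₅])
    (by rwa [f4]) N
  rw [f1 _ h₅, f4, ← f2 _ h₂, ← f2 _ h₃, ← f2 _ h₄] at key
  rw [f3]
  generalize ∑ k ∈ Finset.range (N + 1), eightPhiTerm q (1 / g₁ ^ 2) (1 / (g₁ * g₂))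
    (1 / (g₁ * g₃)) (1 / (g₁ * g₄)) (1 / (g₁ * g₅)) N k = W₁ at *
  generalize ∑ k ∈ Finset.range (N + 1), eightPhiTerm q (1 / (r * g₁) ^ 2) (1 / (r * g₁ * (r * g₂)))
    (1 / (r * g₁ * (r * g₃))) (1 / (r * g₁ * (r * g₄))) (1 / (g₁ * g₅)) N k = W₂ at *
  simp only [Fin.prod_univ_six, Matrix.cons_val]
  rw [← lam]
  have s1 : qTheta (1 / g₁ ^ 2) q = (1 - 1 / g₁ ^ 2) * qPochFin (1 / g₁ ^ 2 * q) q N *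
      qPochInf (q * (q ^ N / g₁) * g₁⁻¹) q * qPochInf (q * g₁ / g₁⁻¹) q := by
    have e : q / (1 / g₁ ^ 2) = q * g₁ / g₁⁻¹ := by field_simp
    have e' : 1 / g₁ ^ 2 * q * q ^ N = q * (q ^ N / g₁) * g₁⁻¹ := by field_simp
    rw [qTheta, qPochInf_succ _ hq, qPochInf_eq_mul (1 / g₁ ^ 2 * q) q hq N, e, e', qPochFin]
    ring
  have s2 : qTheta (1 / (r * g₁) ^ 2) q = (1 - 1 / (r * g₁) ^ 2) *
      qPochFin (1 / (r * g₁) ^ 2 * q) q N *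
      qPochInf (q * (q ^ N / (r * g₁)) * (r * g₁)⁻¹) q * qPochInf (q * (r * g₁) / (r * g₁)⁻¹) q := by
    have e : q / (1 / (r * g₁) ^ 2) = q * (r * g₁) / (r * g₁)⁻¹ := by field_simp
    have e' : 1 / (r * g₁) ^ 2 * q * q ^ N = q * (q ^ N / (r * g₁)) * (r * g₁)⁻¹ := by field_simp
    rw [qTheta, qPochInf_succ _ hq, qPochInf_eq_mul (1 / (r * g₁) ^ 2 * q) q hq N, e, e', qPochFin]
    ring
  have s3 : qPochInf (q * g₅ * g₁⁻¹) q = qPochFin (q * g₅ / g₁) q N *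
      qPochInf (q * g₅ * (q ^ N / g₁)) q := by
    have e : q * g₅ / g₁ * q ^ N = q * g₅ * (q ^ N / g₁) := by field_simp
    rw [← div_eq_mul_inv, qPochInf_eq_mul _ q hq N, e, qPochFin]
  have s4 : qPochInf (q * (g₅ / r) * (r * g₁)⁻¹) q = qPochFin (q * (g₅ / r) / (r * g₁)) q N *
      qPochInf (q * g₅ * (q ^ N / g₁) / r ^ 2) q := by
    have e : q * (g₅ / r) / (r * g₁) * q ^ N = q * g₅ * (q ^ N / g₁) / r ^ 2 := by field_simp
    rw [← div_eq_mul_inv, qPochInf_eq_mul _ q hq N, e, qPochFin]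
  have t1 : ∀ g, q * (r * g) * (r * g₁)⁻¹ = q * g * g₁⁻¹ := fun g => by field_simp
  have t2 : q * g₅ / g₁⁻¹ = q * (g₅ / r) / (r * g₁)⁻¹ := by field_simp
  have t3 : q * (q ^ N / g₁) / g₁⁻¹ = q * (q ^ N / (r * g₁)) / (r * g₁)⁻¹ := by field_simp
  have t4 : ∀ g, q * g / g₁⁻¹ = q * g₁ * g := fun g => by field_simp
  have t5 : ∀ x y z, x ≠ 0 → y ≠ 0 → z ≠ 0 → r ^ 2 = 1 / (q * (g₁ * x * y * z)) →
      q * (r * x) / (r * g₁)⁻¹ = 1 / (y * z) := by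
    intro x y z hx hy hz h
    have : q * (r * x) / (r * g₁)⁻¹ = r ^ 2 * (q * x * g₁) := by field_simp
    rw [this, h]; field_simp
  rw [s1, s2, s3, s4, t1, t1, t1, t1, t2, t3, t4 g₂, t4 g₃, t4 g₄, t5 g₂ g₃ g₄ h₂ h₃ h₄ hr2,
    t5 g₃ g₂ g₄ h₃ h₂ h₄ (by rw [hr2]; ring), t5 g₄ g₂ g₃ h₄ h₂ h₃ (by rw [hr2]; ring)]
  linear_combination (qPochInf (q * g₁ * g₁⁻¹) q * qPochInf (q * g₁ / g₁⁻¹) q *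
    (qPochInf (q * g₂ * g₁⁻¹) q * qPochInf (q * g₁ * g₂) q) *
    (qPochInf (q * g₃ * g₁⁻¹) q * qPochInf (q * g₁ * g₃) q) *
    (qPochInf (q * g₄ * g₁⁻¹) q * qPochInf (q * g₁ * g₄) q) *
    (qPochInf (q * g₅ * (q ^ N / g₁)) q * qPochInf (q * (g₅ / r) / (r * g₁)⁻¹) q) *
    (qPochInf (q * (q ^ N / g₁) * g₁⁻¹) q * qPochInf (q * (q ^ N / (r * g₁)) / (r * g₁)⁻¹) q) *
    qPochInf (q * g₅ * (q ^ N / g₁) / r ^ 2) q *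
    (qPochInf (q * (q ^ N / (r * g₁)) * (r * g₁)⁻¹) q * qPochInf (q * (r * g₁) / (r * g₁)⁻¹) q) *
    (qPochInf (1 / (g₂ * g₃)) q * qPochInf (1 / (g₂ * g₄)) q * qPochInf (1 / (g₃ * g₄)) q)) * key

/-- Bailey's transformation of a nonterminating very-well-poised `₈φ₇` series, in terms of
`wpSeries`. -/
theorem wpSeries_transformation {q r g₁ g₂ g₃ g₄ g₅ g₆ : ℂ} (hq0 : q ≠ 0) (hq : ‖q‖ < 1)
    (hr : r ^ 2 * (q * (g₁ * g₂ * g₃ * g₄)) = 1) (h₅ : g₅ ≠ 0)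
    (hz : ‖q ^ 2 * (g₁ * g₂ * g₃ * g₄ * g₅ * g₆)‖ < 1) (hz' : ‖q * g₅ * g₆‖ < 1)
    (ha : ∀ k : ℤ, g₁ ^ 2 ≠ q ^ k) (hb : ∀ k : ℤ, g₂ ≠ q ^ k * g₁) (hc : ∀ k : ℤ, g₃ ≠ q ^ k * g₁)
    (hd : ∀ k : ℤ, g₄ ≠ q ^ k * g₁) (he : ∀ k : ℤ, g₅ ≠ q ^ k * g₁)
    (hl : ∀ k : ℤ, g₂ * g₃ * g₄ ≠ q ^ k * g₁) (hle : ∀ k : ℤ, g₂ * g₃ * g₄ * g₅ ≠ q ^ k) :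
    wpSeries q g₁⁻¹ ![g₁, g₂, g₃, g₄, g₅, g₆] *
      (qPochInf (q * g₅ * g₆ / r ^ 2) q * qTheta (q * (g₂ * g₃ * g₄) / g₁) q *
        (qPochInf (1 / (g₂ * g₃)) q * qPochInf (1 / (g₂ * g₄)) q * qPochInf (1 / (g₃ * g₄)) q)) =
    wpSeries q (r * g₁)⁻¹ ![r * g₁, r * g₂, r * g₃, r * g₄, g₅ / r, g₆ / r] *
      (qPochInf (q * g₅ * g₆) q * qTheta (1 / g₁ ^ 2) q *
        (qPochInf (q * g₁ * g₂) q * qPochInf (q * g₁ * g₃) q * qPochInf (q * g₁ * g₄) q)) := by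
  have h0 : r ^ 2 * (q * (g₁ * g₂ * g₃ * g₄)) ≠ 0 := by rw [hr]; exact one_ne_zero
  have hr0 : r ≠ 0 := by rintro rfl; simp at h0
  have h₁ : g₁ ≠ 0 := by rintro rfl; simp at h0
  set c₁ := q ^ 2 * (g₁ * g₂ * g₃ * g₄ * g₅) with hc₁
  set c₂ := q * g₅ with hc₂
  have hc₁0 : 0 < ‖c₁‖ := by
    rw [norm_pos_iff, hc₁]
    have := right_ne_zero_of_mul (right_ne_zero_of_mul h0)
    exact mul_ne_zero (pow_ne_zero 2 hq0) (mul_ne_zero this h₅)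
  have hc₂0 : 0 < ‖c₂‖ := norm_pos_iff.mpr (mul_ne_zero hq0 h₅)
  -- The disc of last parameters `t` for which both series converge: their limiting ratios are `c₁ *
  -- t` and `c₂ * t`.
  set U := Metric.ball (0 : ℂ) (min ‖c₁‖⁻¹ ‖c₂‖⁻¹) with hU
  have memU : ∀ t, t ∈ U ↔ ‖c₁ * t‖ < 1 ∧ ‖c₂ * t‖ < 1 := by
    intro t
    rw [hU, mem_ball_zero_iff, lt_min_iff, norm_mul c₁, norm_mul c₂, ← one_div, ← one_div,
      lt_div_iff₀' hc₁0, lt_div_iff₀' hc₂0]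
  set Φ : ℂ → ℂ := fun t =>
    wpSeries q g₁⁻¹ ![g₁, g₂, g₃, g₄, g₅, t] *
      (qPochInf (q * g₅ * t / r ^ 2) q * qTheta (q * (g₂ * g₃ * g₄) / g₁) q *
        (qPochInf (1 / (g₂ * g₃)) q * qPochInf (1 / (g₂ * g₄)) q * qPochInf (1 / (g₃ * g₄)) q)) -
    wpSeries q (r * g₁)⁻¹ ![r * g₁, r * g₂, r * g₃, r * g₄, g₅ / r, t / r] *
      (qPochInf (q * g₅ * t) q * qTheta (1 / g₁ ^ 2) q *
        (qPochInf (q * g₁ * g₂) q * qPochInf (q * g₁ * g₃) q * qPochInf (q * g₁ * g₄) q)) with hΦ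
  have hd : DifferentiableOn ℂ Φ U := by
    intro t ht
    obtain ⟨ht1, ht2⟩ := (memU t).mp ht
    refine DifferentiableAt.differentiableWithinAt ?_
    refine DifferentiableAt.fun_sub (DifferentiableAt.fun_mul ?_ ?_)
      (DifferentiableAt.fun_mul ?_ ?_)
    · refine DifferentiableAt.wpSeries hq0 hq (Eventually.of_forall fun _ => by fun_prop)
        (Eventually.of_forall fun _ j => ?_) (inv_ne_zero h₁) ?_
      · fin_cases j <;> simp
      · simp only [Fin.prod_univ_six, Matrix.cons_val]
        rwa [← mul_assoc, ← hc₁]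
    · exact ((DifferentiableAt.qPochInf hq (by fun_prop)).mul_const _).mul_const _
    · refine DifferentiableAt.wpSeries hq0 hq (Eventually.of_forall fun _ => by fun_prop)
        (Eventually.of_forall fun _ j => ?_) (inv_ne_zero (mul_ne_zero hr0 h₁)) ?_
      · fin_cases j <;> simp
      · simp only [Fin.prod_univ_six, Matrix.cons_val]
        convert ht2 using 2
        rw [hc₂]
        field_simp
        linear_combination t * hr
    · exact ((DifferentiableAt.qPochInf hq (by fun_prop)).mul_const _).mul_const _
  have han : AnalyticOnNhd ℂ Φ U := hd.analyticOnNhd Metric.isOpen_ball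
  have hN : ∀ N : ℕ, Φ (q ^ N / g₁) = 0 := fun N => sub_eq_zero.mpr
    (wpSeries_terminating_transformation hq0 hq hr h₅ ha hb hc ‹_› he hl hle N)
  -- The terminating values `q ^ N / g₁` accumulate at `0`, an interior point of the disc, so the
  -- identity theorem applies.
  have hfreq : ∃ᶠ t in 𝓝[≠] (0 : ℂ), Φ t = 0 := by
    have ht : Tendsto (fun N : ℕ => q ^ N / g₁) atTop (𝓝[≠] 0) := by
      refine tendsto_nhdsWithin_iff.mpr ⟨?_, Eventually.of_forall fun N =>
        div_ne_zero (pow_ne_zero N hq0) h₁⟩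
      simpa using (tendsto_pow_atTop_nhds_zero_of_norm_lt_one hq).div_const g₁
    exact ht.frequently (Frequently.of_forall hN)
  have h0U : (0 : ℂ) ∈ U := (memU 0).mpr (by simp)
  have := han.eqOn_zero_of_preconnected_of_frequently_eq_zero
    (convex_ball _ _).isPreconnected h0U hfreq ((memU g₆).mpr ⟨by rwa [hc₁, mul_assoc], hz'⟩)
  exact sub_eq_zero.mp this

end NonterminatingBailey

/-! ### Division by `θ(x²)` and the two-term relation at a parameter. -/

section GenericTransformation

open Filter Topology

/-- `wpSeries q x γ` is divisible by `θ(x²)` as a holomorphic function of `x`. -/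
theorem exists_wpSeries_eq_qTheta_mul {q : ℂ} (hq0 : q ≠ 0) (hq : ‖q‖ < 1) {γ : Fin 6 → ℂ}
    (hγ : ‖q ^ 2 * ∏ j, γ j‖ < 1) :
    ∃ G : ℂ → ℂ, (∀ x ≠ 0, DifferentiableAt ℂ G x) ∧
      (∀ x ≠ 0, wpSeries q x γ = qTheta (x ^ 2) q * G x) ∧
      ∀ x ≠ 0, q * x ^ 2 * G (q * x) = G x := by
  have hθ : ∀ x : ℂ, x ≠ 0 → DifferentiableAt ℂ (fun x => qTheta (x ^ 2) q) x := fun x hx =>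
    DifferentiableAt.qTheta hq (by fun_prop) (pow_ne_zero 2 hx)
  have hs : ∀ x : ℂ, x ≠ 0 → qTheta (x ^ 2) q = 0 → deriv (fun x => qTheta (x ^ 2) q) x ≠ 0 := by
    intro x hx h0
    obtain ⟨k, hk⟩ := (qTheta_eq_zero_iff hq0 hq (pow_ne_zero 2 hx)).mp h0
    have hd : DifferentiableAt ℂ (fun x => qTheta x q) (x ^ 2) :=
      differentiableAt_id.qTheta hq (pow_ne_zero 2 hx)
    have := (hd.hasDerivAt.comp x (hasDerivAt_pow 2 x)).deriv
    simp only [Function.comp_def] at this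
    rw [this, hk]
    exact mul_ne_zero (deriv_qTheta_zpow_ne_zero hq0 hq k) (by simpa using hx)
  obtain ⟨G, hG, e⟩ := exists_eq_mul_of_simple_zeros (f := fun x => wpSeries q x γ)
    (h := fun x => qTheta (x ^ 2) q)
    (fun x hx => DifferentiableAt.wpSeries hq0 hq (Eventually.of_forall fun _ => by fun_prop)
      (Eventually.of_forall fun _ j => by fun_prop) hx hγ) hθ
    (fun x hx h0 => by
      obtain ⟨k, hk⟩ := (qTheta_eq_zero_iff hq0 hq (pow_ne_zero 2 hx)).mp h0
      exact wpSeries_eq_zero hq0 hx γ hk) hs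
  refine ⟨G, hG, e, fun x hx => ?_⟩
  refine eq_of_mul_eventuallyEq (h := fun x => qTheta (x ^ 2) q)
    (g₁ := fun x => q * x ^ 2 * G (q * x)) (hθ x hx) ?_ (hG x hx) (hs x hx) ?_
  · exact DifferentiableAt.fun_mul (by fun_prop)
      ((hG _ (mul_ne_zero hq0 hx)).comp x (differentiableAt_id.const_mul q))
  · filter_upwards [isOpen_ne.mem_nhds hx] with y hy
    -- The series has a multiplier of degree `-6` and `θ(x ^ 2)` one of degree `-4`, which leaves
    -- degree `-2` for `G`.
    have e1 := wpSeries_zpow_mul hq0 hy γ 1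
    rw [zpow_one, e _ (mul_ne_zero hq0 hy), e y hy] at e1
    have e2 := qTheta_q_mul hq0 hq (pow_ne_zero 2 hy)
    have e3 := qTheta_q_mul hq0 hq (mul_ne_zero hq0 (pow_ne_zero 2 hy))
    have e4 : q * (q * y ^ 2) = (q * y) ^ 2 := by ring
    rw [e4] at e3
    have e5 : y ^ (-6 * 1 : ℤ) * q ^ (1 - 3 * 1 ^ 2 : ℤ) * (y ^ 6 * q ^ 2) = 1 := by
      have h1 : y ^ (-6 * 1 : ℤ) = (y ^ 6)⁻¹ := rfl
      have h2 : q ^ (1 - 3 * 1 ^ 2 : ℤ) = (q ^ 2)⁻¹ := rfl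
      rw [h1, h2]
      field_simp
    linear_combination y ^ 6 * q ^ 2 * e1 + qTheta (y ^ 2) q * G y * e5 +
      q * y ^ 2 * G (q * y) * (e2 - y ^ 2 * e3)

/-- Genericity of the parameters: no coincidences modulo `q ^ ℤ`. -/
structure WPGeneric (q : ℂ) (g : Fin 4 → ℂ) (s : ℂ) : Prop where
  sq : ∀ i, ∀ k : ℤ, g i ^ 2 ≠ q ^ k
  ratio : ∀ i j, i ≠ j → ∀ k : ℤ, g i ≠ q ^ k * g j
  mul : ∀ i j, i ≠ j → ∀ k : ℤ, g i * g j ≠ q ^ k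
  ratio' : ∀ i, ∀ k : ℤ, s ≠ q ^ k * g i
  prod : ∀ i, ∀ k : ℤ, ∏ j, g j ≠ q ^ k * g i ^ 2
  prod' : ∀ i, ∀ k : ℤ, (∏ j, g j) * s ≠ q ^ k * g i

/-- Bailey's transformation reflected from `u⁻¹` to `u`. It is arranged around a distinguished `v`
so that the products outside the theta functions are symmetric in `u, w, z`; the same constants then
serve at three different zeros. -/
theorem wpSeries_transformation_at_parameter {q r u v w z g₅ g₆ : ℂ} (hq0 : q ≠ 0) (hq : ‖q‖ < 1)
    (hr : r ^ 2 * (q * (u * v * w * z)) = 1) (h₅ : g₅ ≠ 0)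
    (hz : ‖q ^ 2 * (u * v * w * z * g₅ * g₆)‖ < 1) (hz' : ‖q * g₅ * g₆‖ < 1)
    (hgen : WPGeneric q ![u, v, w, z] g₅) :
    wpSeries q u ![u, v, w, z, g₅, g₆] * (qTheta ((r * u) ^ 2) q * qTheta (r ^ 2 * v * u) q *
      (qPochInf (1 / (v * u)) q * qPochInf (1 / (v * w)) q * qPochInf (1 / (v * z)) q *
        qPochInf (q * g₅ * g₆ / r ^ 2) q)) =
    wpSeries q (r * u) ![r * u, r * v, r * w, r * z, g₅ / r, g₆ / r] * (r ^ 2 * qTheta (u ^ 2) q *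
      qTheta (v * u) q * (qPochInf (q * u * w) q * qPochInf (q * u * z) q *
        qPochInf (q * w * z) q * qPochInf (q * g₅ * g₆) q)) := by
  have h0 : r ^ 2 * (q * (u * v * w * z)) ≠ 0 := by rw [hr]; exact one_ne_zero
  have hr0 : r ≠ 0 := by rintro rfl; simp at h0
  have hu : u ≠ 0 := by rintro rfl; simp at h0
  have hv : v ≠ 0 := by rintro rfl; simp at h0
  have hw : w ≠ 0 := by rintro rfl; simp at h0
  have hz0 : z ≠ 0 := by rintro rfl; simp at h0
  have hr2 : r ^ 2 = 1 / (q * (u * v * w * z)) := eq_one_div_of_mul_eq_one_left hr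
  have hprod := hgen.prod 0
  have hprod' := hgen.prod' 0
  simp only [Fin.prod_univ_four, Matrix.cons_val] at hprod hprod'
  have key := wpSeries_transformation hq0 hq hr h₅ hz hz' (hgen.sq 0)
    (fun k => hgen.ratio 1 0 (by decide) k) (fun k => hgen.ratio 2 0 (by decide) k)
    (fun k => hgen.ratio 3 0 (by decide) k) (hgen.ratio' 0)
    (fun k h => hprod k (by linear_combination u * h))
    (fun k h => hprod' k (by linear_combination u * h))
  have hru := mul_ne_zero hr0 hu
  have lam : q * (v * w * z) / u = ((r * u) ^ 2)⁻¹ := by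
    rw [mul_pow, hr2]; field_simp
  rw [lam, one_div (u ^ 2)] at key
  have i1 := qTheta_inv hq (pow_ne_zero 2 hru)
  have i2 := qTheta_inv hq (pow_ne_zero 2 hu)
  have i3 := wpSeries_inv hq0 hu ![u, v, w, z, g₅, g₆]
  have i4 := wpSeries_inv hq0 hru ![r * u, r * v, r * w, r * z, g₅ / r, g₆ / r]
  have t1 : qTheta (r ^ 2 * v * u) q = -(r ^ 2 * v * u) *
      (qPochInf (1 / (w * z)) q * qPochInf (q * w * z) q) := by
    have h := qTheta_q_mul (x := r ^ 2 * v * u) hq0 hq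
      (mul_ne_zero (mul_ne_zero (pow_ne_zero 2 hr0) hv) hu)
    have e : q * (r ^ 2 * v * u) = 1 / (w * z) := by rw [hr2]; field_simp
    have e' : q / (1 / (w * z)) = q * w * z := by field_simp
    rw [e, qTheta, e'] at h
    linear_combination h
  have t2 : qTheta (v * u) q = -(v * u) * (qPochInf (1 / (v * u)) q * qPochInf (q * u * v) q) := by
    have h := qTheta_inv (x := v * u) hq (mul_ne_zero hv hu)
    have e' : q / (v * u)⁻¹ = q * u * v := by field_simp
    rw [qTheta, e', ← one_div] at h
    linear_combination h
  rw [t1, t2, i3, i4]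
  generalize wpSeries q u⁻¹ ![u, v, w, z, g₅, g₆] = F₁ at *
  generalize wpSeries q (r * u)⁻¹ ![r * u, r * v, r * w, r * z, g₅ / r, g₆ / r] = F₂ at *
  linear_combination ((r ^ 2 * v * u) * qPochInf (q * w * z) q * qPochInf (1 / (v * u)) q) *
    (-((r * u) ^ 2 * u ^ 2 * key) +
      u ^ 2 * F₁ * (qPochInf (q * g₅ * g₆ / r ^ 2) q * (qPochInf (1 / (v * w)) q *
        qPochInf (1 / (v * z)) q * qPochInf (1 / (w * z)) q)) * i1 -
      (r * u) ^ 2 * F₂ * (qPochInf (q * g₅ * g₆) q * (qPochInf (q * u * v) q *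
        qPochInf (q * u * w) q * qPochInf (q * u * z) q)) * i2)

end GenericTransformation

/-! ### The three-term relation for generic parameters. -/

section ThreeTerm

open Filter Topology

theorem WPGeneric.comp_perm {q s : ℂ} {g : Fin 4 → ℂ} (h : WPGeneric q g s)
    (σ : Equiv.Perm (Fin 4)) : WPGeneric q (g ∘ σ) s where
  sq i := h.sq (σ i)
  ratio i j hij := h.ratio _ _ (σ.injective.ne hij)
  mul i j hij := h.mul _ _ (σ.injective.ne hij)
  ratio' i := h.ratio' (σ i)
  prod i := by
    have : ∏ j, (g ∘ σ) j = ∏ j, g j := Equiv.prod_comp σ g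
    rw [this]; exact h.prod (σ i)
  prod' i := by
    have : ∏ j, (g ∘ σ) j = ∏ j, g j := Equiv.prod_comp σ g
    rw [this]; exact h.prod' (σ i)

/-- The three-term relation for `wpSeries` with generic parameters. -/
theorem wpSeries_three_term_of_generic {q r x g₁ g₂ g₃ g₄ g₅ g₆ : ℂ} (hq0 : q ≠ 0) (hq : ‖q‖ < 1)
    (hr : r ^ 2 * (q * (g₁ * g₂ * g₃ * g₄)) = 1) (h₅ : g₅ ≠ 0)
    (hz : ‖q ^ 2 * (g₁ * g₂ * g₃ * g₄ * g₅ * g₆)‖ < 1) (hz' : ‖q * g₅ * g₆‖ < 1)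
    (hgen : WPGeneric q ![g₁, g₂, g₃, g₄] g₅) (hx : x ≠ 0) :
    wpSeries q x ![g₁, g₂, g₃, g₄, g₅, g₆] *
      (qTheta ((r * x) ^ 2) q * qTheta (r ^ 2 * g₁ * x) q *
        (qPochInf (1 / (g₁ * g₂)) q * qPochInf (1 / (g₁ * g₃)) q * qPochInf (1 / (g₁ * g₄)) q *
          qPochInf (q * g₅ * g₆ / r ^ 2) q) *
        (qTheta (1 / (g₁ * g₂)) q * qTheta (1 / (g₁ * g₃)) q * qTheta (1 / (g₁ * g₄)) q) *
        qTheta (1 / g₁ ^ 2) q) =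
    wpSeries q (r * x) ![r * g₁, r * g₂, r * g₃, r * g₄, g₅ / r, g₆ / r] *
      (r ^ 2 * (qPochInf (q * g₂ * g₃) q * qPochInf (q * g₂ * g₄) q * qPochInf (q * g₃ * g₄) q *
          qPochInf (q * g₅ * g₆) q) * qTheta (g₁ * x) q * qTheta (x ^ 2) q *
        (qTheta (1 / (g₁ * g₂)) q * qTheta (1 / (g₁ * g₃)) q * qTheta (1 / (g₁ * g₄)) q) *
        qTheta (1 / g₁ ^ 2) q) +
    wpSeries q g₁⁻¹ ![g₁, g₂, g₃, g₄, g₅, g₆] *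
      (qTheta (r ^ 2) q * (qTheta (x / g₂) q * qTheta (x / g₃) q * qTheta (x / g₄) q) *
        (qPochInf (1 / (g₁ * g₂)) q * qPochInf (1 / (g₁ * g₃)) q * qPochInf (1 / (g₁ * g₄)) q *
          qPochInf (q * g₅ * g₆ / r ^ 2) q) * qTheta (x ^ 2) q * qTheta ((r * x) ^ 2) q) := by
  have h0 : r ^ 2 * (q * (g₁ * g₂ * g₃ * g₄)) ≠ 0 := by rw [hr]; exact one_ne_zero
  have hr0 : r ≠ 0 := by rintro rfl; simp at h0
  have h₁ : g₁ ≠ 0 := by rintro rfl; simp at h0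
  have h₂ : g₂ ≠ 0 := by rintro rfl; simp at h0
  have h₃ : g₃ ≠ 0 := by rintro rfl; simp at h0
  have h₄ : g₄ ≠ 0 := by rintro rfl; simp at h0
  obtain ⟨G, hG, eG, qG⟩ := exists_wpSeries_eq_qTheta_mul hq0 hq
    (γ := ![g₁, g₂, g₃, g₄, g₅, g₆]) (by simpa only [Fin.prod_univ_six, Matrix.cons_val] using hz)
  obtain ⟨G', hG', eG', qG'⟩ := exists_wpSeries_eq_qTheta_mul hq0 hq
    (γ := ![r * g₁, r * g₂, r * g₃, r * g₄, g₅ / r, g₆ / r]) (by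
      simp only [Fin.prod_univ_six, Matrix.cons_val]
      convert hz' using 2
      field_simp
      linear_combination g₆ * hr)
  set k₁ := qPochInf (1 / (g₁ * g₂)) q * qPochInf (1 / (g₁ * g₃)) q * qPochInf (1 / (g₁ * g₄)) q *
          qPochInf (q * g₅ * g₆ / r ^ 2) q with hk₁
  set k₂ := qPochInf (q * g₂ * g₃) q * qPochInf (q * g₂ * g₄) q * qPochInf (q * g₃ * g₄) q *
          qPochInf (q * g₅ * g₆) q with hk₂
  set T := qTheta (1 / (g₁ * g₂)) q * qTheta (1 / (g₁ * g₃)) q * qTheta (1 / (g₁ * g₄)) q with hT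
  -- The difference of the two sides after division by `θ(x ^ 2) * θ((r * x) ^ 2)`; the constants
  -- `k₁`, `k₂` and `T` are fixed by the cancellations at the four zeros.
  set f : ℂ → ℂ := fun x => G x * qTheta (r ^ 2 * g₁ * x) q * k₁ * T -
    r ^ 2 * k₂ * T * (qTheta (g₁ * x) q * G' (r * x)) -
    qTheta (r ^ 2) q * G g₁⁻¹ * k₁ * (qTheta (x / g₂) q * qTheta (x / g₃) q * qTheta (x / g₄) q)
    with hf
  have theta_one : qTheta 1 q = 0 := (qTheta_eq_zero_iff hq0 hq one_ne_zero).mpr ⟨0, by simp⟩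
  have hfd : ∀ x ≠ 0, DifferentiableAt ℂ f x := by
    intro x hx
    refine DifferentiableAt.fun_sub (DifferentiableAt.fun_sub ?_ ?_) ?_
    · refine (DifferentiableAt.fun_mul (hG x hx) (DifferentiableAt.qTheta hq (by fun_prop)
        ?_)).mul_const _ |>.mul_const _
      exact mul_ne_zero (mul_ne_zero (pow_ne_zero 2 hr0) h₁) hx
    · exact (DifferentiableAt.fun_mul (DifferentiableAt.qTheta hq (by fun_prop)
        (mul_ne_zero h₁ hx)) ((hG' _ (mul_ne_zero hr0 hx)).comp x
          (differentiableAt_id.const_mul r))).const_mul _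
    · refine (DifferentiableAt.fun_mul (DifferentiableAt.fun_mul ?_ ?_) ?_).const_mul _ <;>
        exact DifferentiableAt.qTheta hq (by fun_prop) (div_ne_zero hx ‹_›)
  -- All three terms share this multiplier because `g₂ * g₃ * g₄ = 1 / (q * g₁ * r ^ 2)`.
  have hfq : ∀ x ≠ 0, f (q * x) = -(g₂ * g₃ * g₄) * x ^ (-3 : ℤ) * f x := by
    intro x hx
    have a1 := qG x hx
    have a2 := qG' (r * x) (mul_ne_zero hr0 hx)
    have a3 := qTheta_q_mul (x := r ^ 2 * g₁ * x) hq0 hq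
      (mul_ne_zero (mul_ne_zero (pow_ne_zero 2 hr0) h₁) hx)
    have a4 := qTheta_q_mul (x := g₁ * x) hq0 hq (mul_ne_zero h₁ hx)
    have a5 := qTheta_q_mul (x := x / g₂) hq0 hq (div_ne_zero hx h₂)
    have a6 := qTheta_q_mul (x := x / g₃) hq0 hq (div_ne_zero hx h₃)
    have a7 := qTheta_q_mul (x := x / g₄) hq0 hq (div_ne_zero hx h₄)
    have b1 : G (q * x) = G x / (q * x ^ 2) := by
      rw [eq_div_iff (mul_ne_zero hq0 (pow_ne_zero 2 hx))]; linear_combination a1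
    have b2 : G' (r * (q * x)) = G' (r * x) / (q * (r * x) ^ 2) := by
      rw [eq_div_iff (mul_ne_zero hq0 (pow_ne_zero 2 (mul_ne_zero hr0 hx))),
        show r * (q * x) = q * (r * x) by ring]
      linear_combination a2
    have b3 : qTheta (r ^ 2 * g₁ * (q * x)) q = -qTheta (r ^ 2 * g₁ * x) q / (r ^ 2 * g₁ * x) := by
      rw [eq_div_iff (mul_ne_zero (mul_ne_zero (pow_ne_zero 2 hr0) h₁) hx),
        show r ^ 2 * g₁ * (q * x) = q * (r ^ 2 * g₁ * x) by ring]
      linear_combination a3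
    have b4 : qTheta (g₁ * (q * x)) q = -qTheta (g₁ * x) q / (g₁ * x) := by
      rw [eq_div_iff (mul_ne_zero h₁ hx), show g₁ * (q * x) = q * (g₁ * x) by ring]
      linear_combination a4
    have b5 : ∀ g, g ≠ 0 → qTheta (q * x / g) q = -qTheta (x / g) q * g / x := by
      intro g hg
      have := qTheta_q_mul (x := x / g) hq0 hq (div_ne_zero hx hg)
      rw [← mul_div_assoc, div_mul_eq_mul_div, div_eq_iff hg] at this
      rw [eq_div_iff hx]
      linear_combination this
    have b6 : x ^ (-3 : ℤ) = (x ^ 3)⁻¹ := rfl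
    have hr2 : g₂ * g₃ * g₄ = 1 / (q * g₁ * r ^ 2) := by
      field_simp
      linear_combination hr
    simp only [hf]
    rw [b1, b2, b3, b4, b5 _ h₂, b5 _ h₃, b5 _ h₄, b6]
    generalize qTheta (x / g₂) q = θ₂
    generalize qTheta (x / g₃) q = θ₃
    generalize qTheta (x / g₄) q = θ₄
    generalize qTheta (g₁ * x) q = θ₁
    generalize qTheta (r ^ 2 * g₁ * x) q = θ₅
    have : -θ₂ * g₂ / x * (-θ₃ * g₃ / x) * (-θ₄ * g₄ / x) =
        -(g₂ * g₃ * g₄) * (x ^ 3)⁻¹ * (θ₂ * θ₃ * θ₄) := by field_simp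
    rw [this, hr2]
    field_simp
    ring
  -- The zeros `g₂, g₃, g₄` are treated together: a permutation brings the chosen parameter to the
  -- front and puts `g₁` in the distinguished second place.
  have at_param : ∀ (u v w : ℂ) (σ : Equiv.Perm (Fin 6)) (τ : Equiv.Perm (Fin 4)),
      ![u, g₁, v, w, g₅, g₆] = ![g₁, g₂, g₃, g₄, g₅, g₆] ∘ σ →
      ![r * u, r * g₁, r * v, r * w, g₅ / r, g₆ / r] =
        ![r * g₁, r * g₂, r * g₃, r * g₄, g₅ / r, g₆ / r] ∘ σ →
      ![u, g₁, v, w] = ![g₁, g₂, g₃, g₄] ∘ τ →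
      qPochInf (1 / (g₁ * u)) q * qPochInf (1 / (g₁ * v)) q * qPochInf (1 / (g₁ * w)) q *
        qPochInf (q * g₅ * g₆ / r ^ 2) q = k₁ →
      qPochInf (q * u * v) q * qPochInf (q * u * w) q * qPochInf (q * v * w) q *
        qPochInf (q * g₅ * g₆) q = k₂ → u * g₁ * v * w = g₁ * g₂ * g₃ * g₄ →
      G u * qTheta (r ^ 2 * g₁ * u) q * k₁ * T -
        r ^ 2 * k₂ * T * (qTheta (g₁ * u) q * G' (r * u)) = 0 := by
    intro u v w σ τ e1 e2 e3 e4 e5 e6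
    have hgen' := hgen.comp_perm τ
    rw [← e3] at hgen'
    have h := wpSeries_transformation_at_parameter hq0 hq (by rw [e6]; exact hr) h₅
      (by rw [e6]; exact hz) hz' hgen'
    have hu : u ≠ 0 := by
      rintro rfl
      rw [← e6] at h0
      simp at h0
    rw [e1, e2, wpSeries_comp_perm, wpSeries_comp_perm, e4, e5, eG u hu,
      eG' _ (mul_ne_zero hr0 hu)] at h
    have n1 : qTheta (u ^ 2) q ≠ 0 := fun h => by
      obtain ⟨k, hk⟩ := (qTheta_eq_zero_iff hq0 hq (pow_ne_zero 2 hu)).mp h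
      exact hgen'.sq 0 k hk
    -- Since `(r * u) ^ 2 = u ^ 2 / (q * ∏ g)`, a zero would contradict the genericity condition on
    -- `∏ g` and `u ^ 2`.
    have n2 : qTheta ((r * u) ^ 2) q ≠ 0 := fun h => by
      have hru := pow_ne_zero 2 (mul_ne_zero hr0 hu)
      obtain ⟨k, hk⟩ := (qTheta_eq_zero_iff hq0 hq hru).mp h
      apply hgen'.prod 0 (-k - 1)
      simp only [Fin.prod_univ_four, Matrix.cons_val]
      rw [e6, zpow_sub_one₀ hq0, zpow_neg, ← hk]
      field_simp
      linear_combination hr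
    refine mul_left_cancel₀ (mul_ne_zero n1 n2) ?_
    rw [mul_zero]
    linear_combination T * h
  have hf0 : ∀ x ≠ 0, f x = 0 := by
    -- Four zeros, inequivalent modulo `q ^ ℤ`, against degree three.
    refine eq_zero_of_q_quasiperiodic hq0 hq 4 ![g₁⁻¹, g₂, g₃, g₄] hfd hfq (by norm_num) ?_ ?_ ?_
    · intro i
      fin_cases i <;> simp [h₁, h₂, h₃, h₄]
    · have hinv : ∀ j, j ≠ 0 → ∀ k : ℤ, g₁⁻¹ ≠ q ^ k * ![g₁, g₂, g₃, g₄] j := by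
        intro j hj k h
        apply hgen.mul 0 j hj.symm (-k)
        rw [zpow_neg, Matrix.cons_val_zero]
        have := zpow_ne_zero k hq0
        field_simp at h ⊢
        linear_combination -h
      have hinv' : ∀ j, j ≠ 0 → ∀ k : ℤ, ![g₁, g₂, g₃, g₄] j ≠ q ^ k * g₁⁻¹ := by
        intro j hj k h
        apply hgen.mul 0 j hj.symm k
        rw [Matrix.cons_val_zero, h]
        field_simp
      intro i j hij k
      fin_cases i <;> fin_cases j
      · exact absurd rfl hij
      · exact hinv 1 (by decide) k
      · exact hinv 2 (by decide) k
      · exact hinv 3 (by decide) k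
      · exact hinv' 1 (by decide) k
      · exact absurd rfl hij
      · exact hgen.ratio 1 2 (by decide) k
      · exact hgen.ratio 1 3 (by decide) k
      · exact hinv' 2 (by decide) k
      · exact hgen.ratio 2 1 (by decide) k
      · exact absurd rfl hij
      · exact hgen.ratio 2 3 (by decide) k
      · exact hinv' 3 (by decide) k
      · exact hgen.ratio 3 1 (by decide) k
      · exact hgen.ratio 3 2 (by decide) k
      · exact absurd rfl hij
    · intro i
      fin_cases i
      · simp only [hf, Fin.mk_zero, Matrix.cons_val_zero]
        have c1 : ∀ g, g₁⁻¹ / g = 1 / (g₁ * g) := fun g => by field_simp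
        rw [mul_inv_cancel_right₀ h₁, mul_inv_cancel₀ h₁, theta_one, c1, c1, c1, ← hT]
        ring
      · have := at_param g₂ g₃ g₄ (Equiv.swap 0 1) (Equiv.swap 0 1)
          (by funext i; fin_cases i <;> rfl) (by funext i; fin_cases i <;> rfl)
          (by funext i; fin_cases i <;> rfl) rfl rfl (by ring)
        simp only [hf, Fin.mk_one, Matrix.cons_val]
        rw [this, div_self h₂, theta_one]
        ring
      · have := at_param g₃ g₂ g₄ (Equiv.swap 0 2 * Equiv.swap 1 2)
          (Equiv.swap 0 2 * Equiv.swap 1 2)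
          (by funext i; fin_cases i <;> rfl) (by funext i; fin_cases i <;> rfl)
          (by funext i; fin_cases i <;> rfl) (by rw [hk₁]; ring)
          (by rw [hk₂, mul_right_comm q g₃ g₂]; ring) (by ring)
        simp only [hf, Fin.reduceFinMk, Matrix.cons_val]
        rw [this, div_self h₃, theta_one]
        ring
      · have := at_param g₄ g₂ g₃ (Equiv.swap 0 3 * Equiv.swap 1 3 * Equiv.swap 2 3)
          (Equiv.swap 0 3 * Equiv.swap 1 3 * Equiv.swap 2 3)
          (by funext i; fin_cases i <;> rfl) (by funext i; fin_cases i <;> rfl)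
          (by funext i; fin_cases i <;> rfl) (by rw [hk₁]; ring)
          (by rw [hk₂, mul_right_comm q g₄ g₂, mul_right_comm q g₄ g₃]; ring) (by ring)
        simp only [hf, Fin.reduceFinMk, Matrix.cons_val]
        rw [this, div_self h₄, theta_one]
        ring
  have hfx := hf0 x hx
  simp only [hf] at hfx
  have e1 : (g₁⁻¹) ^ 2 = 1 / g₁ ^ 2 := by rw [inv_pow, one_div]
  rw [eG x hx, eG' _ (mul_ne_zero hr0 hx), eG _ (inv_ne_zero h₁), e1]
  linear_combination (qTheta (x ^ 2) q * qTheta ((r * x) ^ 2) q * qTheta (1 / g₁ ^ 2) q) * hfx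

end ThreeTerm

/-! ### From the `₈ψ₈` series to the normalized series. -/

section PsiTerm

open Filter Topology

theorem qPoch_natCast (x q : ℂ) (k : ℕ) : qPoch x q (k : ℤ) = qPochFin x q k := rfl

theorem qPoch_add_one {x q : ℂ} (hq0 : q ≠ 0) (hx : ∀ n : ℕ, x ≠ q ^ (n + 1)) (k : ℤ) :
    qPoch x q (k + 1) = qPoch x q k * (1 - x * q ^ k) := by
  cases k with
  | ofNat n =>
    show ∏ i ∈ Finset.range (n + 1), (1 - x * q ^ i) = _
    rw [Finset.prod_range_succ]
    simp [qPoch]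
  | negSucc n =>
    have h1 : 1 - x / q ^ (n + 1) ≠ 0 := by
      intro h
      apply hx n
      field_simp at h
      linear_combination -h
    have h2 : (1 - x * q ^ (Int.negSucc n)) = 1 - x / q ^ (n + 1) := by
      rw [zpow_negSucc, div_eq_mul_inv]
    cases n with
    | zero =>
      show qPoch x q 0 = _
      simp only [qPoch]
      rw [h2]
      simp at h1 ⊢
      rw [inv_mul_cancel₀ h1]
    | succ n =>
      have e : Int.negSucc (n + 1) + 1 = Int.negSucc n := rfl
      rw [e, h2]
      simp only [qPoch]
      rw [Finset.prod_range_succ _ (n + 1), mul_inv, mul_assoc, inv_mul_cancel₀ h1, mul_one]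

theorem one_sub_mul_zpow_ne_zero {x q : ℂ} (hq0 : q ≠ 0) (hx : ∀ n : ℕ, x ≠ q ^ (n + 1)) {k : ℤ}
    (hk : k < 0) : 1 - x * q ^ k ≠ 0 := by
  obtain ⟨n, rfl⟩ := Int.eq_negSucc_of_lt_zero hk
  intro h
  apply hx n
  rw [zpow_negSucc] at h
  have := pow_ne_zero (n + 1) hq0
  field_simp at h
  linear_combination -h

/-- Moves an upper parameter into an infinite product. Both sides satisfy the same first-order
recurrence in `k`, which can also be run backwards because `x` is not a positive power of `q`. -/
theorem qPoch_mul_qPochInf {x q : ℂ} (hq0 : q ≠ 0) (hq : ‖q‖ < 1) (hx0 : x ≠ 0)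
    (hx : ∀ n : ℕ, x ≠ q ^ (n + 1)) (k : ℤ) :
    qPoch x q k * qPochInf (q / x) q =
      qPochInf (q / (x * q ^ k)) q * ((-x) ^ k * q ^ (k * (k - 1) / 2)) := by
  have key : ∀ k : ℤ, qPochInf (q / (x * q ^ (k + 1))) q *
      ((-x) ^ (k + 1) * q ^ ((k + 1) * (k + 1 - 1) / 2)) =
      qPochInf (q / (x * q ^ k)) q * ((-x) ^ k * q ^ (k * (k - 1) / 2)) * (1 - x * q ^ k) := by
    intro k
    have e1 : q / (x * q ^ (k + 1)) = 1 / (x * q ^ k) := by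
      rw [zpow_add_one₀ hq0]; field_simp
    have e2 : 1 / (x * q ^ k) * q = q / (x * q ^ k) := by ring
    -- The numerator grows by `k * 2`, so the integer quotient grows by exactly `k`.
    have e3 : (k + 1) * (k + 1 - 1) / 2 = k * (k - 1) / 2 + k := by
      rw [show (k + 1) * (k + 1 - 1) = k * (k - 1) + k * 2 by ring,
        Int.add_mul_ediv_right _ _ two_ne_zero]
    have hqk := zpow_ne_zero k hq0
    rw [e1, qPochInf_succ _ hq, e2, e3, zpow_add₀ hq0, zpow_add_one₀ (neg_ne_zero.mpr hx0)]
    field_simp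
    ring
  induction k using Int.induction_on with
  | zero => simp [qPoch]
  | succ i ih => rw [qPoch_add_one hq0 hx, key, ← ih]; ring
  | pred i ih =>
    have h1 := qPoch_add_one hq0 hx (-(i : ℤ) - 1)
    have h2 := key (-(i : ℤ) - 1)
    rw [sub_add_cancel] at h1 h2
    rw [h1, h2] at ih
    refine mul_right_cancel₀ (one_sub_mul_zpow_ne_zero hq0 hx (k := -(i : ℤ) - 1) (by omega)) ?_
    rw [← ih]; ring

theorem qPoch_inv_mul_qPochInf {x q : ℂ} (hq0 : q ≠ 0) (hq : ‖q‖ < 1)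
    (hx : ∀ n : ℕ, x * q ^ n ≠ 1) (k : ℤ) :
    (qPoch x q k)⁻¹ * qPochInf x q = qPochInf (x * q ^ k) q := by
  cases k with
  | ofNat n =>
    have e := qPochInf_eq_mul x q hq n
    have h : (∏ i ∈ Finset.range n, (1 - x * q ^ i)) ≠ 0 :=
      Finset.prod_ne_zero_iff.mpr fun i _ h => hx i (by linear_combination -h)
    rw [e]
    simp only [qPoch, Int.ofNat_eq_natCast, zpow_natCast]
    rw [inv_mul_cancel_left₀ h]
  | negSucc n =>
    have e := qPochInf_eq_mul (x * q ^ (Int.negSucc n)) q hq (n + 1)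
    have e1 : x * q ^ (Int.negSucc n) * q ^ (n + 1) = x := by
      rw [zpow_negSucc, mul_assoc, inv_mul_cancel₀ (pow_ne_zero _ hq0), mul_one]
    rw [e, e1]
    simp only [qPoch, inv_inv]
    congr 1
    rw [← Finset.prod_range_reflect]
    refine Finset.prod_congr rfl fun i hi => ?_
    have hi' : i < n + 1 := Finset.mem_range.mp hi
    obtain ⟨m, rfl⟩ : ∃ m, n = i + m := ⟨n - i, by omega⟩
    have e2 : i + m + 1 - 1 - i + 1 = m + 1 := by omega
    rw [e2, zpow_negSucc, pow_add, pow_add, pow_add]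
    field_simp

theorem qPoch_ne_zero {x q : ℂ} (hq0 : q ≠ 0) (hx : ∀ n : ℕ, x ≠ q ^ (n + 1))
    (hx' : ∀ n : ℕ, x * q ^ n ≠ 1) (k : ℤ) : qPoch x q k ≠ 0 := by
  cases k with
  | ofNat n => exact Finset.prod_ne_zero_iff.mpr fun i _ h => hx' i (by linear_combination -h)
  | negSucc n =>
    refine inv_ne_zero (Finset.prod_ne_zero_iff.mpr fun i _ h => hx i ?_)
    field_simp at h
    linear_combination -h

/-- Applied to `x` and `-x`, this gives the very-well-poised factor `(1 - x ^ 2 * q ^ (2 * k)) / (1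
- x ^ 2)`. -/
theorem qPoch_q_mul_div {x q : ℂ} (hq0 : q ≠ 0) (hx : ∀ n : ℕ, q * x ≠ q ^ (n + 1))
    (hx' : ∀ n : ℕ, x * q ^ n ≠ 1) (k : ℤ) :
    qPoch (q * x) q k / qPoch x q k = (1 - x * q ^ k) / (1 - x) := by
  have hx1 : ∀ n : ℕ, x ≠ q ^ (n + 1) := fun n h => hx (n + 1) (by rw [h]; ring)
  have h1 : 1 - x ≠ 0 := fun h => hx' 0 (by linear_combination -h)
  rw [div_eq_div_iff (qPoch_ne_zero hq0 hx1 hx' k) h1]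
  induction k using Int.induction_on with
  | zero => simp [qPoch]
  | succ i ih =>
    rw [qPoch_add_one hq0 hx, qPoch_add_one hq0 hx1, zpow_add_one₀ hq0]
    linear_combination (1 - q * x * q ^ (i : ℤ)) * ih
  | pred i ih =>
    have e1 := qPoch_add_one hq0 hx (-(i : ℤ) - 1)
    have e2 := qPoch_add_one hq0 hx1 (-(i : ℤ) - 1)
    have e3 : q ^ (-(i : ℤ)) = q * q ^ (-(i : ℤ) - 1) := by
      rw [← zpow_one_add₀ hq0]; congr 1; ring
    rw [sub_add_cancel] at e1 e2
    rw [e1, e2, e3] at ih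
    refine mul_right_cancel₀ (one_sub_mul_zpow_ne_zero hq0 hx (k := -(i : ℤ) - 1) (by omega)) ?_
    linear_combination ih

/-- The terms of the very-well-poised `₈ψ₈` series are multiples of those of `wpSeries`. -/
theorem psiTerm_mul_eq_wpTerm {q x z : ℂ} {b l : Fin 6 → ℂ} (hq0 : q ≠ 0) (hq : ‖q‖ < 1)
    (hx : x ≠ 0) (hb : ∀ j, b j ≠ 0) (hl : ∀ j, l j = q * (x / b j) * x)
    (hz : z = q ^ 2 * ∏ j, x / b j)
    (h : PsiDefined [q * x, -(q * x), b 0, b 1, b 2, b 3, b 4, b 5]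
      [x, -x, l 0, l 1, l 2, l 3, l 4, l 5] q) (k : ℤ) :
    psiTerm [q * x, -(q * x), b 0, b 1, b 2, b 3, b 4, b 5]
      [x, -x, l 0, l 1, l 2, l 3, l 4, l 5] q z k *
        ((1 - x ^ 2) * ∏ j, (qPochInf (l j) q * qPochInf (q / b j) q)) =
      wpTerm q x (fun j => x / b j) k := by
  obtain ⟨hA, hB⟩ := h
  have hb' : ∀ j, ∀ n : ℕ, b j ≠ q ^ (n + 1) := by
    intro j; fin_cases j <;> exact hA _ (by simp)
  have hl' : ∀ j, ∀ n : ℕ, l j * q ^ n ≠ 1 := by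
    intro j; fin_cases j <;> exact hB _ (by simp)
  have hx1 : ∀ n : ℕ, x * q ^ n ≠ 1 := hB _ (by simp)
  have hx2 : ∀ n : ℕ, -x * q ^ n ≠ 1 := hB _ (by simp)
  have v1 := qPoch_q_mul_div hq0 (hA _ (by simp)) hx1 k
  have v2 := qPoch_q_mul_div (x := -x) hq0 (by rw [mul_neg]; exact hA _ (by simp)) hx2 k
  have n1 : 1 - x ≠ 0 := fun h => hx1 0 (by linear_combination -h)
  have n2 : 1 - -x ≠ 0 := fun h => hx2 0 (by linear_combination -h)
  rw [mul_neg] at v2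
  have hT : psiTerm [q * x, -(q * x), b 0, b 1, b 2, b 3, b 4, b 5]
      [x, -x, l 0, l 1, l 2, l 3, l 4, l 5] q z k =
      (qPoch (q * x) q k / qPoch x q k) * (qPoch (-(q * x)) q k / qPoch (-x) q k) *
        (∏ j, qPoch (b j) q k * (qPoch (l j) q k)⁻¹) * z ^ k := by
    simp only [psiTerm, qPochs, List.map_cons, List.map_nil, List.prod_cons, List.prod_nil,
      List.length_cons, List.length_nil, sub_self, zpow_zero, mul_one, Fin.prod_univ_six,
      div_eq_mul_inv, mul_inv]
    ring
  have hj : ∀ j, qPoch (b j) q k * (qPoch (l j) q k)⁻¹ * (qPochInf (l j) q * qPochInf (q / b j) q) =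
      (-b j) ^ k * q ^ (k * (k - 1) / 2) * (qPochInf (q * (x / b j) * (x * q ^ k)) q *
        qPochInf (q * (x / b j) / (x * q ^ k)) q) := by
    intro j
    have e1 := qPoch_mul_qPochInf hq0 hq (hb j) (hb' j) k
    have e2 := qPoch_inv_mul_qPochInf hq0 hq (hl' j) k
    have e3 : q * (x / b j) * (x * q ^ k) = l j * q ^ k := by rw [hl]; ring
    have e4 : q * (x / b j) / (x * q ^ k) = q / (b j * q ^ k) := by
      have := hb j
      have := zpow_ne_zero k hq0
      field_simp
    rw [e3, e4, ← e2]
    linear_combination (qPoch (l j) q k)⁻¹ * qPochInf (l j) q * e1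
  have hprod : (∏ j, qPoch (b j) q k * (qPoch (l j) q k)⁻¹) *
      ∏ j, (qPochInf (l j) q * qPochInf (q / b j) q) = (∏ j, b j) ^ k * q ^ (3 * k ^ 2 - 3 * k) *
      ∏ j, (qPochInf (q * (x / b j) * (x * q ^ k)) q *
        qPochInf (q * (x / b j) / (x * q ^ k)) q) := by
    rw [← Finset.prod_mul_distrib, Finset.prod_congr rfl fun j _ => hj j, Finset.prod_mul_distrib,
      Finset.prod_mul_distrib]
    have e1 : ∏ j, (-b j) ^ k = (∏ j, b j) ^ k := by
      rw [Finset.prod_zpow, Finset.prod_neg, Finset.card_fin, Even.neg_one_pow (by decide), one_mul]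
    have e2 : ∏ _j : Fin 6, q ^ (k * (k - 1) / 2) = q ^ (3 * k ^ 2 - 3 * k) := by
      rw [Finset.prod_const, Finset.card_fin, ← zpow_natCast, ← zpow_mul]
      congr 1
      -- The product `k * (k - 1)` is even, so the integer division is exact.
      have := Int.ediv_mul_cancel (Int.even_mul_pred_self k).two_dvd
      push_cast
      linear_combination 3 * this
    rw [e1, e2]
  have hz' : z ^ k * (∏ j, b j) ^ k = x ^ (6 * k) * q ^ (2 * k) := by
    have hbn : ∏ j, b j ≠ 0 := Finset.prod_ne_zero_iff.mpr fun j _ => hb j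
    rw [← mul_zpow, hz, Finset.prod_div_distrib, Finset.prod_const, Finset.card_fin, mul_assoc,
      div_mul_cancel₀ _ hbn, mul_zpow, zpow_mul, zpow_mul, mul_comm]
    rfl
  have hq2 : q ^ (3 * k ^ 2 - k) = q ^ (2 * k) * q ^ (3 * k ^ 2 - 3 * k) := by
    rw [← zpow_add₀ hq0]; congr 1; ring
  have hv : (1 - x * q ^ k) / (1 - x) * ((1 - -x * q ^ k) / (1 - -x)) * (1 - x ^ 2) =
      1 - (x * q ^ k) ^ 2 := by
    rw [div_mul_div_comm, div_mul_eq_mul_div, div_eq_iff (mul_ne_zero n1 n2)]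
    ring
  rw [hT, v1, v2]
  unfold wpTerm
  rw [hq2, ← hv]
  linear_combination ((1 - x * q ^ k) / (1 - x) * ((1 - -x * q ^ k) / (1 - -x)) * (1 - x ^ 2)) *
    (z ^ k * hprod + q ^ (3 * k ^ 2 - 3 * k) * (∏ j, (qPochInf (q * (x / b j) * (x * q ^ k)) q *
        qPochInf (q * (x / b j) / (x * q ^ k)) q)) * hz')

/-- The factor relating the very-well-poised `₈ψ₈` series to `wpSeries` does not vanish. -/
theorem wpFactor_ne_zero {q x : ℂ} {b l : Fin 6 → ℂ} (hq : ‖q‖ < 1)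
    (hb : ∀ j, b j ≠ 0)
    (h : PsiDefined [q * x, -(q * x), b 0, b 1, b 2, b 3, b 4, b 5]
      [x, -x, l 0, l 1, l 2, l 3, l 4, l 5] q) :
    (1 - x ^ 2) * ∏ j, (qPochInf (l j) q * qPochInf (q / b j) q) ≠ 0 := by
  obtain ⟨hA, hB⟩ := h
  have hb' : ∀ j, ∀ n : ℕ, b j ≠ q ^ (n + 1) := by
    intro j; fin_cases j <;> exact hA _ (by simp)
  have hl' : ∀ j, ∀ n : ℕ, l j * q ^ n ≠ 1 := by
    intro j; fin_cases j <;> exact hB _ (by simp)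
  have hx1 : x * q ^ 0 ≠ 1 := hB _ (by simp) 0
  have hx2 : -x * q ^ 0 ≠ 1 := hB _ (by simp) 0
  refine mul_ne_zero ?_ (Finset.prod_ne_zero_iff.mpr fun j _ => mul_ne_zero
    ((qPochInf_ne_zero_iff hq).mpr (hl' j)) ((qPochInf_ne_zero_iff hq).mpr fun n hn => hb' j n ?_))
  · rw [show 1 - x ^ 2 = (1 - x * q ^ 0) * (1 - -x * q ^ 0) by ring]
    exact mul_ne_zero (sub_ne_zero.mpr hx1.symm) (sub_ne_zero.mpr hx2.symm)
  · have := hb j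
    field_simp at hn
    rw [← hn]; ring

theorem summable_psiTerm_of_wpTerm {q x z : ℂ} {b l : Fin 6 → ℂ} (hq0 : q ≠ 0) (hq : ‖q‖ < 1)
    (hx : x ≠ 0) (hb : ∀ j, b j ≠ 0) (hl : ∀ j, l j = q * (x / b j) * x)
    (hz : z = q ^ 2 * ∏ j, x / b j) (hz1 : ‖z‖ < 1)
    (h : PsiDefined [q * x, -(q * x), b 0, b 1, b 2, b 3, b 4, b 5]
      [x, -x, l 0, l 1, l 2, l 3, l 4, l 5] q) :
    Summable (psiTerm [q * x, -(q * x), b 0, b 1, b 2, b 3, b 4, b 5]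
      [x, -x, l 0, l 1, l 2, l 3, l 4, l 5] q z) := by
  have hs := summable_wpTerm hq0 hq hx (γ := fun j => x / b j) (by rwa [← hz])
  rw [← summable_mul_right_iff (wpFactor_ne_zero hq hb h)]
  exact hs.congr fun k => (psiTerm_mul_eq_wpTerm hq0 hq hx hb hl hz h k).symm

theorem psiSeries_mul_eq_wpSeries {q x z : ℂ} {b l : Fin 6 → ℂ} (hq0 : q ≠ 0) (hq : ‖q‖ < 1)
    (hx : x ≠ 0) (hb : ∀ j, b j ≠ 0) (hl : ∀ j, l j = q * (x / b j) * x)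
    (hz : z = q ^ 2 * ∏ j, x / b j)
    (h : PsiDefined [q * x, -(q * x), b 0, b 1, b 2, b 3, b 4, b 5]
      [x, -x, l 0, l 1, l 2, l 3, l 4, l 5] q) :
    psiSeries [q * x, -(q * x), b 0, b 1, b 2, b 3, b 4, b 5]
      [x, -x, l 0, l 1, l 2, l 3, l 4, l 5] q z *
        ((1 - x ^ 2) * ∏ j, (qPochInf (l j) q * qPochInf (q / b j) q)) =
      wpSeries q x (fun j => x / b j) := by
  rw [psiSeries, wpSeries, ← tsum_mul_right]
  exact tsum_congr fun k => psiTerm_mul_eq_wpTerm hq0 hq hx hb hl hz h k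

end PsiTerm

/-! ### From the `₈φ₇` series to the normalized series. -/

section PhiTerm

open Filter Topology

/-- The terms of the very-well-poised `₈φ₇` series with parameters `x / γ j`, where `γ 0 = x⁻¹`
gives the parameter `x ^ 2`. -/
noncomputable def wpPhiTerm (q x : ℂ) (γ : Fin 6 → ℂ) (k : ℕ) : ℂ :=
  (1 - x ^ 2 * q ^ (2 * k)) / (1 - x ^ 2) *
    (∏ j, qPochFin (x / γ j) q k / qPochFin (q * γ j * x) q k) * (q ^ 2 * ∏ j, γ j) ^ k

theorem wpPhiTerm_succ {q x : ℂ} {γ : Fin 6 → ℂ} {k : ℕ} (h : 1 - x ^ 2 * (q ^ k) ^ 2 ≠ 0) :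
    wpPhiTerm q x γ (k + 1) = (1 - x ^ 2 * q ^ 2 * (q ^ k) ^ 2) / (1 - x ^ 2 * (q ^ k) ^ 2) *
      (∏ j, (1 - x / γ j * q ^ k) / (1 - q * γ j * x * q ^ k)) * (q ^ 2 * ∏ j, γ j) *
      wpPhiTerm q x γ k := by
  unfold wpPhiTerm
  have e1 : ∏ j, qPochFin (x / γ j) q (k + 1) / qPochFin (q * γ j * x) q (k + 1) =
      (∏ j, qPochFin (x / γ j) q k / qPochFin (q * γ j * x) q k) *
        ∏ j, (1 - x / γ j * q ^ k) / (1 - q * γ j * x * q ^ k) := by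
    rw [← Finset.prod_mul_distrib]
    refine Finset.prod_congr rfl fun j _ => ?_
    rw [qPochFin_succ, qPochFin_succ, mul_div_mul_comm]
  have e2 : (1 - x ^ 2 * q ^ (2 * (k + 1))) / (1 - x ^ 2) =
      (1 - x ^ 2 * q ^ 2 * (q ^ k) ^ 2) / (1 - x ^ 2 * (q ^ k) ^ 2) *
        ((1 - x ^ 2 * q ^ (2 * k)) / (1 - x ^ 2)) := by
    have : q ^ (2 * k) = (q ^ k) ^ 2 := by rw [mul_comm, pow_mul]
    have e3 : x ^ 2 * q ^ 2 * (q ^ k) ^ 2 = x ^ 2 * q ^ (2 * (k + 1)) := by ring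
    rw [this, div_mul_div_cancel₀ h, e3]
  rw [e1, e2, pow_succ]
  ring

theorem continuousAt_wpPhiTerm {q : ℂ} {p : ℂ × (Fin 6 → ℂ)} (hx : 1 - p.1 ^ 2 ≠ 0)
    (hγ : ∀ j, p.2 j ≠ 0) (hd : ∀ j, ∀ n : ℕ, q * p.2 j * p.1 * q ^ n ≠ 1) (k : ℕ) :
    ContinuousAt (fun p : ℂ × (Fin 6 → ℂ) => wpPhiTerm q p.1 p.2 k) p := by
  unfold wpPhiTerm qPochFin
  refine ContinuousAt.mul (ContinuousAt.mul (ContinuousAt.div (by fun_prop) (by fun_prop) hx)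
    (tendsto_finsetProd _ fun j _ => ContinuousAt.div (tendsto_finsetProd _ fun i _ => ?_)
      (by fun_prop) (qPochFin_ne_zero (hd j) k))) (by fun_prop)
  have := hγ j
  refine ContinuousAt.sub continuousAt_const (ContinuousAt.mul (ContinuousAt.div ?_ ?_ this)
    continuousAt_const) <;> fun_prop

theorem exists_summable_bound_wpPhiTerm {q : ℂ} (hq : ‖q‖ < 1) {p₀ : ℂ × (Fin 6 → ℂ)}
    (hx : 1 - p₀.1 ^ 2 ≠ 0) (hγ : ∀ j, p₀.2 j ≠ 0)
    (hd : ∀ j, ∀ n : ℕ, q * p₀.2 j * p₀.1 * q ^ n ≠ 1) (hz : ‖q ^ 2 * ∏ j, p₀.2 j‖ < 1) :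
    ∃ u : ℕ → ℝ, Summable u ∧ ∀ᶠ p in 𝓝 p₀, ∀ k : ℕ, ‖wpPhiTerm q p.1 p.2 k‖ ≤ u k := by
  set R : (ℂ × (Fin 6 → ℂ)) × ℂ → ℂ := fun s =>
    (1 - s.1.1 ^ 2 * q ^ 2 * s.2 ^ 2) / (1 - s.1.1 ^ 2 * s.2 ^ 2) *
      (∏ j, (1 - s.1.1 / s.1.2 j * s.2) / (1 - q * s.1.2 j * s.1.1 * s.2)) *
        (q ^ 2 * ∏ j, s.1.2 j) with hR
  refine exists_summable_bound_of_ratio hq (R := R)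
    (fun k => continuousAt_wpPhiTerm hx hγ hd k) ?_ ?_ ?_
  · refine ContinuousAt.mul (ContinuousAt.mul (ContinuousAt.div (by fun_prop) (by fun_prop)
      (by simp)) (tendsto_finsetProd _ fun j _ => ContinuousAt.div ?_ (by fun_prop) (by simp)))
      (by fun_prop)
    refine ContinuousAt.sub continuousAt_const (ContinuousAt.mul (ContinuousAt.div ?_ ?_ (hγ j)) ?_)
      <;> fun_prop
  · simpa [hR] using hz
  · have hc : ContinuousAt (fun s : (ℂ × (Fin 6 → ℂ)) × ℂ => 1 - s.1.1 ^ 2 * s.2 ^ 2) (p₀, 0) := by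
      fun_prop
    have hne : ∀ᶠ s in 𝓝 (p₀, (0 : ℂ)), 1 - s.1.1 ^ 2 * s.2 ^ 2 ≠ 0 := hc.eventually_ne (by simp)
    filter_upwards [hne] with s hs k hk
    rw [hk] at hs
    rw [wpPhiTerm_succ hs, hR]
    simp only [hk]

theorem summable_wpPhiTerm {q x : ℂ} (hq : ‖q‖ < 1) {γ : Fin 6 → ℂ}
    (hx : 1 - x ^ 2 ≠ 0) (hγ : ∀ j, γ j ≠ 0)
    (hd : ∀ j, ∀ n : ℕ, q * γ j * x * q ^ n ≠ 1) (hz : ‖q ^ 2 * ∏ j, γ j‖ < 1) :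
    Summable (wpPhiTerm q x γ) := by
  obtain ⟨u, hu, h⟩ := exists_summable_bound_wpPhiTerm hq (p₀ := (x, γ)) hx hγ hd hz
  exact Summable.of_norm_bounded hu h.self_of_nhds

theorem continuousAt_tsum_wpPhiTerm {q : ℂ} (hq : ‖q‖ < 1) {p₀ : ℂ × (Fin 6 → ℂ)}
    (hx : 1 - p₀.1 ^ 2 ≠ 0) (hγ : ∀ j, p₀.2 j ≠ 0)
    (hd : ∀ j, ∀ n : ℕ, q * p₀.2 j * p₀.1 * q ^ n ≠ 1) (hz : ‖q ^ 2 * ∏ j, p₀.2 j‖ < 1) :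
    ContinuousAt (fun p : ℂ × (Fin 6 → ℂ) => ∑' k, wpPhiTerm q p.1 p.2 k) p₀ := by
  obtain ⟨u, hu, h⟩ := exists_summable_bound_wpPhiTerm hq hx hγ hd hz
  exact tendsto_tsum_of_dominated_convergence hu (fun k => continuousAt_wpPhiTerm hx hγ hd k) h

/-- At `x = (γ i)⁻¹` the series `wpSeries` is unilateral, and the extra factor is its term at `k =
0`. -/
theorem tsum_wpPhiTerm_mul {q : ℂ} (hq0 : q ≠ 0) (hq : ‖q‖ < 1) {γ : Fin 6 → ℂ} {i : Fin 6}
    (hγ : ∀ j, γ j ≠ 0) (hx : 1 - (γ i)⁻¹ ^ 2 ≠ 0)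
    (hd : ∀ j, ∀ n : ℕ, q * γ j * (γ i)⁻¹ * q ^ n ≠ 1) :
    (∑' k, wpPhiTerm q (γ i)⁻¹ γ k) * ((1 - (γ i)⁻¹ ^ 2) *
      ∏ j, (qPochInf (q * γ j * (γ i)⁻¹) q * qPochInf (q * γ j / (γ i)⁻¹) q)) =
      wpSeries q (γ i)⁻¹ γ := by
  rw [wpSeries_eq_tsum_nat hq0 hq (hγ i), ← tsum_mul_right]
  refine tsum_congr fun k => ?_
  have hn : ∏ j, qPochFin (q * γ j * (γ i)⁻¹) q k ≠ 0 :=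
    Finset.prod_ne_zero_iff.mpr fun j _ => qPochFin_ne_zero (hd j) k
  refine mul_right_cancel₀ hn ?_
  rw [wpTerm_natCast hq0 hq (inv_ne_zero (hγ i)) hγ k, wpPhiTerm, Finset.prod_div_distrib]
  generalize ∏ j, qPochFin (q * γ j * (γ i)⁻¹) q k = A at hn ⊢
  generalize ∏ j, qPochFin ((γ i)⁻¹ / γ j) q k = B
  generalize ∏ j, (qPochInf (q * γ j * (γ i)⁻¹) q * qPochInf (q * γ j / (γ i)⁻¹) q) = C
  generalize 1 - (γ i)⁻¹ ^ 2 = D at hx ⊢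
  field_simp

theorem qPochFin_q_mul_div {q x : ℂ} (hd : ∀ n : ℕ, x * q ^ n ≠ 1) (k : ℕ) :
    qPochFin (q * x) q k / qPochFin x q k = (1 - x * q ^ k) / (1 - x) := by
  have h1 : 1 - x ≠ 0 := fun h => hd 0 (by linear_combination -h)
  rw [div_eq_div_iff (qPochFin_ne_zero hd k) h1, mul_comm _ (1 - x), mul_comm q x,
    ← qPochFin_succ', qPochFin_succ, mul_comm]

theorem psiTerm_eq_wpPhiTerm {q x z : ℂ} {u l : Fin 5 → ℂ} {γ : Fin 6 → ℂ} (hx : x ≠ 0)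
    (h₀ : γ 0 = x⁻¹) (hu : ∀ j, u j = x / γ j.succ) (hl : ∀ j, l j = q * γ j.succ * x)
    (hz : z = q ^ 2 * ∏ j, γ j) (hd : ∀ n : ℕ, x * q ^ n ≠ 1) (hd' : ∀ n : ℕ, -x * q ^ n ≠ 1)
    (k : ℕ) :
    psiTerm [x ^ 2, q * x, -(q * x), u 0, u 1, u 2, u 3, u 4]
      [q, x, -x, l 0, l 1, l 2, l 3, l 4] q z k = wpPhiTerm q x γ k := by
  have v1 := qPochFin_q_mul_div hd k
  have v2 := qPochFin_q_mul_div hd' k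
  rw [mul_neg] at v2
  have hT : psiTerm [x ^ 2, q * x, -(q * x), u 0, u 1, u 2, u 3, u 4]
      [q, x, -x, l 0, l 1, l 2, l 3, l 4] q z k =
      (qPochFin (q * x) q k / qPochFin x q k) * (qPochFin (-(q * x)) q k / qPochFin (-x) q k) *
        (qPochFin (x ^ 2) q k / qPochFin q q k * ∏ j, qPochFin (u j) q k / qPochFin (l j) q k) *
          z ^ k := by
    simp only [psiTerm, qPochs, List.map_cons, List.map_nil, List.prod_cons, List.prod_nil,
      List.length_cons, List.length_nil, sub_self, zpow_zero, mul_one, Fin.prod_univ_five,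
      div_eq_mul_inv, mul_inv, qPoch_natCast, zpow_natCast]
    ring
  have h2 : x / γ 0 = x ^ 2 := by rw [h₀]; field_simp
  have h3 : q * γ 0 * x = q := by rw [h₀]; field_simp
  have hv : (1 - x * q ^ k) / (1 - x) * ((1 - -x * q ^ k) / (1 - -x)) =
      (1 - x ^ 2 * q ^ (2 * k)) / (1 - x ^ 2) := by
    rw [div_mul_div_comm]
    congr 1 <;> ring
  rw [hT, v1, v2, hv, wpPhiTerm,
    Fin.prod_univ_succ (fun j => qPochFin (x / γ j) q k / qPochFin (q * γ j * x) q k), h2, h3, ← hz]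
  simp only [hu, hl]

end PhiTerm

/-! ### Genericity almost everywhere and cancellation of common factors. -/

section Specialization

open Filter Topology MeasureTheory

/-- For each `k` the exceptional `v` are roots of a monomial equation, hence finitely many; the
union over `k` is countable, so a null set. -/
theorem ae_zpow_mul_ne (q : ℂ) {m : ℤ} (hm : m ≠ 0) {c : ℂ} (hc : c ≠ 0) (c' : ℂ) :
    ∀ᵐ v : ℂ, ∀ k : ℤ, v ^ m * c ≠ q ^ k * c' := by
  have hfin : ∀ (n : ℕ) (c : ℂ), 0 < n → {v : ℂ | v ^ n = c}.Countable := fun n c hn =>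
    ((Polynomial.nthRoots n c).toFinset.finite_toSet.subset fun v hv => by
      simpa [Polynomial.mem_nthRoots hn] using hv).countable
  rw [ae_all_iff]
  intro k
  have h : {v : ℂ | v ^ m * c = q ^ k * c'}.Countable := by
    rcases lt_or_gt_of_ne hm with h | h
    · obtain ⟨n, rfl⟩ : ∃ n : ℕ, m = -n := ⟨m.natAbs, by omega⟩
      refine (hfin n (q ^ k * c' / c)⁻¹ (by omega)).mono fun v hv => ?_
      have hv' : v ^ (-(n : ℤ)) * c = q ^ k * c' := hv
      show v ^ n = _
      rw [← hv', mul_div_cancel_right₀ _ hc, zpow_neg, inv_inv, zpow_natCast]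
    · obtain ⟨n, rfl⟩ : ∃ n : ℕ, m = n := ⟨m.natAbs, by omega⟩
      refine (hfin n (q ^ k * c' / c) (by omega)).mono fun v hv => ?_
      have hv' : v ^ (n : ℤ) * c = q ^ k * c' := hv
      show v ^ n = _
      rw [← hv', mul_div_cancel_right₀ _ hc, zpow_natCast]
  exact h.ae_notMem _

/-- Scaling four parameters by powers of `v` with total exponent zero makes them generic for almost
every `v`. -/
theorem ae_wpGeneric (q : ℂ) {g : Fin 4 → ℂ} {s : ℂ} (hg : ∀ i, g i ≠ 0) (hs : s ≠ 0) :
    ∀ᵐ v : ℂ, WPGeneric q (fun i => g i * v ^ (![-6, 1, 2, 3] i : ℤ)) s := by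
  -- The exponents sum to zero, which preserves the product of the parameters; no exponent, pairwise
  -- sum or pairwise difference vanishes, so each condition excludes only a null set.
  set n : Fin 4 → ℤ := ![-6, 1, 2, 3] with hn
  have n0 : ∀ i, n i ≠ 0 := by rw [hn]; decide
  have n1 : ∀ i j, i ≠ j → n i - n j ≠ 0 := by rw [hn]; decide
  have n2 : ∀ i j, i ≠ j → n i + n j ≠ 0 := by rw [hn]; decide
  have hp : ∏ j, g j ≠ 0 := Finset.prod_ne_zero_iff.mpr fun j _ => hg j
  have a0 : ∀ᵐ v : ℂ, v ≠ 0 := by simpa using (Set.countable_singleton (0 : ℂ)).ae_notMem volume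
  have a1 := ae_all_iff.mpr fun i => ae_zpow_mul_ne q (mul_ne_zero (n0 i) two_ne_zero)
    (pow_ne_zero 2 (hg i)) 1
  have a2 := ae_all_iff.mpr fun i => ae_all_iff.mpr fun j => ae_all_iff.mpr fun hij : i ≠ j =>
    ae_zpow_mul_ne q (n1 i j hij) (hg i) (g j)
  have a3 := ae_all_iff.mpr fun i => ae_all_iff.mpr fun j => ae_all_iff.mpr fun hij : i ≠ j =>
    ae_zpow_mul_ne q (n2 i j hij) (mul_ne_zero (hg i) (hg j)) 1
  have a4 := ae_all_iff.mpr fun i => ae_zpow_mul_ne q (neg_ne_zero.mpr (n0 i)) hs (g i)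
  have a5 := ae_all_iff.mpr fun i => ae_zpow_mul_ne q
    (neg_ne_zero.mpr (mul_ne_zero (n0 i) two_ne_zero)) hp (g i ^ 2)
  have a6 := ae_all_iff.mpr fun i => ae_zpow_mul_ne q (neg_ne_zero.mpr (n0 i))
    (mul_ne_zero hp hs) (g i)
  filter_upwards [a0, a1, a2, a3, a4, a5, a6] with v h0 h1 h2 h3 h4 h5 h6
  have hprod : ∏ j, g j * v ^ n j = ∏ j, g j := by
    have : ∏ j, v ^ n j = 1 := by
      rw [Fin.prod_univ_four, ← zpow_add₀ h0, ← zpow_add₀ h0, ← zpow_add₀ h0]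
      exact zpow_zero v
    rw [Finset.prod_mul_distrib, this, mul_one]
  have hv : ∀ i, v ^ n i ≠ 0 := fun i => zpow_ne_zero _ h0
  have hsq : ∀ i, v ^ (n i * 2) = (v ^ n i) ^ 2 := fun i => by rw [zpow_mul]; rfl
  refine ⟨fun i k h => h1 i k ?_, fun i j hij k h => h2 i j hij k ?_,
    fun i j hij k h => h3 i j hij k ?_, fun i k h => h4 i k ?_, fun i k h => h5 i k ?_,
    fun i k h => h6 i k ?_⟩
  · rw [hsq, mul_one, ← h]; ring
  · have := hv i
    have := hv j
    rw [zpow_sub₀ h0]; field_simp; linear_combination h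
  · rw [zpow_add₀ h0, mul_one, ← h]; ring
  · have := hv i
    rw [zpow_neg]; field_simp; linear_combination h
  · have := hv i
    rw [hprod] at h
    rw [zpow_neg, hsq]; field_simp; linear_combination h
  · have := hv i
    rw [hprod] at h
    rw [zpow_neg]; field_simp; linear_combination h

theorem qPochInf_ne_zero_of_zpow {x q : ℂ} (hq : ‖q‖ < 1)
    (h : ∀ k : ℤ, x ≠ q ^ k) : qPochInf x q ≠ 0 := by
  rw [qPochInf_ne_zero_iff hq]
  intro n hn
  apply h (-n)
  rw [zpow_neg, zpow_natCast, eq_inv_of_mul_eq_one_left hn]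

/-- The unilateral value is replaced by the `₈φ₇` sum. Some common factors, such as `(q * g₁ * g₂;
q)_∞`, may vanish at the parameters finally wanted, so they have to be cancelled here, before the
limit. -/
theorem wpSeries_phi_three_term_of_generic {q r x g₁ g₂ g₃ g₄ g₅ g₆ : ℂ} (hq0 : q ≠ 0)
    (hq : ‖q‖ < 1) (hr : r ^ 2 * (q * (g₁ * g₂ * g₃ * g₄)) = 1) (h₅ : g₅ ≠ 0) (h₆ : g₆ ≠ 0)
    (hz : ‖q ^ 2 * (g₁ * g₂ * g₃ * g₄ * g₅ * g₆)‖ < 1) (hz' : ‖q * g₅ * g₆‖ < 1)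
    (hgen : WPGeneric q ![g₁, g₂, g₃, g₄] g₅) (hx : x ≠ 0)
    (hd : ∀ j, qPochInf (q * ![g₁, g₂, g₃, g₄, g₅, g₆] j * g₁⁻¹) q ≠ 0) :
    wpSeries q x ![g₁, g₂, g₃, g₄, g₅, g₆] *
      (qTheta ((r * x) ^ 2) q * qTheta (r ^ 2 * g₁ * x) q * qPochInf (q * g₅ * g₆ / r ^ 2) q *
        (qPochInf (1 / (g₁ * g₂)) q * qPochInf (1 / (g₁ * g₃)) q * qPochInf (1 / (g₁ * g₄)) q) *
        qPochInf (q / g₁ ^ 2) q) =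
    wpSeries q (r * x) ![r * g₁, r * g₂, r * g₃, r * g₄, g₅ / r, g₆ / r] *
      (r ^ 2 * (qPochInf (q * g₂ * g₃) q * qPochInf (q * g₂ * g₄) q * qPochInf (q * g₃ * g₄) q *
          qPochInf (q * g₅ * g₆) q) * qTheta (g₁ * x) q * qTheta (x ^ 2) q *
        qPochInf (q / g₁ ^ 2) q) +
    (∑' k, wpPhiTerm q g₁⁻¹ ![g₁, g₂, g₃, g₄, g₅, g₆] k) *
      (qPochInf q q * (qPochInf (q * g₂ / g₁) q * qPochInf (q * g₃ / g₁) q *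
          qPochInf (q * g₄ / g₁) q * qPochInf (q * g₅ / g₁) q * qPochInf (q * g₆ / g₁) q) *
        (qPochInf (q * g₁ * g₅) q * qPochInf (q * g₁ * g₆) q) *
        qTheta (r ^ 2) q * (qTheta (x / g₂) q * qTheta (x / g₃) q * qTheta (x / g₄) q) *
        qPochInf (q * g₅ * g₆ / r ^ 2) q * qTheta (x ^ 2) q * qTheta ((r * x) ^ 2) q) := by
  have h1 : g₁ ≠ 0 := by rintro rfl; simp at hr
  have h2 : g₂ ≠ 0 := by rintro rfl; simp at hr
  have h3 : g₃ ≠ 0 := by rintro rfl; simp at hr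
  have h4 : g₄ ≠ 0 := by rintro rfl; simp at hr
  have hne : ∀ j, ![g₁, g₂, g₃, g₄, g₅, g₆] j ≠ 0 := by
    intro j; fin_cases j <;> assumption
  have hm : ∀ j : Fin 4, 0 ≠ j → qPochInf (1 / (g₁ * ![g₁, g₂, g₃, g₄] j)) q ≠ 0 ∧
      qPochInf (q * g₁ * ![g₁, g₂, g₃, g₄] j) q ≠ 0 := by
    intro j hj
    have h := hgen.mul 0 j hj
    constructor
    · refine qPochInf_ne_zero_of_zpow hq fun k hk => h (-k) ?_
      rw [zpow_neg, ← hk]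
      simp
    · refine qPochInf_ne_zero_of_zpow hq fun k hk => h (k - 1) ?_
      rw [zpow_sub_one₀ hq0, ← hk]
      simp
      field_simp
  obtain ⟨n2, n2'⟩ : qPochInf (1 / (g₁ * g₂)) q ≠ 0 ∧ qPochInf (q * g₁ * g₂) q ≠ 0 :=
    hm 1 (by decide)
  obtain ⟨n3, n3'⟩ : qPochInf (1 / (g₁ * g₃)) q ≠ 0 ∧ qPochInf (q * g₁ * g₃) q ≠ 0 :=
    hm 2 (by decide)
  obtain ⟨n4, n4'⟩ : qPochInf (1 / (g₁ * g₄)) q ≠ 0 ∧ qPochInf (q * g₁ * g₄) q ≠ 0 :=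
    hm 3 (by decide)
  have hsq : ∀ k : ℤ, g₁ ^ 2 ≠ q ^ k := hgen.sq 0
  have n1 : 1 - g₁⁻¹ ^ 2 ≠ 0 := by
    intro h
    apply hsq 0
    field_simp at h
    rw [zpow_zero]
    linear_combination h
  have n1' : qPochInf (q * g₁ ^ 2) q ≠ 0 := by
    refine qPochInf_ne_zero_of_zpow hq fun k hk => hsq (k - 1) ?_
    rw [zpow_sub_one₀ hq0, ← hk]
    field_simp
  have hφ := tsum_wpPhiTerm_mul hq0 hq (γ := ![g₁, g₂, g₃, g₄, g₅, g₆]) (i := 0) hne n1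
    fun j => (qPochInf_ne_zero_iff hq).mp (hd j)
  have key := wpSeries_three_term_of_generic hq0 hq hr h₅ hz hz' hgen hx
  have t : ∀ y, qTheta (1 / (g₁ * y)) q = qPochInf (1 / (g₁ * y)) q * qPochInf (q * g₁ * y) q := by
    intro y
    rw [qTheta, show q / (1 / (g₁ * y)) = q * g₁ * y by rw [div_div_eq_mul_div]; ring]
  have t1 : qTheta (1 / g₁ ^ 2) q =
      (1 - g₁⁻¹ ^ 2) * qPochInf (q / g₁ ^ 2) q * qPochInf (q * g₁ ^ 2) q := by
    rw [qTheta, qPochInf_succ (1 / g₁ ^ 2) hq, show q / (1 / g₁ ^ 2) = q * g₁ ^ 2 by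
      rw [div_div_eq_mul_div]; ring, show 1 / g₁ ^ 2 * q = q / g₁ ^ 2 by ring, inv_pow, one_div]
  have e1 : q * g₁ * g₁⁻¹ = q := by field_simp
  have e2 : q * g₁ / g₁⁻¹ = q * g₁ ^ 2 := by rw [div_inv_eq_mul]; ring
  have e3 : ∀ y, q * y * g₁⁻¹ = q * y / g₁ := fun y => by ring
  have e4 : ∀ y, q * y / g₁⁻¹ = q * g₁ * y := fun y => by rw [div_inv_eq_mul]; ring
  simp only [Fin.prod_univ_six] at hφ
  change (∑' k, wpPhiTerm q g₁⁻¹ ![g₁, g₂, g₃, g₄, g₅, g₆] k) * ((1 - g₁⁻¹ ^ 2) *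
    (qPochInf (q * g₁ * g₁⁻¹) q * qPochInf (q * g₁ / g₁⁻¹) q *
    (qPochInf (q * g₂ * g₁⁻¹) q * qPochInf (q * g₂ / g₁⁻¹) q) *
    (qPochInf (q * g₃ * g₁⁻¹) q * qPochInf (q * g₃ / g₁⁻¹) q) *
    (qPochInf (q * g₄ * g₁⁻¹) q * qPochInf (q * g₄ / g₁⁻¹) q) *
    (qPochInf (q * g₅ * g₁⁻¹) q * qPochInf (q * g₅ / g₁⁻¹) q) *
    (qPochInf (q * g₆ * g₁⁻¹) q * qPochInf (q * g₆ / g₁⁻¹) q))) =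
      wpSeries q g₁⁻¹ ![g₁, g₂, g₃, g₄, g₅, g₆] at hφ
  rw [e1, e2] at hφ
  simp only [e3, e4] at hφ
  rw [← hφ, t g₂, t g₃, t g₄, t1] at key
  -- The common factor of the three terms, nonzero by genericity.
  have hn : (1 - g₁⁻¹ ^ 2) * qPochInf (q * g₁ ^ 2) q * (qPochInf (1 / (g₁ * g₂)) q *
      qPochInf (q * g₁ * g₂) q * (qPochInf (1 / (g₁ * g₃)) q * qPochInf (q * g₁ * g₃) q) *
      (qPochInf (1 / (g₁ * g₄)) q * qPochInf (q * g₁ * g₄) q)) ≠ 0 := by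
    simp only [ne_eq, mul_eq_zero, not_or]
    exact ⟨⟨n1, n1'⟩, ⟨⟨n2, n2'⟩, n3, n3'⟩, n4, n4'⟩
  refine mul_right_cancel₀ hn ?_
  linear_combination key

end Specialization

/-! ### Removal of genericity by continuity. -/

section ThreeTermRelation

open Filter Topology MeasureTheory

theorem continuousAt_wpSeries {q : ℂ} (hq0 : q ≠ 0) (hq : ‖q‖ < 1) {p : ℂ × (Fin 6 → ℂ)}
    (hx : p.1 ≠ 0) (hγ : ‖q ^ 2 * ∏ j, p.2 j‖ < 1) :
    ContinuousAt (fun p : ℂ × (Fin 6 → ℂ) => wpSeries q p.1 p.2) p := by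
  obtain ⟨u, hu, h⟩ := exists_summable_bound_wpTerm hq0 hq hx hγ
  exact tendsto_tsum_of_dominated_convergence hu (fun k => continuousAt_wpTerm hq0 hq hx k) h

theorem continuousAt_vec_six {X : Type*} [TopologicalSpace X] {v₀ : X} {f₁ f₂ f₃ f₄ f₅ f₆ : X → ℂ}
    (h₁ : ContinuousAt f₁ v₀) (h₂ : ContinuousAt f₂ v₀) (h₃ : ContinuousAt f₃ v₀)
    (h₄ : ContinuousAt f₄ v₀) (h₅ : ContinuousAt f₅ v₀) (h₆ : ContinuousAt f₆ v₀) :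
    ContinuousAt (fun v => ![f₁ v, f₂ v, f₃ v, f₄ v, f₅ v, f₆ v]) v₀ := by
  rw [continuousAt_pi]
  intro j
  fin_cases j <;> assumption

/-- The three-term relation for very-well-poised series, with the unilateral series in terms of
`wpPhiTerm`. -/
theorem wpSeries_phi_three_term {q r x g₁ g₂ g₃ g₄ g₅ g₆ : ℂ} (hq0 : q ≠ 0)
    (hq : ‖q‖ < 1) (hr : r ^ 2 * (q * (g₁ * g₂ * g₃ * g₄)) = 1) (h₅ : g₅ ≠ 0) (h₆ : g₆ ≠ 0)
    (hz : ‖q ^ 2 * (g₁ * g₂ * g₃ * g₄ * g₅ * g₆)‖ < 1) (hz' : ‖q * g₅ * g₆‖ < 1)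
    (hx : x ≠ 0) (hg : 1 - g₁⁻¹ ^ 2 ≠ 0)
    (hd : ∀ j, qPochInf (q * ![g₁, g₂, g₃, g₄, g₅, g₆] j * g₁⁻¹) q ≠ 0) :
    wpSeries q x ![g₁, g₂, g₃, g₄, g₅, g₆] *
      (qTheta ((r * x) ^ 2) q * qTheta (r ^ 2 * g₁ * x) q * qPochInf (q * g₅ * g₆ / r ^ 2) q *
        (qPochInf (1 / (g₁ * g₂)) q * qPochInf (1 / (g₁ * g₃)) q * qPochInf (1 / (g₁ * g₄)) q) *
        qPochInf (q / g₁ ^ 2) q) =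
    wpSeries q (r * x) ![r * g₁, r * g₂, r * g₃, r * g₄, g₅ / r, g₆ / r] *
      (r ^ 2 * (qPochInf (q * g₂ * g₃) q * qPochInf (q * g₂ * g₄) q * qPochInf (q * g₃ * g₄) q *
          qPochInf (q * g₅ * g₆) q) * qTheta (g₁ * x) q * qTheta (x ^ 2) q *
        qPochInf (q / g₁ ^ 2) q) +
    (∑' k, wpPhiTerm q g₁⁻¹ ![g₁, g₂, g₃, g₄, g₅, g₆] k) *
      (qPochInf q q * (qPochInf (q * g₂ / g₁) q * qPochInf (q * g₃ / g₁) q *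
          qPochInf (q * g₄ / g₁) q * qPochInf (q * g₅ / g₁) q * qPochInf (q * g₆ / g₁) q) *
        (qPochInf (q * g₁ * g₅) q * qPochInf (q * g₁ * g₆) q) *
        qTheta (r ^ 2) q * (qTheta (x / g₂) q * qTheta (x / g₃) q * qTheta (x / g₄) q) *
        qPochInf (q * g₅ * g₆ / r ^ 2) q * qTheta (x ^ 2) q * qTheta ((r * x) ^ 2) q) := by
  have h1 : g₁ ≠ 0 := by rintro rfl; simp at hr
  have h2 : g₂ ≠ 0 := by rintro rfl; simp at hr
  have h3 : g₃ ≠ 0 := by rintro rfl; simp at hr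
  have h4 : g₄ ≠ 0 := by rintro rfl; simp at hr
  have hr0 : r ≠ 0 := by rintro rfl; simp at hr
  have hne : ∀ j, ![g₁, g₂, g₃, g₄, g₅, g₆] j ≠ 0 := by
    intro j; fin_cases j <;> assumption
  -- The deformation passes through the given parameters at `v = 1` and keeps `g₁ * g₂ * g₃ * g₄`,
  -- hence also `r` and both convergence conditions, fixed.
  obtain ⟨f₁, hf₁⟩ : ∃ f : ℂ → ℂ, f = fun v => g₁ * v ^ (-6 : ℤ) := ⟨_, rfl⟩
  obtain ⟨f₂, hf₂⟩ : ∃ f : ℂ → ℂ, f = fun v => g₂ * v ^ (1 : ℤ) := ⟨_, rfl⟩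
  obtain ⟨f₃, hf₃⟩ : ∃ f : ℂ → ℂ, f = fun v => g₃ * v ^ (2 : ℤ) := ⟨_, rfl⟩
  obtain ⟨f₄, hf₄⟩ : ∃ f : ℂ → ℂ, f = fun v => g₄ * v ^ (3 : ℤ) := ⟨_, rfl⟩
  have hc : ∀ (g : ℂ) (n : ℤ), ContinuousAt (fun v : ℂ => g * v ^ n) 1 := fun g n =>
    continuousAt_const.mul (continuousAt_id.zpow₀ n (Or.inl one_ne_zero))
  have c₁ : ContinuousAt f₁ 1 := hf₁ ▸ hc _ _
  have c₂ : ContinuousAt f₂ 1 := hf₂ ▸ hc _ _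
  have c₃ : ContinuousAt f₃ 1 := hf₃ ▸ hc _ _
  have c₄ : ContinuousAt f₄ 1 := hf₄ ▸ hc _ _
  have o₁ : f₁ 1 = g₁ := by simp [hf₁]
  have o₂ : f₂ 1 = g₂ := by simp [hf₂]
  have o₃ : f₃ 1 = g₃ := by simp [hf₃]
  have o₄ : f₄ 1 = g₄ := by simp [hf₄]
  have hprod : ∀ v : ℂ, v ≠ 0 → f₁ v * f₂ v * f₃ v * f₄ v = g₁ * g₂ * g₃ * g₄ := by
    intro v hv
    have : v ^ (-6 : ℤ) * v ^ (1 : ℤ) * v ^ (2 : ℤ) * v ^ (3 : ℤ) = 1 := by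
      rw [← zpow_add₀ hv, ← zpow_add₀ hv, ← zpow_add₀ hv]
      exact zpow_zero v
    rw [hf₁, hf₂, hf₃, hf₄]
    linear_combination g₁ * g₂ * g₃ * g₄ * this
  have hgen : ∀ᵐ v : ℂ, WPGeneric q ![f₁ v, f₂ v, f₃ v, f₄ v] g₅ := by
    have := ae_wpGeneric q (g := ![g₁, g₂, g₃, g₄]) (s := g₅)
      (by intro j; fin_cases j <;> assumption) h₅
    filter_upwards [this] with v hv
    convert hv using 1
    rw [hf₁, hf₂, hf₃, hf₄]
    funext j
    fin_cases j <;> rfl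
  have hcv := continuousAt_vec_six c₁ c₂ c₃ c₄ (continuousAt_const (y := g₅))
    (continuousAt_const (y := g₆))
  have hinv : ContinuousAt (fun v => (f₁ v)⁻¹) 1 := c₁.inv₀ (by rwa [o₁])
  have hd' : ∀ᶠ v in 𝓝 1, ∀ j,
      qPochInf (q * ![f₁ v, f₂ v, f₃ v, f₄ v, g₅, g₆] j * (f₁ v)⁻¹) q ≠ 0 := by
    rw [eventually_all]
    intro j
    refine ContinuousAt.eventually_ne (ContinuousAt.qPochInf hq
      ((continuousAt_const.mul (continuousAt_pi.mp hcv j)).mul hinv)) ?_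
    rw [o₁, o₂, o₃, o₄]
    exact hd j
  have hv0 : ∀ᶠ v in 𝓝 (1 : ℂ), v ≠ 0 := continuousAt_id.eventually_ne one_ne_zero
  -- A property that holds almost everywhere holds on a dense set, hence at points arbitrarily close
  -- to `1`.
  have hfreq : ∃ᶠ v in 𝓝 (1 : ℂ), WPGeneric q ![f₁ v, f₂ v, f₃ v, f₄ v] g₅ :=
    mem_closure_iff_frequently.mp (Measure.dense_of_ae hgen 1)
  have key := (hfreq.and_eventually (hd'.and hv0)).mono fun v ⟨hv1, hv2, hv3⟩ =>
    wpSeries_phi_three_term_of_generic hq0 hq (r := r) (x := x) (by rw [hprod v hv3]; exact hr)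
      h₅ h₆ (by rw [hprod v hv3]; exact hz) hz' hv1 hx hv2
  have ho : ![f₁ 1, f₂ 1, f₃ 1, f₄ 1, g₅, g₆] = ![g₁, g₂, g₃, g₄, g₅, g₆] := by
    rw [o₁, o₂, o₃, o₄]
  have hP : ∏ j, ![g₁, g₂, g₃, g₄, g₅, g₆] j = g₁ * g₂ * g₃ * g₄ * g₅ * g₆ := Fin.prod_univ_six _
  have hP' : ∏ j, ![r * g₁, r * g₂, r * g₃, r * g₄, g₅ / r, g₆ / r] j =
      (r * g₁) * (r * g₂) * (r * g₃) * (r * g₄) * (g₅ / r) * (g₆ / r) := Fin.prod_univ_six _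
  have w₁ : ContinuousAt (fun v => wpSeries q x ![f₁ v, f₂ v, f₃ v, f₄ v, g₅, g₆]) 1 := by
    refine ContinuousAt.comp (f := fun v => (x, ![f₁ v, f₂ v, f₃ v, f₄ v, g₅, g₆]))
      (g := fun p : ℂ × (Fin 6 → ℂ) => wpSeries q p.1 p.2)
      (continuousAt_wpSeries hq0 hq hx ?_) (continuousAt_const.prodMk hcv)
    rw [ho, hP]
    exact hz
  have w₂ : ContinuousAt (fun v => wpSeries q (r * x)
      ![r * f₁ v, r * f₂ v, r * f₃ v, r * f₄ v, g₅ / r, g₆ / r]) 1 := by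
    refine ContinuousAt.comp
      (f := fun v => (r * x, ![r * f₁ v, r * f₂ v, r * f₃ v, r * f₄ v, g₅ / r, g₆ / r]))
      (g := fun p : ℂ × (Fin 6 → ℂ) => wpSeries q p.1 p.2)
      (continuousAt_wpSeries hq0 hq (mul_ne_zero hr0 hx) ?_) (continuousAt_const.prodMk
        (continuousAt_vec_six (continuousAt_const.mul c₁) (continuousAt_const.mul c₂)
          (continuousAt_const.mul c₃) (continuousAt_const.mul c₄) continuousAt_const
          continuousAt_const))
    rw [o₁, o₂, o₃, o₄, hP']
    convert hz' using 2
    field_simp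
    linear_combination hr
  have w₃ : ContinuousAt (fun v => ∑' k, wpPhiTerm q (f₁ v)⁻¹
      ![f₁ v, f₂ v, f₃ v, f₄ v, g₅, g₆] k) 1 := by
    refine ContinuousAt.comp (f := fun v => ((f₁ v)⁻¹, ![f₁ v, f₂ v, f₃ v, f₄ v, g₅, g₆]))
      (g := fun p : ℂ × (Fin 6 → ℂ) => ∑' k, wpPhiTerm q p.1 p.2 k)
      (continuousAt_tsum_wpPhiTerm hq ?_ ?_ ?_ ?_) (hinv.prodMk hcv)
    · rw [o₁]; exact hg
    · rw [ho]; exact hne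
    · rw [ho, o₁]; exact fun j => (qPochInf_ne_zero_iff hq).mp (hd j)
    · rw [ho, hP]; exact hz
  have hm : ∀ {f f' : ℂ → ℂ}, ContinuousAt f 1 → ContinuousAt f' 1 → f 1 ≠ 0 → f' 1 ≠ 0 →
      ContinuousAt (fun v => qPochInf (1 / (f v * f' v)) q) 1 := fun h h' hn hn' =>
    ContinuousAt.qPochInf hq (continuousAt_const.div (h.mul h') (mul_ne_zero hn hn'))
  have hqm : ∀ {f f' : ℂ → ℂ}, ContinuousAt f 1 → ContinuousAt f' 1 →
      ContinuousAt (fun v => qPochInf (q * f v * f' v) q) 1 := fun h h' =>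
    ContinuousAt.qPochInf hq ((continuousAt_const.mul h).mul h')
  have hqd : ∀ {f f' : ℂ → ℂ}, ContinuousAt f 1 → ContinuousAt f' 1 → f' 1 ≠ 0 →
      ContinuousAt (fun v => qPochInf (q * f v / f' v) q) 1 := fun h h' hn =>
    ContinuousAt.qPochInf hq ((continuousAt_const.mul h).div h' hn)
  have hth : ∀ {f : ℂ → ℂ} {y : ℂ}, ContinuousAt f 1 → f 1 ≠ 0 → y ≠ 0 →
      ContinuousAt (fun v => qTheta (y / f v) q) 1 := fun h hn hy =>
    ContinuousAt.qTheta hq (continuousAt_const.div h hn) (div_ne_zero hy hn)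
  have m₁ : f₁ 1 ≠ 0 := by rwa [o₁]
  have m₂ : f₂ 1 ≠ 0 := by rwa [o₂]
  have m₃ : f₃ 1 ≠ 0 := by rwa [o₃]
  have m₄ : f₄ 1 ≠ 0 := by rwa [o₄]
  have hsq : ContinuousAt (fun v => qPochInf (q / f₁ v ^ 2) q) 1 :=
    ContinuousAt.qPochInf hq (continuousAt_const.div (c₁.pow 2) (pow_ne_zero 2 m₁))
  have ht₁ : ContinuousAt (fun v => qTheta (r ^ 2 * f₁ v * x) q) 1 :=
    ContinuousAt.qTheta hq ((continuousAt_const.mul c₁).mul continuousAt_const)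
      (mul_ne_zero (mul_ne_zero (pow_ne_zero 2 hr0) m₁) hx)
  have ht₂ : ContinuousAt (fun v => qTheta (f₁ v * x) q) 1 :=
    ContinuousAt.qTheta hq (c₁.mul continuousAt_const) (mul_ne_zero m₁ hx)
  have k : ∀ c : ℂ, ContinuousAt (fun _ : ℂ => c) 1 := fun _ => continuousAt_const
  have hL := w₁.mul (((((k (qTheta ((r * x) ^ 2) q)).mul ht₁).mul
    (k (qPochInf (q * g₅ * g₆ / r ^ 2) q))).mul
    (((hm c₁ c₂ m₁ m₂).mul (hm c₁ c₃ m₁ m₃)).mul (hm c₁ c₄ m₁ m₄))).mul hsq)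
  have hR := (w₂.mul (((((k (r ^ 2)).mul ((((hqm c₂ c₃).mul (hqm c₂ c₄)).mul (hqm c₃ c₄)).mul
    (k (qPochInf (q * g₅ * g₆) q)))).mul ht₂).mul (k (qTheta (x ^ 2) q))).mul hsq)).add
    (w₃.mul ((((((((k (qPochInf q q)).mul (((((hqd c₂ c₁ m₁).mul (hqd c₃ c₁ m₁)).mul
      (hqd c₄ c₁ m₁)).mul (hqd (k g₅) c₁ m₁)).mul (hqd (k g₆) c₁ m₁))).mul
      ((hqm c₁ (k g₅)).mul (hqm c₁ (k g₆)))).mul (k (qTheta (r ^ 2) q))).mul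
      (((hth c₂ m₂ hx).mul (hth c₃ m₃ hx)).mul (hth c₄ m₄ hx))).mul
      (k (qPochInf (q * g₅ * g₆ / r ^ 2) q))).mul (k (qTheta (x ^ 2) q))).mul
      (k (qTheta ((r * x) ^ 2) q))))
  -- Both sides are continuous at `v = 1` and agree frequently near it, so they agree there.
  have := tendsto_nhds_unique_of_frequently_eq hL hR key
  simpa only [Pi.mul_apply, Pi.add_apply, o₁, o₂, o₃, o₄] using this

end ThreeTermRelation

theorem eq_div_mul_add_of_mul_eq {y N₁ D₁ p N₂ D₂ N₃ D₃ s K X₁ X₂ : ℂ} (h₁ : D₁ ≠ 0)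
    (h₂ : D₂ ≠ 0) (h₃ : D₃ ≠ 0) (hK : K ≠ 0) (hX₁ : K = D₁ * X₁) (hX₂ : K = D₂ * D₃ * X₂)
    (h : y * K = N₁ * X₁ * p + N₂ * N₃ * X₂ * s) :
    y = N₁ / D₁ * p + N₂ / D₂ * (N₃ / D₃) * s := by
  refine mul_right_cancel₀ hK ?_
  have e₁ : N₁ / D₁ * p * K = N₁ * X₁ * p := by rw [hX₁]; field_simp
  have e₂ : N₂ / D₂ * (N₃ / D₃) * s * K = N₂ * N₃ * X₂ * s := by rw [hX₂]; field_simp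
  rw [add_mul, e₁, e₂, h]

theorem theorem3 (q a b c d e f g μ sa sμ : ℂ)
    (hq0 : q ≠ 0) (hq : ‖q‖ < 1)
    (ha : a ≠ 0) (hb : b ≠ 0) (hc : c ≠ 0) (hd : d ≠ 0) (he : e ≠ 0) (hf : f ≠ 0) (hg : g ≠ 0)
    (hmax : max ‖a ^ 3 * q ^ 2 / (b * c * d * e * f * g)‖ ‖a * q / (f * g)‖ < 1)
    (hμ : μ = b * c * d * e / (a * q))
    -- `sa` and `sμ` are any square roots of `a` and `μ`
    (hsa : sa ^ 2 = a) (hsμ : sμ ^ 2 = μ)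
    -- no denominator in the three series vanishes
    (hψ₁ : PsiDefined [q * sa, -(q * sa), b, c, d, e, f, g]
      [sa, -sa, a * q / b, a * q / c, a * q / d, a * q / e, a * q / f, a * q / g] q)
    (hψ₂ : PsiDefined [q * sμ, -(q * sμ), b, c, d, e, μ * f / a, μ * g / a]
      [sμ, -sμ, μ * q / b, μ * q / c, μ * q / d, μ * q / e, a * q / f, a * q / g] q)
    (hφ : PhiDefined [b / sa, -(b / sa), b * q / c, b * q / d, b * q / e, b * q / f, b * q / g] q)
    -- no denominator of the infinite-product factors vanishes
    (hD₁ : qPochInfs [q / f, q / g, a * q / c, a * q / d, a * q / e, b * c / a, b * d / a,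
      b * e / a, b / μ, μ * q, q / μ, a ^ 2 * q / (μ * f * g)] q ≠ 0)
    (hD₂ : qPochInfs [q / f, q / g, a * q / b, a * q / c, a * q / d, a * q / e, a * q / f,
      a * q / g, b * c / a, b * d / a, b * e / a] q ≠ 0)
    (hD₃ : qPochInfs [q / b, b ^ 2 * q / a, c * d * e / (a * q), a * q ^ 2 / (c * d * e)] q ≠ 0) :
    -- the three series converge absolutely
    Summable (psiTerm [q * sa, -(q * sa), b, c, d, e, f, g]
      [sa, -sa, a * q / b, a * q / c, a * q / d, a * q / e, a * q / f, a * q / g] q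
      (a ^ 3 * q ^ 2 / (b * c * d * e * f * g))) ∧
    Summable (psiTerm [q * sμ, -(q * sμ), b, c, d, e, μ * f / a, μ * g / a]
      [sμ, -sμ, μ * q / b, μ * q / c, μ * q / d, μ * q / e, a * q / f, a * q / g] q
      (a * q / (f * g))) ∧
    Summable (fun k : ℕ => psiTerm
      [b ^ 2 / a, q * b / sa, -(q * b / sa), b * c / a, b * d / a, b * e / a, b * f / a, b * g / a]
      [q, b / sa, -(b / sa), b * q / c, b * q / d, b * q / e, b * q / f, b * q / g] q
      (a ^ 3 * q ^ 2 / (b * c * d * e * f * g)) (k : ℤ)) ∧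
    -- and satisfy the transformation formula
    psiSeries [q * sa, -(q * sa), b, c, d, e, f, g]
      [sa, -sa, a * q / b, a * q / c, a * q / d, a * q / e, a * q / f, a * q / g] q
      (a ^ 3 * q ^ 2 / (b * c * d * e * f * g))
    = qPochInfs [a * q, q / a, a * q / (c * d), a * q / (c * e), a * q / (d * e), a * q / (f * g),
          b / a, μ * q / c, μ * q / d, μ * q / e, a * q / (μ * f), a * q / (μ * g)] q
        / qPochInfs [q / f, q / g, a * q / c, a * q / d, a * q / e, b * c / a, b * d / a,
          b * e / a, b / μ, μ * q, q / μ, a ^ 2 * q / (μ * f * g)] q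
        * psiSeries [q * sμ, -(q * sμ), b, c, d, e, μ * f / a, μ * g / a]
          [sμ, -sμ, μ * q / b, μ * q / c, μ * q / d, μ * q / e, a * q / f, a * q / g] q
          (a * q / (f * g))
      + qPochInfs [q, a * q, q / a, c, d, e, b * q / c, b * q / d, b * q / e, b * q / f,
          b * q / g] q
        / qPochInfs [q / f, q / g, a * q / b, a * q / c, a * q / d, a * q / e, a * q / f,
          a * q / g, b * c / a, b * d / a, b * e / a] q
        * (qPochInfs [a * q / (b * f), a * q / (b * g), b * c * d * e / (a ^ 2 * q),
            a ^ 2 * q ^ 2 / (b * c * d * e)] q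
          / qPochInfs [q / b, b ^ 2 * q / a, c * d * e / (a * q), a * q ^ 2 / (c * d * e)] q)
        * phiSeries
          [b ^ 2 / a, q * b / sa, -(q * b / sa), b * c / a, b * d / a, b * e / a, b * f / a,
            b * g / a]
          [b / sa, -(b / sa), b * q / c, b * q / d, b * q / e, b * q / f, b * q / g] q
          (a ^ 3 * q ^ 2 / (b * c * d * e * f * g)) := by
  obtain ⟨hz₁, hz₂⟩ := max_lt_iff.mp hmax
  have hsa0 : sa ≠ 0 := by rintro rfl; simp at hsa; exact ha hsa.symm
  have hμ0 : μ ≠ 0 := by rw [hμ]; positivity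
  have hsμ0 : sμ ≠ 0 := by rintro rfl; simp at hsμ; exact hμ0 hsμ.symm
  have hμa : μ * a * q = b * c * d * e := by rw [hμ]; field_simp
  -- the series in terms of the normalized series
  have z₁ : a ^ 3 * q ^ 2 / (b * c * d * e * f * g) = q ^ 2 * ∏ j, sa / ![b, c, d, e, f, g] j := by
    rw [Fin.prod_univ_six]
    show _ = q ^ 2 * (sa / b * (sa / c) * (sa / d) * (sa / e) * (sa / f) * (sa / g))
    rw [← hsa]; field_simp
  have z₂ : a * q / (f * g) = q ^ 2 * ∏ j, sμ / ![b, c, d, e, μ * f / a, μ * g / a] j := by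
    rw [Fin.prod_univ_six]
    show _ = q ^ 2 * (sμ / b * (sμ / c) * (sμ / d) * (sμ / e) * (sμ / (μ * f / a)) *
      (sμ / (μ * g / a)))
    have : sμ ^ 6 = μ ^ 3 := by rw [← hsμ]; ring
    field_simp
    rw [this]
    linear_combination -μ ^ 2 * hμa
  have b₁ : ∀ j, ![b, c, d, e, f, g] j ≠ 0 := by intro j; fin_cases j <;> assumption
  have b₂ : ∀ j, ![b, c, d, e, μ * f / a, μ * g / a] j ≠ 0 := by
    intro j
    fin_cases j <;> first | assumption | exact div_ne_zero (mul_ne_zero hμ0 ‹_›) ha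
  have l₁ : ∀ j, ![a * q / b, a * q / c, a * q / d, a * q / e, a * q / f, a * q / g] j =
      q * (sa / ![b, c, d, e, f, g] j) * sa := by
    have : ∀ y, a * q / y = q * (sa / y) * sa := fun y => by rw [← hsa]; ring
    intro j; fin_cases j <;> exact this _
  have l₂ : ∀ j, ![μ * q / b, μ * q / c, μ * q / d, μ * q / e, a * q / f, a * q / g] j =
      q * (sμ / ![b, c, d, e, μ * f / a, μ * g / a] j) * sμ := by
    have h1 : ∀ y, μ * q / y = q * (sμ / y) * sμ := fun y => by rw [← hsμ]; ring
    have h2 : ∀ y, y ≠ 0 → a * q / y = q * (sμ / (μ * y / a)) * sμ := fun y hy => by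
      rw [← h1]; field_simp
    intro j
    fin_cases j
    exacts [h1 _, h1 _, h1 _, h1 _, h2 _ hf, h2 _ hg]
  have s₁ := summable_psiTerm_of_wpTerm hq0 hq hsa0 b₁ l₁ z₁ hz₁ hψ₁
  have s₂ := summable_psiTerm_of_wpTerm hq0 hq hsμ0 b₂ l₂ z₂ hz₂ hψ₂
  have e₁ := psiSeries_mul_eq_wpSeries hq0 hq hsa0 b₁ l₁ z₁ hψ₁
  have e₂ := psiSeries_mul_eq_wpSeries hq0 hq hsμ0 b₂ l₂ z₂ hψ₂
  have n₁ := wpFactor_ne_zero hq (x := sa)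
    (l := ![a * q / b, a * q / c, a * q / d, a * q / e, a * q / f, a * q / g]) b₁ hψ₁
  have n₂ := wpFactor_ne_zero hq (x := sμ)
    (l := ![μ * q / b, μ * q / c, μ * q / d, μ * q / e, a * q / f, a * q / g]) b₂ hψ₂
  have γ₁ : (fun j => sa / ![b, c, d, e, f, g] j) =
      ![sa / b, sa / c, sa / d, sa / e, sa / f, sa / g] := by
    funext j; fin_cases j <;> rfl
  have hr0 : sμ / sa ≠ 0 := div_ne_zero hsμ0 hsa0
  have γ₂ : (fun j => sμ / ![b, c, d, e, μ * f / a, μ * g / a] j) =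
      ![sμ / sa * (sa / b), sμ / sa * (sa / c), sμ / sa * (sa / d), sμ / sa * (sa / e),
        sa / f / (sμ / sa), sa / g / (sμ / sa)] := by
    have h1 : ∀ y, sμ / y = sμ / sa * (sa / y) := fun y => by field_simp
    have h2 : ∀ y, y ≠ 0 → sμ / (μ * y / a) = sa / y / (sμ / sa) := fun y hy => by
      rw [← hsμ, ← hsa]; field_simp
    funext j
    fin_cases j
    exacts [h1 _, h1 _, h1 _, h1 _, h2 _ hf, h2 _ hg]
  have hP : ∀ y ∈ [b / sa, -(b / sa), b * q / c, b * q / d, b * q / e, b * q / f, b * q / g],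
    ∀ n : ℕ, y * q ^ n ≠ 1 := hφ
  have hx₁ := hP (b / sa) (by simp)
  have hx₂ := hP (-(b / sa)) (by simp)
  have hinv : (sa / b)⁻¹ = b / sa := inv_div _ _
  have t₃ : ∀ k : ℕ, psiTerm
      [b ^ 2 / a, q * b / sa, -(q * b / sa), b * c / a, b * d / a, b * e / a, b * f / a, b * g / a]
      [q, b / sa, -(b / sa), b * q / c, b * q / d, b * q / e, b * q / f, b * q / g] q
      (a ^ 3 * q ^ 2 / (b * c * d * e * f * g)) k =
      wpPhiTerm q (sa / b)⁻¹ ![sa / b, sa / c, sa / d, sa / e, sa / f, sa / g] k := by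
    intro k
    have h1 : b ^ 2 / a = (b / sa) ^ 2 := by rw [← hsa]; ring
    have hu : ∀ y, b * y / a = b / sa / (sa / y) := fun y => by
      rw [← hsa, div_div_eq_mul_div]; ring
    have hl : ∀ y, b * q / y = q * (sa / y) * (b / sa) := fun y => by field_simp
    rw [h1, mul_div_assoc q b sa, hinv]
    refine psiTerm_eq_wpPhiTerm (u := ![b * c / a, b * d / a, b * e / a, b * f / a, b * g / a])
      (l := ![b * q / c, b * q / d, b * q / e, b * q / f, b * q / g]) (div_ne_zero hb hsa0)
      (inv_div _ _).symm ?_ ?_ (by rw [z₁, γ₁]) hx₁ hx₂ k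
    · intro j; fin_cases j <;> exact hu _
    · intro j; fin_cases j <;> exact hl _
  have hγ₁ : ‖q ^ 2 * ∏ j, ![sa / b, sa / c, sa / d, sa / e, sa / f, sa / g] j‖ < 1 := by
    rw [← γ₁, ← z₁]; exact hz₁
  have hγ0 : ∀ j, ![sa / b, sa / c, sa / d, sa / e, sa / f, sa / g] j ≠ 0 := by
    intro j; fin_cases j <;> exact div_ne_zero hsa0 ‹_›
  have hx : 1 - (sa / b)⁻¹ ^ 2 ≠ 0 := by
    rw [hinv, show 1 - (b / sa) ^ 2 = (1 - b / sa * q ^ 0) * (1 - -(b / sa) * q ^ 0) by ring]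
    exact mul_ne_zero (sub_ne_zero.mpr (hx₁ 0).symm) (sub_ne_zero.mpr (hx₂ 0).symm)
  have hdj : ∀ j, qPochInf (q * ![sa / b, sa / c, sa / d, sa / e, sa / f, sa / g] j *
      (sa / b)⁻¹) q ≠ 0 := by
    have h0 : q * (sa / b) * (sa / b)⁻¹ = q := by field_simp
    have h1 : ∀ y, b * q / y ∈ [b / sa, -(b / sa), b * q / c, b * q / d, b * q / e, b * q / f,
        b * q / g] → qPochInf (q * (sa / y) * (sa / b)⁻¹) q ≠ 0 := fun y hy => by
      rw [show q * (sa / y) * (sa / b)⁻¹ = b * q / y by field_simp, qPochInf_ne_zero_iff hq]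
      exact hP _ hy
    intro j
    fin_cases j
    · show qPochInf (q * (sa / b) * (sa / b)⁻¹) q ≠ 0
      rw [h0]
      exact qPochInf_self_ne_zero hq
    all_goals exact h1 _ (by simp)
  have s₃ := summable_wpPhiTerm hq hx hγ0 (fun j => (qPochInf_ne_zero_iff hq).mp (hdj j)) hγ₁
  refine ⟨s₁, s₂, s₃.congr fun k => (t₃ k).symm, ?_⟩
  have e₃ : phiSeries
      [b ^ 2 / a, q * b / sa, -(q * b / sa), b * c / a, b * d / a, b * e / a, b * f / a, b * g / a]
      [b / sa, -(b / sa), b * q / c, b * q / d, b * q / e, b * q / f, b * q / g] q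
      (a ^ 3 * q ^ 2 / (b * c * d * e * f * g)) =
      ∑' k, wpPhiTerm q (sa / b)⁻¹ ![sa / b, sa / c, sa / d, sa / e, sa / f, sa / g] k :=
    tsum_congr t₃
  have hrx : sμ / sa * sa = sμ := div_mul_cancel₀ _ hsa0
  -- With these choices `r ^ 2 = μ / a = b * c * d * e / (a ^ 2 * q)`, and `g₁⁻¹ = b / sa` yields
  -- the leading parameter `b ^ 2 / a` of the `₈φ₇`.
  have key := wpSeries_phi_three_term (q := q) (r := sμ / sa) (x := sa) (g₁ := sa / b)
    (g₂ := sa / c) (g₃ := sa / d) (g₄ := sa / e) (g₅ := sa / f) (g₆ := sa / g) hq0 hq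
    (by rw [div_pow, hsμ]; field_simp; rw [← hμa, ← hsa])
    (div_ne_zero hsa0 hf) (div_ne_zero hsa0 hg)
    (by rwa [Fin.prod_univ_six] at hγ₁)
    (by rwa [show q * (sa / f) * (sa / g) = a * q / (f * g) by rw [← hsa]; field_simp])
    hsa0 hx hdj
  rw [hrx, ← γ₁, ← γ₂, ← e₁, ← e₂, γ₁, ← e₃] at key
  simp only [Fin.prod_univ_six, Matrix.cons_val] at key n₁ n₂
  have hF : q * (sa / f) * (sa / g) / (sμ / sa) ^ 2 = a ^ 2 * q / (μ * f * g) := by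
    rw [← hsμ, ← hsa]; field_simp
  have hm : ∀ y, 1 / (sa / b * (sa / y)) = b * y / a := fun y => by
    rw [← hsa, div_mul_div_comm, one_div_div]; ring
  have hb2 : q / (sa / b) ^ 2 = b ^ 2 * q / a := by
    rw [← hsa, div_pow, div_div_eq_mul_div]; ring
  have hqm : ∀ y y', q * (sa / y) * (sa / y') = a * q / (y * y') := fun y y' => by
    rw [← hsa, mul_assoc, div_mul_div_comm]; ring
  have hqd : ∀ y, q * (sa / y) / (sa / b) = b * q / y := fun y => by field_simp
  have hmf : ∀ y, q / (μ * y / a) = a * q / (μ * y) := fun y => by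
    rw [div_div_eq_mul_div]; ring
  have hxd : ∀ y, sa / (sa / y) = y := fun y => div_div_cancel₀ hsa0
  have θone : ∀ y, qTheta y q = (1 - y) * (qPochInf (y * q) q * qPochInf (q / y) q) := fun y => by
    rw [qTheta, qPochInf_succ y hq, mul_assoc]
  have hr2 : (sμ / sa) ^ 2 = b * c * d * e / (a ^ 2 * q) := by
    rw [div_pow, hsμ, hsa, hμ]; field_simp
  have hr2' : q / (b * c * d * e / (a ^ 2 * q)) = a ^ 2 * q ^ 2 / (b * c * d * e) := by
    rw [div_div_eq_mul_div]; ring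
  have hU : (sμ / sa) ^ 2 * (sa / b) * sa = μ / b := by
    rw [← hsμ]; field_simp
  have hU' : μ / b = c * d * e / (a * q) := by rw [hμ]; field_simp
  have hU'' : q / (c * d * e / (a * q)) = a * q ^ 2 / (c * d * e) := by
    rw [div_div_eq_mul_div]; ring
  have hab : sa / b * sa = a / b := by rw [← hsa]; ring
  -- The relation `key` carries `θ(a / b)` and `θ(μ / b)`, while the first coefficient of the
  -- theorem contains `(b / a; q)_∞` and `(b / μ; q)_∞`. Theta inversion at both arguments
  -- reconciles them, the factor `μ / a` being `r ^ 2`.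
  have rel : (sμ / sa) ^ 2 * qTheta (a / b) q * (qPochInf (b / μ) q * qPochInf (μ * q / b) q) =
      qPochInf (b / a) q * qPochInf (a * q / b) q *
        (qPochInf (c * d * e / (a * q)) q * qPochInf (a * q ^ 2 / (c * d * e)) q) := by
    have h1 := qTheta_inv (x := a / b) hq (div_ne_zero ha hb)
    have h2 := qTheta_inv (x := μ / b) hq (div_ne_zero hμ0 hb)
    have h3 : qTheta (b / μ) q = qPochInf (b / μ) q * qPochInf (μ * q / b) q := by
      rw [qTheta, div_div_eq_mul_div, mul_comm q]
    have h4 : qTheta (b / a) q = qPochInf (b / a) q * qPochInf (a * q / b) q := by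
      rw [qTheta, div_div_eq_mul_div, mul_comm q]
    have h5 : qTheta (μ / b) q =
        qPochInf (c * d * e / (a * q)) q * qPochInf (a * q ^ 2 / (c * d * e)) q := by
      rw [hU', qTheta, hU'']
    rw [inv_div] at h1 h2
    rw [← h3, ← h4, ← h5, div_pow, hsμ, hsa]
    have h6 : μ / a * (a / b) = μ / b := by field_simp
    linear_combination (μ / a) * qTheta (b / μ) q * h1 - qTheta (b / a) q * h2 -
      (qTheta (b / a) q * qTheta (b / μ) q) * h6
  have θr : qTheta ((sμ / sa) ^ 2) q = qPochInf (b * c * d * e / (a ^ 2 * q)) q *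
      qPochInf (a ^ 2 * q ^ 2 / (b * c * d * e)) q := by
    rw [hr2, qTheta, hr2']
  rw [θr, hU, hab, hF, hb2, hsa, hsμ, hxd, hxd, hxd, hU'] at key
  simp only [hm, hqm, hqd, hmf] at key
  rw [qTheta.eq_1 (c * d * e / (a * q)), hU'', qTheta.eq_1 c, qTheta.eq_1 d, qTheta.eq_1 e,
    θone a, θone μ] at key
  rw [hsa] at n₁
  rw [hsμ] at n₂
  simp only [qPochInfs, List.map_cons, List.map_nil, List.prod_cons, List.prod_nil, mul_one]
    at hD₁ hD₂ hD₃ ⊢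
  generalize psiSeries _ _ q (a ^ 3 * q ^ 2 / (b * c * d * e * f * g)) = ψ₁ at key ⊢
  generalize psiSeries _ _ q (a * q / (f * g)) = ψ₂ at key ⊢
  generalize phiSeries _ _ q _ = φ at key ⊢
  clear * - key n₁ n₂ hD₁ hD₂ hD₃ rel
  -- Only a polynomial identity remains, so every infinite product is treated as an independent
  -- variable.
  generalize qPochInf (a * q / b) q = Ab at key n₁ n₂ hD₁ hD₂ hD₃ rel ⊢
  generalize qPochInf (q / b) q = Qb at key n₁ n₂ hD₁ hD₂ hD₃ rel ⊢
  generalize qPochInf (a * q / c) q = Ac at key n₁ n₂ hD₁ hD₂ hD₃ rel ⊢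
  generalize qPochInf (q / c) q = Qc at key n₁ n₂ hD₁ hD₂ hD₃ rel ⊢
  generalize qPochInf (a * q / d) q = Ad at key n₁ n₂ hD₁ hD₂ hD₃ rel ⊢
  generalize qPochInf (q / d) q = Qd at key n₁ n₂ hD₁ hD₂ hD₃ rel ⊢
  generalize qPochInf (a * q / e) q = Ae at key n₁ n₂ hD₁ hD₂ hD₃ rel ⊢
  generalize qPochInf (q / e) q = Qe at key n₁ n₂ hD₁ hD₂ hD₃ rel ⊢
  generalize qPochInf (a * q / f) q = Af at key n₁ n₂ hD₁ hD₂ hD₃ rel ⊢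
  generalize qPochInf (q / f) q = Qf at key n₁ n₂ hD₁ hD₂ hD₃ rel ⊢
  generalize qPochInf (a * q / g) q = Ag at key n₁ n₂ hD₁ hD₂ hD₃ rel ⊢
  generalize qPochInf (q / g) q = Qg at key n₁ n₂ hD₁ hD₂ hD₃ rel ⊢
  generalize qPochInf (μ * q / b) q = Mb at key n₁ n₂ hD₁ hD₂ hD₃ rel ⊢
  generalize qPochInf (μ * q / c) q = Mc at key n₁ n₂ hD₁ hD₂ hD₃ rel ⊢
  generalize qPochInf (μ * q / d) q = Md at key n₁ n₂ hD₁ hD₂ hD₃ rel ⊢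
  generalize qPochInf (μ * q / e) q = Me at key n₁ n₂ hD₁ hD₂ hD₃ rel ⊢
  generalize qPochInf (a * q / (μ * f)) q = Mf at key n₁ n₂ hD₁ hD₂ hD₃ rel ⊢
  generalize qPochInf (a * q / (μ * g)) q = Mg at key n₁ n₂ hD₁ hD₂ hD₃ rel ⊢
  generalize qPochInf (b * q / c) q = Tc at key n₁ n₂ hD₁ hD₂ hD₃ rel ⊢
  generalize qPochInf (b * q / d) q = Td at key n₁ n₂ hD₁ hD₂ hD₃ rel ⊢
  generalize qPochInf (b * q / e) q = Te at key n₁ n₂ hD₁ hD₂ hD₃ rel ⊢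
  generalize qPochInf (b * q / f) q = Tf at key n₁ n₂ hD₁ hD₂ hD₃ rel ⊢
  generalize qPochInf (b * q / g) q = Tg at key n₁ n₂ hD₁ hD₂ hD₃ rel ⊢
  generalize qPochInf (b * c / a) q = Bc at key n₁ n₂ hD₁ hD₂ hD₃ rel ⊢
  generalize qPochInf (c) q = Pc at key n₁ n₂ hD₁ hD₂ hD₃ rel ⊢
  generalize qPochInf (b * d / a) q = Bd at key n₁ n₂ hD₁ hD₂ hD₃ rel ⊢
  generalize qPochInf (d) q = Pd at key n₁ n₂ hD₁ hD₂ hD₃ rel ⊢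
  generalize qPochInf (b * e / a) q = Be at key n₁ n₂ hD₁ hD₂ hD₃ rel ⊢
  generalize qPochInf (e) q = Pe at key n₁ n₂ hD₁ hD₂ hD₃ rel ⊢
  generalize qPochInf (a * q / (c * d)) q = Rcd at key n₁ n₂ hD₁ hD₂ hD₃ rel ⊢
  generalize qPochInf (a * q / (c * e)) q = Rce at key n₁ n₂ hD₁ hD₂ hD₃ rel ⊢
  generalize qPochInf (a * q / (d * e)) q = Rde at key n₁ n₂ hD₁ hD₂ hD₃ rel ⊢
  generalize qPochInf (a * q / (f * g)) q = Rfg at key n₁ n₂ hD₁ hD₂ hD₃ rel ⊢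
  generalize qPochInf (a * q / (b * f)) q = Rbf at key n₁ n₂ hD₁ hD₂ hD₃ rel ⊢
  generalize qPochInf (a * q / (b * g)) q = Rbg at key n₁ n₂ hD₁ hD₂ hD₃ rel ⊢
  generalize qPochInf (q) q = Pq at key n₁ n₂ hD₁ hD₂ hD₃ rel ⊢
  generalize qPochInf (a * q) q = Aq at key n₁ n₂ hD₁ hD₂ hD₃ rel ⊢
  generalize qPochInf (q / a) q = Qa at key n₁ n₂ hD₁ hD₂ hD₃ rel ⊢
  generalize qPochInf (μ * q) q = Mq at key n₁ n₂ hD₁ hD₂ hD₃ rel ⊢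
  generalize qPochInf (q / μ) q = Qm at key n₁ n₂ hD₁ hD₂ hD₃ rel ⊢
  generalize qPochInf (b / a) q = Ba at key n₁ n₂ hD₁ hD₂ hD₃ rel ⊢
  generalize qPochInf (b / μ) q = Bm at key n₁ n₂ hD₁ hD₂ hD₃ rel ⊢
  generalize qPochInf (a ^ 2 * q / (μ * f * g)) q = F at key n₁ n₂ hD₁ hD₂ hD₃ rel ⊢
  generalize qPochInf (b ^ 2 * q / a) q = Bq at key n₁ n₂ hD₁ hD₂ hD₃ rel ⊢
  generalize qPochInf (c * d * e / (a * q)) q = U at key n₁ n₂ hD₁ hD₂ hD₃ rel ⊢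
  generalize qPochInf (a * q ^ 2 / (c * d * e)) q = V at key n₁ n₂ hD₁ hD₂ hD₃ rel ⊢
  generalize qPochInf (b * c * d * e / (a ^ 2 * q)) q = X at key n₁ n₂ hD₁ hD₂ hD₃ rel ⊢
  generalize qPochInf (a ^ 2 * q ^ 2 / (b * c * d * e)) q = Y at key n₁ n₂ hD₁ hD₂ hD₃ rel ⊢
  generalize qTheta (a / b) q = T at *
  generalize 1 - a = a' at *
  generalize 1 - μ = μ' at *
  generalize (sμ / sa) ^ 2 = r at *
  -- `K` is the coefficient of the first series in `key`, times `(b / μ; q)_∞ * (μ * q / b; q)_∞`.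
  -- It is a common multiple of the denominators, and all its factors are nonzero by the hypotheses
  -- on the series and products.
  refine eq_div_mul_add_of_mul_eq (K := a' * (Ab * Qb * (Ac * Qc) * (Ad * Qd) * (Ae * Qe) *
    (Af * Qf) * (Ag * Qg)) * (μ' * Mq * Qm * U * V * F * (Bc * Bd * Be) * Bq * (Bm * Mb)))
    (X₁ := a' * Ab * Af * Ag * (Qb * Qc * Qd * Qe) * μ' * U * V * Bq * Mb)
    (X₂ := a' * (Qc * Qd * Qe) * μ' * Mq * Qm * F * (Bm * Mb)) hD₁ hD₂ hD₃ ?_ (by ring) (by ring) ?_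
  · simp only [ne_eq, mul_eq_zero, not_or] at n₁ n₂ hD₁ hD₂ hD₃ ⊢
    tauto
  · linear_combination (Bm * Mb) * key +
      ψ₂ * (μ' * (Mb * Qb * (Mc * Qc) * (Md * Qd) * (Me * Qe) * (Af * Mf) * (Ag * Mg))) *
        (Rcd * Rce * Rde * Rfg) * (a' * (Aq * Qa)) * Bq * rel
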